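/- **Setting.** Let $(\mathfrak t,B)$ be a Euclidean space of dimension $n$ and $\Lambda\subset\mathfrak t$ a lattice of full rank on which $B$ takes integer values (for example the integral lattice of the Lie algebra of a maximal torus $T$ of a compact, connected, simply connected simple Lie group, with the basic inner product $B$, the invariant inner product for which $B(\alpha^\vee,\alpha^\vee)=2$ for long roots $\alpha$). Put $T=\mathfrak t/\Lambda$. On $\mathfrak t^2$, with projections $p,q$, let $\omega=2\pi B(dp,dq)$, and let $L$ be the Hermitian line bundle with connection on $T^2=\mathfrak t^2/\Lambda^2$ that is the quotient of the trivial Hermitian line bundle on $\mathfrak t^2$ with connection $d+\frac{\pi}{i}(B(p,dq)-B(q,dp))$ by the action of $\Lambda^2$ given by $\lambda\cdot(x,v)=(x+\lambda,\ e^{i\pi B(p(\lambda),q(\lambda))}e^{\frac i2\omega(\lambda,x)}v)$. For $\tau$ in the upper half-plane $\mathbb H$, let $j_\tau$ be the complex structure of $T^2$ with complex coordinate $\zeta_\tau=p+\tau q$. Let $\Omega\in\wedge^n(\mathfrak t\otimes\mathbb C)^*$ take the value $1$ on a basis of $\Lambda$, and let $\Omega_\tau$ be the section of the canonical bundle of $(T^2,j_\tau)$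 corresponding to $\Omega$ through $d\zeta_\tau$. Let $\delta_\tau$ be the trivial line bundle on $T^2$ with fibre $\delta=\mathbb C\,\Omega^{1/2}$, with the isomorphism $\delta_\tau^{\otimes2}\simeq\wedge^{n}(T^{1,0}(T^2,j_\tau))^*$ sending $\Omega^{1/2}\otimes\Omega^{1/2}$ to $\Omega_\tau$, and with the induced metric and holomorphic structure, the Hermitian product of tangent vectors being $(X,Y)\mapsto\frac1i\omega(X,\overline Y)$. Let $H_{\tau,k}=H^0_\tau(T^2,L^k\otimes\delta_\tau)$ be the space of holomorphic sections, with the scalar product given by integrating the pointwise product against the Liouville measure $|\omega^n|/n!$. For $\mu\in k^{-1}\Lambda^*$ (where $\Lambda^*\subset\mathfrak t$ is the dual lattice) set $$\Theta^\tau_{\mu,k}=\sum_{\gamma\in\mu+\Lambda}e^{2i\pi k(\frac\tau2B(\gamma,\gamma)-B(\zeta_\tau,\gamma))},\qquad s_\tau=e^{i\pi B(\zeta_\tau,q)} .$$ **Fourier integral operators.** Let $\tau_1,\tau_2\in\mathbb H$. A section $\varphi$ of $\mathrm{Hom}(\delta_{\tau_1},\delta_{\tau_2})$ is a *half-form bundle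 isomorphism* if $\varphi_x^{\otimes 2}=\pi^*:\wedge^{n}E_{\tau_1,x}^*\to\wedge^{n}E_{\tau_2,x}^*$ for every $x\in T^2$, where $E_{\tau}=T^{1,0}(T^2,j_\tau)$ and $\pi:E_{\tau_2,x}\to E_{\tau_1,x}$ is the projection with kernel $\overline{E}_{\tau_2,x}$. The Schwartz kernel of a linear map $S_k:H_{\tau_1,k}\to H_{\tau_2,k}$ is the section of $(L^k\otimes\delta_{\tau_2})\boxtimes(\bar L^k\otimes\bar\delta_{\tau_1})$ over $T^2\times T^2$ corresponding to $S_k$ under $\mathrm{Hom}(H_{\tau_1,k},H_{\tau_2,k})\simeq H_{\tau_2,k}\otimes\overline{H}_{\tau_1,k}$. Endow $T^2\times T^2$ with the complex structure $(j_{\tau_2},-j_{\tau_1})$. A sequence $(S_k)_{k\ge1}$ is a *Fourier integral operator with symbol* the half-form bundle isomorphism $\varphi$ if its Schwartz kernels satisfy $$S_k(x,y)=\Bigl(\frac{k}{2\pi}\Bigr)^nE^k(x,y)f(x,y,k)+O(k^{-\infty})$$ uniformly on $T^2\times T^2$ for the pointwise norms, where - $E$ is a smooth section of $L\boxtimes\bar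 L$ with $\|E(x,y)\|<1$ for $x\ne y$, $E(x,x)=u\otimes\bar u$ for every $u\in L_x$ of norm $1$, and $\bar\partial E$ vanishes to any order along the diagonal; - $(f(\cdot,k))_k$ is a sequence of smooth sections of $\delta_{\tau_2}\boxtimes\bar\delta_{\tau_1}$ with an asymptotic expansion $f_0+k^{-1}f_1+k^{-2}f_2+\cdots$ in the $C^\infty$ topology, where every $f_i$ is smooth and $\bar\partial f_i$ vanishes to any order along the diagonal; - the restriction of $f_0$ to the diagonal is $\varphi$, when $\delta_{\tau_2}\otimes\bar\delta_{\tau_1}$ is identified with $\mathrm{Hom}(\delta_{\tau_1},\delta_{\tau_2})$ by the metric of $\delta_{\tau_1}$. **Theorem.** Let $\tau_1,\tau_2\in\mathbb H$. For every integer $k\ge1$ and $\tau\in\{\tau_1,\tau_2\}$ the sections $\Theta^{\tau}_{\mu,k}s_{\tau}^k\otimes\Omega^{1/2}$, $\mu\in k^{-1}\Lambda^*\bmod\Lambda$, form a basis of $H_{\tau,k}$, and the linear isomorphism $\Psi_{\tau_1,\tau_2,k}:H_{\tau_1,k}\to H_{\tau_2,k}$ defined by $$\Psi_{\tau_1,\tau_2,k}\bigl(\Theta^{\tau_1}_{\mu,k}s_{\tau_1}^k\otimes\Omega^{1/2}\bigr)=\Theta^{\tau_2}_{\mu,k}s_{\tau_2}^k\otimes\Omega^{1/2}\qquad\text{for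 all }\mu$$ is unitary. The sequence $(\Psi_{\tau_1,\tau_2,k})_{k\ge1}$ is a Fourier integral operator with symbol the half-form bundle isomorphism $\varphi_{\tau_1,\tau_2}$ given by $$\varphi_{\tau_1,\tau_2}(\Omega^{1/2})=\Bigl(\frac{\tau_1-\bar\tau_1}{\tau_2-\bar\tau_1}\Bigr)^{n/2}\Omega^{1/2},$$ where the power is the determination which is continuous in $(\tau_1,\tau_2)$ and equal to $1$ when $\tau_1=\tau_2$. -/

import Mathlib

open Module
open scoped InnerProductSpace ContDiff ComplexConjugate TensorProduct UpperHalfPlane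

noncomputable section

namespace TorusQuantization

/-! Throughout, `V` is the Euclidean space `𝔱` with inner product `B = ⟪·,·⟫_ℝ`, `Λ` is a lattice
in `V` on which `B` is integer valued, and `(p, q)` is a point of `V × V`. Objects living on the
torus `T² = (V × V) / Λ²` are described by their lifts to `V × V`. In particular a section of the
prequantum bundle `L = (V × V × ℂ) / Λ²` is a `Λ²`-invariant section of the trivial bundle. -/

section Lattice

/-- The coroot lattice of an irreducible reduced root system with coroots in `V`, for a Weyl
invariant inner product in which the short coroots (those of the long roots) have square length
`2`, is a lattice of full rank on which the inner product is integer valued. So the lattices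
considered below include the integral lattice of a maximal torus of each compact connected simply
connected simple Lie group, with the basic inner product. -/
theorem corootLattice_integral {V ι M : Type*} [NormedAddCommGroup V] [InnerProductSpace ℝ V]
    [Finite ι] [AddCommGroup M] [Module ℝ M] (P : RootPairing ι ℝ M V)
    [P.IsRootSystem] [P.IsCrystallographic] [P.IsReduced] [P.IsIrreducible]
    (hinv : ∀ (i : ι) (x y : V), ⟪P.coreflection i x, P.coreflection i y⟫_ℝ = ⟪x, y⟫_ℝ)
    (hnorm : ∀ i : ι, (∀ j, ⟪P.coroot i, P.coroot i⟫_ℝ ≤ ⟪P.coroot j, P.coroot j⟫_ℝ) →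
      ⟪P.coroot i, P.coroot i⟫_ℝ = 2) :
    (∀ a ∈ Submodule.span ℤ (Set.range P.coroot), ∀ b ∈ Submodule.span ℤ (Set.range P.coroot),
        ∃ m : ℤ, ⟪a, b⟫_ℝ = m) ∧
      DiscreteTopology (Submodule.span ℤ (Set.range P.coroot)) ∧
      Submodule.span ℝ (Submodule.span ℤ (Set.range P.coroot) : Set V) = ⊤ := by
  let B : P.flip.InvariantForm :=
    { form := innerₗ V
      symm := ⟨fun x y => by simp [real_inner_comm]⟩
      ne_zero := fun i => by
        have := P.ne_zero' i
        simpa using this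
      isOrthogonal_reflection := fun i x y => hinv i x y }
  have hB : ∀ x y, B.form x y = ⟪x, y⟫_ℝ := fun x y => rfl
  have key : ∀ j, ∃ m : ℤ, ⟪P.coroot j, P.coroot j⟫_ℝ = 2 * m := by
    intro j
    have : Nonempty ι := ⟨j⟩
    obtain ⟨i, hi⟩ := Finite.exists_min (fun i => ⟪P.coroot i, P.coroot i⟫_ℝ)
    have h2 := hnorm i hi
    have hj := hi j
    have h := B.apply_eq_or i j
    simp only [hB, RootPairing.flip_root, h2] at h hj
    rcases h with h | h | h | h | h
    · exact ⟨1, by push_cast; linarith⟩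
    · linarith
    · linarith
    · exact ⟨2, by push_cast; linarith⟩
    · exact ⟨3, by push_cast; linarith⟩
  have hint : ∀ a ∈ Submodule.span ℤ (Set.range P.coroot),
      ∀ b ∈ Submodule.span ℤ (Set.range P.coroot), ∃ m : ℤ, ⟪a, b⟫_ℝ = m := by
    intro a ha b hb
    induction ha, hb using Submodule.span_induction₂ with
    | mem_mem x y hx hy =>
      obtain ⟨i, rfl⟩ := hx
      obtain ⟨j, rfl⟩ := hy
      obtain ⟨m, hm⟩ := key j
      have h := B.two_mul_apply_root_root i j
      simp only [hB, RootPairing.flip_root, hm] at h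
      refine ⟨P.flip.pairingIn ℤ i j * m, ?_⟩
      have h' : P.flip.pairing i j = (P.flip.pairingIn ℤ i j : ℝ) := by
        simpa using (P.flip.algebraMap_pairingIn ℤ i j).symm
      rw [h'] at h
      push_cast
      linarith
    | zero_left y hy => exact ⟨0, by simp⟩
    | zero_right x hx => exact ⟨0, by simp⟩
    | add_left x y z _ _ _ h1 h2 =>
      obtain ⟨m, hm⟩ := h1
      obtain ⟨l, hl⟩ := h2
      exact ⟨m + l, by rw [inner_add_left, hm, hl]; push_cast; ring⟩
    | add_right x y z _ _ _ h1 h2 =>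
      obtain ⟨m, hm⟩ := h1
      obtain ⟨l, hl⟩ := h2
      exact ⟨m + l, by rw [inner_add_right, hm, hl]; push_cast; ring⟩
    | smul_left r x y _ _ h =>
      obtain ⟨m, hm⟩ := h
      exact ⟨r * m, by
        rw [← Int.cast_smul_eq_zsmul ℝ, real_inner_smul_left, hm]; push_cast; ring⟩
    | smul_right r x y _ _ h =>
      obtain ⟨m, hm⟩ := h
      exact ⟨r * m, by
        rw [← Int.cast_smul_eq_zsmul ℝ, real_inner_smul_right, hm]; push_cast; ring⟩
  refine ⟨hint, ?_, ?_⟩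
  · rw [discreteTopology_iff_isOpen_singleton_zero, Metric.isOpen_singleton_iff]
    refine ⟨1, one_pos, fun y hy => ?_⟩
    obtain ⟨m, hm⟩ := hint y y.2 y y.2
    rw [dist_zero_right] at hy
    have h1 : ‖(y : V)‖ < 1 := hy
    rw [real_inner_self_eq_norm_sq] at hm
    have h3 : (m : ℝ) < 1 := by rw [← hm]; nlinarith [norm_nonneg (y : V)]
    have h4 : (0 : ℝ) ≤ m := by rw [← hm]; positivity
    have h5 : m = 0 := by
      have : m < 1 := by exact_mod_cast h3
      have : 0 ≤ m := by exact_mod_cast h4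
      omega
    rw [h5] at hm
    have : (y : V) = 0 := by simpa using hm
    exact Subtype.ext this
  · rw [Submodule.span_span_of_tower]
    exact RootPairing.IsRootSystem.span_coroot_eq_top

end Lattice

variable {V : Type*} [NormedAddCommGroup V] [InnerProductSpace ℝ V]

section Prequantum

/-- The symplectic form `2π B(dp, dq)` on `V × V`, i.e.
`((p, q), (p', q')) ↦ 2π (B(p, q') - B(q, p'))`. -/
def symplForm (V : Type*) [NormedAddCommGroup V] [InnerProductSpace ℝ V] :
    LinearMap.BilinForm ℝ (V × V) :=
  (2 * Real.pi) •
    ((innerₗ V).compl₁₂ (LinearMap.fst ℝ V V) (LinearMap.snd ℝ V V) -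
      (innerₗ V).compl₁₂ (LinearMap.snd ℝ V V) (LinearMap.fst ℝ V V))

theorem symplForm_apply (x y : V × V) :
    symplForm V x y = 2 * Real.pi * (⟪x.1, y.2⟫_ℝ - ⟪x.2, y.1⟫_ℝ) := rfl

/-- The embedding `(p, q) ↦ (p, q, exp(iπ B(p, q)))` of `Λ²` in the Heisenberg group
`(V × V) × U(1)`, with product `(x, u)(y, v) = (x + y, u v exp((i/2) ω(x, y)))`, makes `lam ∈ Λ²`
act on the trivial line bundle by `(x, v) ↦ (lam + x, multiplier lam x * v)`. -/
def multiplier (lam x : V × V) : ℂ :=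
  Complex.exp (Complex.I * Real.pi * (⟪lam.1, lam.2⟫_ℝ : ℂ)) *
    Complex.exp (Complex.I / 2 * (symplForm V lam x : ℂ))

/-- The sections of `L ^ k` over `T²`: the `Λ²`-invariant functions. -/
def IsInvariant (Λ : Submodule ℤ V) (k : ℕ) (s : V × V → ℂ) : Prop :=
  ∀ lam : V × V, lam.1 ∈ Λ → lam.2 ∈ Λ → ∀ x, s (lam + x) = multiplier lam x ^ k * s x

/-- The connection form `(π/i) (B(p, dq) - B(q, dp))` of `L`. -/
def connForm (x X : V × V) : ℂ :=
  (Real.pi : ℂ) / Complex.I * ((⟪x.1, X.2⟫_ℝ - ⟪x.2, X.1⟫_ℝ : ℝ) : ℂ)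

/-- The covariant derivative on `L ^ k`, at `x` in the direction `X`. -/
def nabla (k : ℕ) (s : V × V → ℂ) (x X : V × V) : ℂ :=
  fderiv ℝ s x X + k * connForm x X * s x

end Prequantum

section Complex

/-- The complex structure `j_τ` of `V × V`: multiplication by `i` in the complex coordinate
`ζ = p + τ q`. -/
def complexStructure (V : Type*) [NormedAddCommGroup V] [InnerProductSpace ℝ V] (τ : ℍ) :
    (V × V) →ₗ[ℝ] (V × V) :=
  LinearMap.prod
    (-(τ.re / τ.im) • LinearMap.fst ℝ V V - (Complex.normSq τ / τ.im) • LinearMap.snd ℝ V V)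
    ((1 / τ.im) • LinearMap.fst ℝ V V + (τ.re / τ.im) • LinearMap.snd ℝ V V)

/-- The quantum space `H⁰_τ(T², L^k ⊗ δ_τ)`. The bundle `δ_τ` is trivialised by its holomorphic
section `Ω^{1/2}`, and a section of `L^k ⊗ δ_τ` is written `s ⊗ Ω^{1/2}`. The section is
holomorphic when `∇_{Z̄} s = 0` for all `Z` of type `(1, 0)`, i.e. `∇_{jX} s = i ∇_X s` for all real
tangent vectors `X`. -/
def quantumSpace (Λ : Submodule ℤ V) (τ : ℍ) (k : ℕ) : Submodule ℂ (V × V → ℂ) where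
  carrier := {s | ContDiff ℝ ∞ s ∧ IsInvariant Λ k s ∧
    ∀ x X, nabla k s x (complexStructure V τ X) = Complex.I * nabla k s x X}
  zero_mem' := by
    refine ⟨contDiff_const, fun _ _ _ _ => by simp, fun x X => ?_⟩
    have : fderiv ℝ (0 : V × V → ℂ) x = 0 := fderiv_const_apply 0
    simp [nabla, this]
  add_mem' := by
    rintro s t ⟨hs, hs', hs''⟩ ⟨ht, ht', ht''⟩
    refine ⟨hs.add ht, fun l h1 h2 x => ?_, fun x X => ?_⟩
    · simp only [Pi.add_apply, hs' l h1 h2 x, ht' l h1 h2 x]; ring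
    · have e : ∀ Y, nabla k (s + t) x Y = nabla k s x Y + nabla k t x Y := fun Y => by
        have : fderiv ℝ (s + t) x = fderiv ℝ s x + fderiv ℝ t x :=
          fderiv_add (hs.differentiable (by simp) x) (ht.differentiable (by simp) x)
        simp only [nabla, this, Pi.add_apply, add_apply]
        ring
      rw [e, e, hs'', ht'']; ring
  smul_mem' := by
    rintro c s ⟨hs, hs', hs''⟩
    refine ⟨contDiff_const.smul hs, fun l h1 h2 x => ?_, fun x X => ?_⟩
    · simp only [Pi.smul_apply, smul_eq_mul, hs' l h1 h2 x]; ring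
    · have e : ∀ Y, nabla k (c • s) x Y = c * nabla k s x Y := fun Y => by
        have : fderiv ℝ (c • s) x = c • fderiv ℝ s x :=
          fderiv_const_smul (hs.differentiable (by simp) x) c
        simp only [nabla, this, Pi.smul_apply, smul_apply, smul_eq_mul]
        ring
      rw [e, e, hs'']; ring

end Complex

section Theta

/-- `k⁻¹ Λ*`, where `Λ*` is the dual lattice, embedded in `V` by the inner product. -/
def scaledDual (Λ : Submodule ℤ V) (k : ℕ) : Submodule ℤ V where
  carrier := {μ | ∀ lam ∈ Λ, ∃ m : ℤ, (k : ℝ) * ⟪μ, lam⟫_ℝ = m}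
  zero_mem' := fun _ _ => ⟨0, by simp⟩
  add_mem' := fun {a b} ha hb l hl => by
    obtain ⟨m, hm⟩ := ha l hl
    obtain ⟨m', hm'⟩ := hb l hl
    exact ⟨m + m', by rw [inner_add_left, mul_add, hm, hm']; push_cast; ring⟩
  smul_mem' := fun r a ha l hl => by
    obtain ⟨m, hm⟩ := ha l hl
    refine ⟨r * m, ?_⟩
    rw [← Int.cast_smul_eq_zsmul ℝ, real_inner_smul_left]
    push_cast
    rw [← hm]; ring

/-- The set `k⁻¹ Λ* mod Λ`. -/
abbrev ThetaIndex (Λ : Submodule ℤ V) (k : ℕ) : Type _ :=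
  scaledDual Λ k ⧸ Λ.submoduleOf (scaledDual Λ k)

/-- The theta function `Θ_{μ,k}(p, q) = ∑_{γ ∈ μ + Λ} exp(2iπk((τ/2) B(γ, γ) - B(ζ, γ)))`, where
`ζ = p + τ q`. -/
def theta (Λ : Submodule ℤ V) (τ : ℍ) (k : ℕ) (μ : V) (x : V × V) : ℂ :=
  ∑' lam : Λ, Complex.exp (2 * Complex.I * Real.pi * k *
    ((τ : ℂ) / 2 * (⟪μ + lam, μ + lam⟫_ℝ : ℂ) -
      ((⟪x.1, μ + lam⟫_ℝ : ℂ) + (τ : ℂ) * (⟪x.2, μ + lam⟫_ℝ : ℂ))))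

/-- The section `s_τ = exp(iπ B(ζ, q))` of the trivial bundle. -/
def baseSection (τ : ℍ) (x : V × V) : ℂ :=
  Complex.exp (Complex.I * Real.pi * ((⟪x.1, x.2⟫_ℝ : ℂ) + (τ : ℂ) * (⟪x.2, x.2⟫_ℝ : ℂ)))

/-- The section `Θ_{μ,k} s_τ^k` (tensored with `Ω^{1/2}`). -/
def thetaSection (Λ : Submodule ℤ V) (τ : ℍ) (k : ℕ) (μ : V) (x : V × V) : ℂ :=
  theta Λ τ k μ x * baseSection τ x ^ k

/-- `b` is the basis of the quantum space consisting of the theta sections. -/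
def IsThetaBasis {Λ : Submodule ℤ V} {τ : ℍ} {k : ℕ}
    (b : Basis (ThetaIndex Λ k) ℂ (quantumSpace Λ τ k)) : Prop :=
  ∀ μ : scaledDual Λ k,
    (b (Submodule.Quotient.mk μ) : V × V → ℂ) = thetaSection Λ τ k (μ : V)

/-- The linear isomorphism sending the vectors of one basis to the vectors of the other one with the
same index. For the two theta bases, it is `Ψ_{τ₁,τ₂,k}`. -/
def identification {Λ : Submodule ℤ V} {τ₁ τ₂ : ℍ} {k : ℕ}
    (b₁ : Basis (ThetaIndex Λ k) ℂ (quantumSpace Λ τ₁ k))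
    (b₂ : Basis (ThetaIndex Λ k) ℂ (quantumSpace Λ τ₂ k)) :
    quantumSpace Λ τ₁ k ≃ₗ[ℂ] quantumSpace Λ τ₂ k :=
  b₁.equiv b₂ (Equiv.refl _)

end Theta

section HalfForms

/-- The complexified tangent space of `V × V`. -/
abbrev ComplexTangent (V : Type*) [NormedAddCommGroup V] [InnerProductSpace ℝ V] : Type _ :=
  ℂ ⊗[ℝ] (V × V)

/-- The tangent vectors of type `(1, 0)` for `j_τ`. -/
def holTangent (V : Type*) [NormedAddCommGroup V] [InnerProductSpace ℝ V] (τ : ℍ) :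
    Submodule ℂ (ComplexTangent V) :=
  LinearMap.ker ((complexStructure V τ).baseChange ℂ - Complex.I • LinearMap.id)

/-- The tangent vectors of type `(0, 1)` for `j_τ`. -/
def antiholTangent (V : Type*) [NormedAddCommGroup V] [InnerProductSpace ℝ V] (τ : ℍ) :
    Submodule ℂ (ComplexTangent V) :=
  LinearMap.ker ((complexStructure V τ).baseChange ℂ + Complex.I • LinearMap.id)

/-- Complex conjugation of tangent vectors. -/
def conjTangent (X : ComplexTangent V) : ComplexTangent V :=
  TensorProduct.map Complex.conjAe.toLinearMap LinearMap.id X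

/-- The complex linear extension of `dζ_τ = dp + τ dq`, with values in `V ⊗ ℂ`. -/
def dzeta (V : Type*) [NormedAddCommGroup V] [InnerProductSpace ℝ V] (τ : ℍ) :
    ComplexTangent V →ₗ[ℂ] ℂ ⊗[ℝ] V :=
  LinearMap.liftBaseChange ℂ
    (TensorProduct.mk ℝ ℂ V 1 ∘ₗ LinearMap.fst ℝ V V +
      TensorProduct.mk ℝ ℂ V (τ : ℂ) ∘ₗ LinearMap.snd ℝ V V)

/-- The fibre of the canonical bundle of `(T², j_τ)`. -/
abbrev CanonicalFibre (V : Type*) [NormedAddCommGroup V] [InnerProductSpace ℝ V] (τ : ℍ) :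
    Type _ :=
  (holTangent V τ) [⋀^Fin (finrank ℝ V)]→ₗ[ℂ] ℂ

/-- The Hermitian product `(X, Y) ↦ (1/i) ω(X, Ȳ)` of tangent vectors. -/
def tangentHerm (X Y : ComplexTangent V) : ℂ :=
  (1 / Complex.I) * (LinearMap.BilinForm.baseChange ℂ (symplForm V)) X (conjTangent Y)

/-- The norm on the canonical bundle induced by the Hermitian product of tangent vectors: the
modulus of the value of the top form on any orthonormal basis (all of these values have the same
modulus, so the supremum is over a one-point set). -/
def canonicalNorm (τ : ℍ) (α : CanonicalFibre V τ) : ℝ :=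
  sSup {r : ℝ | ∃ X : Fin (finrank ℝ V) → holTangent V τ,
    (∀ i j, tangentHerm (X i : ComplexTangent V) (X j) = if i = j then 1 else 0) ∧ r = ‖α X‖}

variable {Λ : Submodule ℤ V} [FiniteDimensional ℝ V] [DiscreteTopology Λ] [IsZLattice ℝ Λ]

/-- The form `Ω ∈ Λ^n (V ⊗ ℂ)^*` such that `Ω(γ₁, …, γ_n) = 1`, where `γ` is a basis of `Λ`. -/
def latticeForm (γ : Basis (Fin (finrank ℝ V)) ℤ Λ) :
    (ℂ ⊗[ℝ] V) [⋀^Fin (finrank ℝ V)]→ₗ[ℂ] ℂ :=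
  ((γ.ofZLatticeBasis ℝ Λ).baseChange ℂ).det

/-- The value `Ω_τ` at any point of the section of the canonical bundle corresponding to `Ω`
through `dζ_τ`. -/
def canonicalForm (γ : Basis (Fin (finrank ℝ V)) ℤ Λ) (τ : ℍ) : CanonicalFibre V τ :=
  (latticeForm γ).compLinearMap (dzeta V τ ∘ₗ (holTangent V τ).subtype)

/-- The squaring map of the half-form bundle `δ_τ`. The line `δ` is `ℂ Ω^{1/2}`, with coordinate
`u ↦ u Ω^{1/2}`, and `Ω^{1/2} ⊗ Ω^{1/2}` is sent to `Ω_τ`. -/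
def halfFormSquare (γ : Basis (Fin (finrank ℝ V)) ℤ Λ) (τ : ℍ) (u v : ℂ) : CanonicalFibre V τ :=
  (u * v) • canonicalForm γ τ

/-- The square of the norm of `Ω^{1/2}` in `δ_τ`, for the metric that makes the squaring map
isometric. -/
def halfFormNormSq (γ : Basis (Fin (finrank ℝ V)) ℤ Λ) (τ : ℍ) : ℝ :=
  canonicalNorm τ (halfFormSquare γ τ 1 1)

/-- A section `φ` of `Hom(δ_{τ₁}, δ_{τ₂})`, written as a function through
`φ_x(Ω^{1/2}) = φ x Ω^{1/2}`, is a half-form bundle isomorphism if its square at each point is the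
pull-back by the projection `π : E_{τ₂} → E_{τ₁}` with kernel `Ē_{τ₂}`, where `E_τ = T^{1,0}` for
`j_τ`. -/
def IsHalfFormIso (γ : Basis (Fin (finrank ℝ V)) ℤ Λ) (τ₁ τ₂ : ℍ) (φ : V × V → ℂ) : Prop :=
  ∃ π : holTangent V τ₂ →ₗ[ℂ] holTangent V τ₁,
    (∀ X : holTangent V τ₂,
      (X : ComplexTangent V) - (π X : ComplexTangent V) ∈ antiholTangent V τ₂) ∧
    ∀ (x : V × V) (u v : ℂ),
      halfFormSquare γ τ₂ (φ x * u) (φ x * v) = (halfFormSquare γ τ₁ u v).compLinearMap π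

/-- The number `((τ₁ - τ̄₁)/(τ₂ - τ̄₁))^{n/2}`, which is the value of `φ_{τ₁,τ₂}` on `Ω^{1/2}`.
The base has positive real part, so the principal determination depends continuously on
`τ₁, τ₂`. It is `1` when `τ₁ = τ₂`. -/
def symbol (V : Type*) [NormedAddCommGroup V] [InnerProductSpace ℝ V] (τ₁ τ₂ : ℍ) : ℂ :=
  (((τ₁ : ℂ) - conj (τ₁ : ℂ)) / ((τ₂ : ℂ) - conj (τ₁ : ℂ))) ^ ((finrank ℝ V : ℂ) / 2)

theorem symbol_base_re_pos (τ₁ τ₂ : ℍ) :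
    0 < (((τ₁ : ℂ) - conj (τ₁ : ℂ)) / ((τ₂ : ℂ) - conj (τ₁ : ℂ))).re := by
  have h1 := τ₁.im_pos
  have h2 := τ₂.im_pos
  have h3 : 0 < Complex.normSq ((τ₂ : ℂ) - conj (τ₁ : ℂ)) := by
    refine Complex.normSq_pos.2 fun h => ?_
    have := congrArg Complex.im h
    simp at this
    linarith
  rw [Complex.div_re]
  simp only [Complex.sub_re, Complex.sub_im, Complex.conj_re, Complex.conj_im, sub_self, zero_mul,
    zero_div, zero_add, UpperHalfPlane.coe_im, sub_neg_eq_add]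
  positivity

end HalfForms

section Operators

variable {Λ : Submodule ℤ V} [FiniteDimensional ℝ V] [DiscreteTopology Λ] [IsZLattice ℝ Λ]
  [MeasurableSpace V] [BorelSpace V]

/-- The Liouville measure `|ω^n| / n!` of `V × V`, which is `(2π)^n` times the Riemannian volume. -/
def liouville (V : Type*) [NormedAddCommGroup V] [InnerProductSpace ℝ V] [FiniteDimensional ℝ V]
    [MeasurableSpace V] [BorelSpace V] : MeasureTheory.Measure (V × V) :=
  ENNReal.ofReal ((2 * Real.pi) ^ finrank ℝ V) • MeasureTheory.volume

/-- A fundamental domain of `Λ²` in `V × V`. -/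
def fundDomain (γ : Basis (Fin (finrank ℝ V)) ℤ Λ) : Set (V × V) :=
  ZSpan.fundamentalDomain (γ.ofZLatticeBasis ℝ Λ) ×ˢ
    ZSpan.fundamentalDomain (γ.ofZLatticeBasis ℝ Λ)

/-- The scalar product of sections of `L^k ⊗ δ_τ`: the integral over `T²` of the pointwise scalar
product against the Liouville measure. It is linear on the left. -/
def sectionInner (γ : Basis (Fin (finrank ℝ V)) ℤ Λ) (τ : ℍ) (s t : V × V → ℂ) : ℂ :=
  ∫ x in fundDomain γ, s x * conj (t x) * (halfFormNormSq γ τ : ℂ) ∂(liouville V)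

/-- `K` is the Schwartz kernel of `S : H_{τ₁} → H_{τ₂}`: the section of
`(L^k ⊗ δ_{τ₂}) ⊠ (L̄^k ⊗ δ̄_{τ₁})` over `T² × T²` corresponding to `S` through the isomorphism
`H_{τ₂} ⊗ H̄_{τ₁} ≃ Hom(H_{τ₁}, H_{τ₂})`, `u ⊗ v̄ ↦ ⟨·, v⟩ u`. It is written in the trivialisation
`Ω^{1/2} ⊗ Ω̄^{1/2}` of `δ_{τ₂} ⊠ δ̄_{τ₁}`. -/
def IsSchwartzKernel (γ : Basis (Fin (finrank ℝ V)) ℤ Λ) (τ₁ τ₂ : ℍ) (k : ℕ)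
    (S : quantumSpace Λ τ₁ k →ₗ[ℂ] quantumSpace Λ τ₂ k) (K : (V × V) × (V × V) → ℂ) : Prop :=
  ∃ (m : ℕ) (u : Fin m → quantumSpace Λ τ₂ k) (v : Fin m → quantumSpace Λ τ₁ k),
    (∀ ψ : quantumSpace Λ τ₁ k,
      S ψ = ∑ i, sectionInner γ τ₁ (ψ : V × V → ℂ) (v i : V × V → ℂ) • u i) ∧
    ∀ x y, K (x, y) = ∑ i, (u i : V × V → ℂ) x * conj ((v i : V × V → ℂ) y)

/-- The sections of `L ⊠ L̄` over `T² × T²`. -/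
def IsBoxInvariant (Λ : Submodule ℤ V) (E : (V × V) × (V × V) → ℂ) : Prop :=
  ∀ lam lam' : V × V, lam.1 ∈ Λ → lam.2 ∈ Λ → lam'.1 ∈ Λ → lam'.2 ∈ Λ →
    ∀ x y, E (lam + x, lam' + y) = multiplier lam x * conj (multiplier lam' y) * E (x, y)

/-- The sections of `δ_{τ₂} ⊠ δ̄_{τ₁}` over `T² × T²`, in the trivialisation
`Ω^{1/2} ⊗ Ω̄^{1/2}`. -/
def IsBoxPeriodic (Λ : Submodule ℤ V) (f : (V × V) × (V × V) → ℂ) : Prop :=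
  ∀ lam lam' : V × V, lam.1 ∈ Λ → lam.2 ∈ Λ → lam'.1 ∈ Λ → lam'.2 ∈ Λ →
    ∀ x y, f (lam + x, lam' + y) = f (x, y)

/-- The complex structure `(j_{τ₂}, -j_{τ₁})`. -/
def boxComplexStructure (τ₁ τ₂ : ℍ) (Z : (V × V) × (V × V)) : (V × V) × (V × V) :=
  (complexStructure V τ₂ Z.1, -complexStructure V τ₁ Z.2)

/-- The covariant derivative on `L ⊠ L̄`. -/
def boxNabla (E : (V × V) × (V × V) → ℂ) (z Z : (V × V) × (V × V)) : ℂ :=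
  fderiv ℝ E z Z + (connForm z.1 Z.1 + conj (connForm z.2 Z.2)) * E z

/-- The value on the real tangent vector `Z` of `∂̄ E`, for a section `E` of `L ⊠ L̄`. -/
def boxDbar (τ₁ τ₂ : ℍ) (E : (V × V) × (V × V) → ℂ) (z Z : (V × V) × (V × V)) : ℂ :=
  (boxNabla E z Z + Complex.I * boxNabla E z (boxComplexStructure τ₁ τ₂ Z)) / 2

/-- The value on the real tangent vector `Z` of `∂̄ f`, for a section `f` of `δ_{τ₂} ⊠ δ̄_{τ₁}`
written in the holomorphic trivialisation `Ω^{1/2} ⊗ Ω̄^{1/2}`. -/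
def funDbar (τ₁ τ₂ : ℍ) (f : (V × V) × (V × V) → ℂ) (z Z : (V × V) × (V × V)) : ℂ :=
  (fderiv ℝ f z Z + Complex.I * fderiv ℝ f z (boxComplexStructure τ₁ τ₂ Z)) / 2

/-- `g` vanishes to any order along the diagonal. -/
def VanishesOnDiagonal (g : (V × V) × (V × V) → ℂ) : Prop :=
  ∀ (x : V × V) (m : ℕ), iteratedFDeriv ℝ m g (x, x) = 0

/-- The sequence `f(·, k)` has the asymptotic expansion `f₀ + k⁻¹ f₁ + k⁻² f₂ + …` in the
`C^∞` topology. -/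
def HasExpansion (f : ℕ+ → (V × V) × (V × V) → ℂ) (c : ℕ → (V × V) × (V × V) → ℂ) : Prop :=
  ∀ N l : ℕ, ∃ C : ℝ, ∀ (k : ℕ+) (z : (V × V) × (V × V)),
    ‖iteratedFDeriv ℝ l
      (fun w => f k w - ∑ i ∈ Finset.range N, ((k : ℂ) ^ i)⁻¹ * c i w) z‖ ≤ C / (k : ℝ) ^ N

/-- The sequence `S_k : H⁰_{τ₁}(T², L^k ⊗ δ_{τ₁}) → H⁰_{τ₂}(T², L^k ⊗ δ_{τ₂})` is a Fourier
integral operator with symbol the half-form bundle isomorphism `φ`. The `O(k^{-∞})` is uniform for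
the pointwise norms. The metric of `L` is the modulus, and the norm of `Ω^{1/2} ⊗ Ω̄^{1/2}` is
constant and does not depend on `k`. -/
def IsFourierIntegralOperator (γ : Basis (Fin (finrank ℝ V)) ℤ Λ) (τ₁ τ₂ : ℍ)
    (S : ∀ k : ℕ+, quantumSpace Λ τ₁ k →ₗ[ℂ] quantumSpace Λ τ₂ k) (φ : V × V → ℂ) : Prop :=
  IsHalfFormIso γ τ₁ τ₂ φ ∧
  ∃ (K : ℕ+ → (V × V) × (V × V) → ℂ) (E : (V × V) × (V × V) → ℂ)
    (f : ℕ+ → (V × V) × (V × V) → ℂ) (c : ℕ → (V × V) × (V × V) → ℂ),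
    (∀ k : ℕ+, IsSchwartzKernel γ τ₁ τ₂ k (S k) (K k)) ∧
    -- the conditions on `E`
    (ContDiff ℝ ∞ E ∧ IsBoxInvariant Λ E) ∧
    (∀ x y : V × V, ¬(x.1 - y.1 ∈ Λ ∧ x.2 - y.2 ∈ Λ) → ‖E (x, y)‖ < 1) ∧
    (∀ x : V × V, ∀ u : ℂ, ‖u‖ = 1 → E (x, x) = u * conj u) ∧
    (∀ Z, VanishesOnDiagonal fun z => boxDbar τ₁ τ₂ E z Z) ∧
    -- the conditions on `f`
    (∀ k, ContDiff ℝ ∞ (f k) ∧ IsBoxPeriodic Λ (f k)) ∧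
    (∀ i, ContDiff ℝ ∞ (c i) ∧ IsBoxPeriodic Λ (c i)) ∧
    HasExpansion f c ∧
    (∀ i Z, VanishesOnDiagonal fun z => funDbar τ₁ τ₂ (c i) z Z) ∧
    -- `f₀ = φ` on the diagonal: `a Ω^{1/2} ⊗ Ω̄^{1/2}` is the map sending `Ω^{1/2}` to
    -- `a ‖Ω^{1/2}‖² Ω^{1/2}`, where the norm is that of `δ_{τ₁}`
    (∀ x, c 0 (x, x) * (halfFormNormSq γ τ₁ : ℂ) = φ x) ∧
    -- the description of the kernel
    ∀ N : ℕ, ∃ C : ℝ, ∀ (k : ℕ+) (z : (V × V) × (V × V)),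
      ‖K k z - ((k : ℂ) / (2 * Real.pi)) ^ finrank ℝ V * E z ^ (k : ℕ) * f k z‖
        ≤ C / (k : ℝ) ^ N

end Operators

end TorusQuantization

end

open TorusQuantization

/-! A section of `L^k` over `T²` is determined by its Fourier coefficients along the fibres
`V × {q}`. For a holomorphic section, the coefficient at `g ∈ k⁻¹ Λ*` is a constant times
`exp(iπkτ ‖g - q‖²)`, by the Cauchy–Riemann equations, and invariance under `{0} × Λ` says that the
constant depends only on the class of `g` modulo `Λ`. These constants are the coordinates of the
section in the family of theta sections, which is therefore a basis (`exists_isThetaBasis`).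

Unitarity comes from a Gaussian integral: the theta sections are orthogonal, and unfolding the sum
over `Λ` gives each of them the square norm `(2π / k)^{n/2}`. This is independent of `τ` because the
factor `(Im τ)^{-n/2}` of the integral is balanced by the norm of `Ω^{1/2}`, which is computed in
`halfFormNormSq_eq`.

It follows that the Schwartz kernel of `Ψ` is `(k / 2π)^{n/2} ∑_μ Θ^{τ₂}_μ(x) conj (Θ^{τ₁}_μ(y))`.
The main point is an exact formula for this sum. Let `gaussKernel τ₁ τ₂` be the section of the lift
of `L ⊠ L̄` to `V² × V²` given by the exponential of a quadratic function, which is holomorphic for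
`(j_{τ₂}, -j_{τ₁})` and equal to `1` on the diagonal. Then the kernel is
`(k / 2π)^n (φ / ‖Ω^{1/2}‖²_{τ₁})` times the sum of the translates under `Λ²` of the `k`-th power of
`gaussKernel` (`thetaKernel_eq_periodise`). Both sides are sections of `L^k` in the variable `x`,
and they have the same Fourier coefficients: unfolding the sum leads to the integral over `V` of a
Gaussian of complex width, whose value contains the determination of the square root that appears
in the symbol (`integral_gaussFiber`, `symbol_mul_cpow`).

The norm of `gaussKernel` at `(x, y)` decreases like a Gaussian in `x - y`. Multiplying it by a
cutoff function supported near the diagonal changes the sum over `Λ²` by an exponentially small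
term, and leaves at most one nonzero term at each point. The sum is then the `k`-th power of a
smooth section `E` of `L ⊠ L̄` (`torusKernel`), which agrees with `gaussKernel` near the diagonal. So
all the conditions hold with a constant amplitude `f`. -/

open MeasureTheory

namespace TorusQuantization

/-! ### Fourier analysis on a lattice -/

section LatticeFourier

variable {V : Type*} [NormedAddCommGroup V] [InnerProductSpace ℝ V]

/-- The character `p ↦ exp(2πi k B(p, μ))` of `V`. It is `Λ`-periodic for `μ ∈ k⁻¹ Λ*`. -/
noncomputable def latticeChar (k : ℕ) (μ p : V) : ℂ :=
  Complex.exp (2 * Real.pi * Complex.I * (k * ⟪p, μ⟫_ℝ : ℝ))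

theorem norm_latticeChar (k : ℕ) (μ p : V) : ‖latticeChar k μ p‖ = 1 := by
  rw [latticeChar, Complex.norm_exp]
  simp

theorem continuous_latticeChar (k : ℕ) (μ : V) : Continuous (latticeChar k μ) := by
  unfold latticeChar
  fun_prop

theorem latticeChar_add_right (k : ℕ) (μ p q : V) :
    latticeChar k μ (p + q) = latticeChar k μ p * latticeChar k μ q := by
  simp only [latticeChar, ← Complex.exp_add, inner_add_left]
  congr 1
  push_cast
  ring

theorem latticeChar_add_left (k : ℕ) (μ ν p : V) :
    latticeChar k (μ + ν) p = latticeChar k μ p * latticeChar k ν p := by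
  simp only [latticeChar, ← Complex.exp_add, inner_add_right]
  congr 1
  push_cast
  ring

theorem latticeChar_neg_left (k : ℕ) (μ p : V) :
    latticeChar k (-μ) p = conj (latticeChar k μ p) := by
  simp [latticeChar, ← Complex.exp_conj, Complex.conj_ofNat]

theorem latticeChar_of_mem {Λ : Submodule ℤ V} {k : ℕ} {μ l : V} (hμ : μ ∈ scaledDual Λ k)
    (hl : l ∈ Λ) : latticeChar k μ l = 1 := by
  obtain ⟨m, hm⟩ := hμ l hl
  rw [latticeChar, real_inner_comm, hm, Complex.exp_eq_one_iff]
  exact ⟨m, by push_cast; ring⟩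

variable {Λ : Submodule ℤ V} [FiniteDimensional ℝ V] [DiscreteTopology Λ] [IsZLattice ℝ Λ]

/-- The fundamental cell of `Λ` attached to a basis of `Λ`. -/
abbrev latticeCell (γ : Basis (Fin (finrank ℝ V)) ℤ Λ) : Set V :=
  ZSpan.fundamentalDomain (γ.ofZLatticeBasis ℝ Λ)

theorem exists_add_mem_latticeCell (γ : Basis (Fin (finrank ℝ V)) ℤ Λ) (v : V) :
    ∃ l ∈ Λ, l + v ∈ latticeCell γ := by
  obtain ⟨⟨l, hl⟩, h, -⟩ :=
    ZSpan.exist_unique_vadd_mem_fundamentalDomain (γ.ofZLatticeBasis ℝ Λ) v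
  rw [γ.ofZLatticeBasis_span ℝ Λ] at hl
  exact ⟨l, hl, h⟩

/-- The covering map of `V` onto the standard torus given by the coordinates in a basis of `Λ`. -/
noncomputable def toUnitAddTorus (γ : Basis (Fin (finrank ℝ V)) ℤ Λ) (p : V) :
    UnitAddTorus (Fin (finrank ℝ V)) :=
  fun i => (((γ.ofZLatticeBasis ℝ Λ).repr p i : ℝ) : UnitAddCircle)

theorem isOpenQuotientMap_toUnitAddTorus (γ : Basis (Fin (finrank ℝ V)) ℤ Λ) :
    IsOpenQuotientMap (toUnitAddTorus γ) := by
  have h1 : IsOpenQuotientMap (Pi.map fun (_ : Fin (finrank ℝ V)) (t : ℝ) => (t : UnitAddCircle)) :=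
    IsOpenQuotientMap.piMap fun _ => QuotientAddGroup.isOpenQuotientMap_mk
  exact h1.comp (γ.ofZLatticeBasis ℝ Λ).equivFunL.toHomeomorph.isOpenQuotientMap

theorem sub_mem_of_toUnitAddTorus_eq (γ : Basis (Fin (finrank ℝ V)) ℤ Λ) {p q : V}
    (h : toUnitAddTorus γ p = toUnitAddTorus γ q) : p - q ∈ Λ := by
  suffices p - q ∈ Submodule.span ℤ (Set.range (γ.ofZLatticeBasis ℝ Λ)) by
    rwa [γ.ofZLatticeBasis_span ℝ Λ] at this
  rw [Basis.mem_span_iff_repr_mem]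
  intro i
  have := congrFun h i
  rw [toUnitAddTorus, toUnitAddTorus, ← sub_eq_zero, ← AddCircle.coe_sub,
    AddCircle.coe_eq_zero_iff] at this
  obtain ⟨n, hn⟩ := this
  exact ⟨n, by simpa using hn⟩

/-- Each monomial on the torus pulls back to a character of `V` attached to `k⁻¹ Λ*`. -/
theorem exists_latticeChar_eq_mFourier (γ : Basis (Fin (finrank ℝ V)) ℤ Λ) {k : ℕ} (hk : k ≠ 0)
    (m : Fin (finrank ℝ V) → ℤ) :
    ∃ μ ∈ scaledDual Λ k, ∀ p,
      UnitAddTorus.mFourier m (toUnitAddTorus γ p) = latticeChar k μ p := by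
  let b := γ.ofZLatticeBasis ℝ Λ
  have hk' : (k : ℝ) ≠ 0 := by exact_mod_cast hk
  let φ : V →L[ℝ] ℝ := LinearMap.toContinuousLinearMap (∑ i, (m i : ℝ) • b.coord i)
  let ν : V := (InnerProductSpace.toDual ℝ V).symm φ
  have hν : ∀ p, ⟪ν, p⟫_ℝ = ∑ i, (m i : ℝ) * b.repr p i := fun p => by
    rw [InnerProductSpace.toDual_symm_apply]
    simp [φ]
  refine ⟨(k : ℝ)⁻¹ • ν, fun l hl => ?_, fun p => ?_⟩
  · refine ⟨∑ i, m i * γ.repr ⟨l, hl⟩ i, ?_⟩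
    rw [real_inner_smul_left, hν, mul_inv_cancel_left₀ hk']
    push_cast
    refine Finset.sum_congr rfl fun i _ => ?_
    congr 1
    exact γ.ofZLatticeBasis_repr_apply ℝ Λ ⟨l, hl⟩ i
  · rw [latticeChar, real_inner_smul_right, real_inner_comm, hν, mul_inv_cancel_left₀ hk']
    simp only [UnitAddTorus.mFourier, ContinuousMap.coe_mk, toUnitAddTorus, fourier_coe_apply]
    rw [← Complex.exp_sum]
    congr 1
    push_cast
    rw [Finset.mul_sum]
    refine Finset.sum_congr rfl fun i _ => ?_
    simp only [b]
    ring

variable [MeasurableSpace V] [BorelSpace V]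

instance : VAddInvariantMeasure Λ V volume :=
  inferInstanceAs (VAddInvariantMeasure Λ.toAddSubgroup V volume)

theorem isAddFundamentalDomain_latticeCell (γ : Basis (Fin (finrank ℝ V)) ℤ Λ) :
    IsAddFundamentalDomain Λ (latticeCell γ) (volume : Measure V) :=
  ZLattice.isAddFundamentalDomain γ volume

theorem volume_latticeCell_lt_top (γ : Basis (Fin (finrank ℝ V)) ℤ Λ) :
    volume (latticeCell γ) < ⊤ :=
  (ZSpan.fundamentalDomain_isBounded _).measure_lt_top

theorem volume_real_latticeCell_pos (γ : Basis (Fin (finrank ℝ V)) ℤ Λ) :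
    0 < (volume : Measure V).real (latticeCell γ) :=
  ENNReal.toReal_pos (ZSpan.measure_fundamentalDomain_ne_zero _) (volume_latticeCell_lt_top γ).ne

theorem measurableSet_latticeCell (γ : Basis (Fin (finrank ℝ V)) ℤ Λ) :
    MeasurableSet (latticeCell γ) :=
  ZSpan.fundamentalDomain_measurableSet _

theorem integrableOn_latticeCell_of_continuous (γ : Basis (Fin (finrank ℝ V)) ℤ Λ)
    {F : Type*} [NormedAddCommGroup F] {h : V → F} (hh : Continuous h) :
    IntegrableOn h (latticeCell γ) := by
  have hb : Bornology.IsBounded (latticeCell γ) := ZSpan.fundamentalDomain_isBounded _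
  exact (hh.continuousOn.integrableOn_compact hb.isCompact_closure).mono_set subset_closure

theorem setIntegral_latticeCell_add (γ : Basis (Fin (finrank ℝ V)) ℤ Λ) {h : V → ℂ}
    (hh : ∀ l ∈ Λ, ∀ p, h (l + p) = h p) (v : V) :
    ∫ p in latticeCell γ, h (v + p) = ∫ p in latticeCell γ, h p := by
  have hD := isAddFundamentalDomain_latticeCell γ
  have hD' : IsAddFundamentalDomain Λ ((v + ·) '' latticeCell γ) (volume : Measure V) :=
    hD.image_of_equiv (Equiv.addLeft v)
      (measurePreserving_add_left volume (-v)).quasiMeasurePreserving (Equiv.refl _)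
      fun g x => add_left_comm v (g : V) x
  rw [hD.setIntegral_eq hD' (fun g x => hh g g.2 x)]
  exact ((measurePreserving_add_left (volume : Measure V) v).setIntegral_image_emb
    (measurableEmbedding_addLeft v) h (latticeCell γ)).symm

/-- Unfolding: the integral over a cell of the periodisation of `F` is the integral of `F`. -/
theorem setIntegral_latticeCell_tsum (γ : Basis (Fin (finrank ℝ V)) ℤ Λ) {F : V → ℂ}
    (hF : Integrable F) :
    ∫ p in latticeCell γ, ∑' l : Λ, F (l + p) = ∫ p, F p := by
  have hD := isAddFundamentalDomain_latticeCell γ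
  have h1 : ∑' l : Λ, ∫⁻ p in latticeCell γ, ‖F (l + p)‖ₑ ≠ ⊤ := by
    have := hD.lintegral_eq_tsum'' (fun p => ‖F p‖ₑ)
    simp only [Submodule.vadd_def, vadd_eq_add] at this
    rw [← this]
    exact hF.2.ne
  have := ZLattice.module_finite ℝ Λ
  rw [integral_tsum (fun l => ?_) h1, hD.integral_eq_tsum'' F hF]
  · rfl
  · exact ((measurePreserving_add_left (volume : Measure V) (l : V)).integrable_comp_of_integrable
      hF).aestronglyMeasurable.restrict

open Classical in
/-- Orthogonality of characters. -/
theorem setIntegral_latticeChar (γ : Basis (Fin (finrank ℝ V)) ℤ Λ) {k : ℕ} (hk : k ≠ 0)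
    {μ : V} (hμ : μ ∈ scaledDual Λ k) :
    ∫ p in latticeCell γ, latticeChar k μ p =
      if μ = 0 then ((volume : Measure V).real (latticeCell γ) : ℂ) else 0 := by
  split_ifs with h0
  · simp [h0, latticeChar]
  · have hper : ∀ l ∈ Λ, ∀ p, latticeChar k μ (l + p) = latticeChar k μ p := fun l hl p => by
      rw [latticeChar_add_right, latticeChar_of_mem hμ hl, one_mul]
    -- translating by `v` with `k B(v, μ) = 1/2` changes the sign of the character
    let v : V := (1 / (2 * k * ‖μ‖ ^ 2) : ℝ) • μ
    have hv : latticeChar k μ v = -1 := by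
      have hn : ‖μ‖ ≠ 0 := norm_ne_zero_iff.2 h0
      have hk' : (k : ℝ) ≠ 0 := by exact_mod_cast hk
      have : (k : ℝ) * ⟪v, μ⟫_ℝ = 1 / 2 := by
        simp only [v, real_inner_smul_left, real_inner_self_eq_norm_sq]
        field_simp
      rw [latticeChar, this, ← Complex.exp_pi_mul_I]
      congr 1
      push_cast
      ring
    have h := setIntegral_latticeCell_add γ hper v
    simp only [latticeChar_add_right, hv, neg_mul, one_mul, integral_neg] at h
    exact self_eq_neg.1 h.symm

/-- A continuous `Λ`-periodic function whose Fourier coefficients all vanish is zero. -/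
theorem eq_zero_of_setIntegral_latticeChar_eq_zero (γ : Basis (Fin (finrank ℝ V)) ℤ Λ) {k : ℕ}
    (hk : k ≠ 0) {h : V → ℂ} (hc : Continuous h) (hper : ∀ l ∈ Λ, ∀ p, h (l + p) = h p)
    (hcoef : ∀ μ ∈ scaledDual Λ k, ∫ p in latticeCell γ, h p * latticeChar k μ p = 0) (p : V) :
    h p = 0 := by
  obtain ⟨ht, hht⟩ : ∃ ht : C(UnitAddTorus (Fin (finrank ℝ V)), ℂ),
      ∀ p, ht (toUnitAddTorus γ p) = h p := by
    have hf : Function.FactorsThrough (⟨h, hc⟩ : C(V, ℂ)) (toUnitAddTorus γ) := fun p q hpq => by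
      have := hper _ (sub_mem_of_toUnitAddTorus_eq γ hpq) q
      rwa [sub_add_cancel] at this
    let π : C(V, UnitAddTorus (Fin (finrank ℝ V))) :=
      ⟨toUnitAddTorus γ, (isOpenQuotientMap_toUnitAddTorus γ).continuous⟩
    have hq : Topology.IsQuotientMap π := (isOpenQuotientMap_toUnitAddTorus γ).isQuotientMap
    exact ⟨hq.lift ⟨h, hc⟩ hf, fun p => DFunLike.congr_fun (hq.lift_comp ⟨h, hc⟩ hf) p⟩
  have hcπ := (isOpenQuotientMap_toUnitAddTorus γ).continuous
  -- `h` is orthogonal to the pull-backs of trigonometric polynomials, hence to all pull-backs of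
  -- continuous functions
  let I : C(UnitAddTorus (Fin (finrank ℝ V)), ℂ) → ℂ := fun g =>
    ∫ p in latticeCell γ, h p * g (toUnitAddTorus γ p)
  have hint : ∀ g : C(UnitAddTorus (Fin (finrank ℝ V)), ℂ),
      IntegrableOn (fun p => h p * g (toUnitAddTorus γ p)) (latticeCell γ) := fun g =>
    integrableOn_latticeCell_of_continuous γ (hc.mul (g.continuous.comp hcπ))
  have hI : ∀ g, I g = 0 := by
    have hIadd : ∀ g g', I (g + g') = I g + I g' := fun g g' => by
      simp only [I, ContinuousMap.add_apply, mul_add]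
      exact integral_add (hint g) (hint g')
    have hIsmul : ∀ (c : ℂ) g, I (c • g) = c * I g := fun c g => by
      simp only [I, ContinuousMap.smul_apply, smul_eq_mul, mul_left_comm _ c]
      exact integral_const_mul _ _
    let J : C(UnitAddTorus (Fin (finrank ℝ V)), ℂ) →ₗ[ℂ] ℂ := ⟨⟨I, hIadd⟩, hIsmul⟩
    have hJc : Continuous J := by
      refine (J.mkContinuous (‖ht‖ * (volume : Measure V).real (latticeCell γ))
        fun g => ?_).continuous
      refine (norm_setIntegral_le_of_norm_le_const (C := ‖ht‖ * ‖g‖)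
        (volume_latticeCell_lt_top γ) fun p _ => ?_).trans_eq (by ring)
      rw [norm_mul, ← hht]
      exact mul_le_mul (ht.norm_coe_le_norm _) (g.norm_coe_le_norm _) (norm_nonneg _)
        (norm_nonneg _)
    have hle : (Submodule.span ℂ (Set.range (UnitAddTorus.mFourier (d := Fin (finrank ℝ V)))))
        ≤ LinearMap.ker J := by
      rw [Submodule.span_le]
      rintro _ ⟨m, rfl⟩
      obtain ⟨μ, hμ, hm⟩ := exists_latticeChar_eq_mFourier γ hk m
      change I _ = 0
      simp only [I, hm]
      exact hcoef μ hμ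
    have hcl := Submodule.topologicalClosure_minimal _ hle (isClosed_singleton.preimage hJc)
    rw [UnitAddTorus.span_mFourier_closure_eq_top] at hcl
    exact fun g => hcl (Submodule.mem_top (x := g))
  have hsq := hI (star ht)
  have hsq' : ∫ p in latticeCell γ, ‖h p‖ ^ 2 = 0 := by
    have : ∀ p, h p * (star ht) (toUnitAddTorus γ p) = ((‖h p‖ ^ 2 : ℝ) : ℂ) := fun p => by
      rw [ContinuousMap.star_apply, hht, ← starRingEnd_apply, Complex.mul_conj,
        Complex.normSq_eq_norm_sq]
    simp only [I, this] at hsq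
    rw [integral_complex_ofReal] at hsq
    exact_mod_cast hsq
  have hae : ∀ᵐ p ∂(volume.restrict (latticeCell γ)), ‖h p‖ ^ 2 = 0 :=
    (setIntegral_eq_zero_iff_of_nonneg_ae (Filter.Eventually.of_forall fun p => sq_nonneg ‖h p‖)
      (integrableOn_latticeCell_of_continuous γ (hc.norm.pow 2))).1 hsq'
  -- an invariant open set which is null in the cell is empty
  have hnull : volume ({p | h p ≠ 0} ∩ latticeCell γ) = 0 := by
    rw [ae_restrict_iff' (measurableSet_latticeCell γ)] at hae
    refine measure_mono_null (fun p hp => ?_) (ae_iff.1 hae)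
    simpa using ⟨hp.2, hp.1⟩
  have hopen : IsOpen {p | h p ≠ 0} := isOpen_ne_fun hc continuous_const
  have := (isAddFundamentalDomain_latticeCell γ).measure_zero_of_invariant {p | h p ≠ 0}
    (fun g => by
      ext p
      rw [Set.mem_vadd_set_iff_neg_vadd_mem]
      change h (((-g : Λ) : V) + p) ≠ 0 ↔ h p ≠ 0
      rw [hper _ (-g).2]) hnull
  have hemp := (hopen.measure_eq_zero_iff volume).1 this
  by_contra hp
  exact (Set.eq_empty_iff_forall_notMem.1 hemp) p hp

end LatticeFourier

/-! ### Gaussian sums over a lattice -/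

section GaussianSums

theorem half_norm_sq_sub_le {V : Type*} [SeminormedAddCommGroup V] (u v : V) :
    ‖u‖ ^ 2 / 2 - ‖v‖ ^ 2 ≤ ‖u + v‖ ^ 2 := by
  have h1 : ‖u‖ ≤ ‖u + v‖ + ‖v‖ := by simpa using norm_sub_le (u + v) v
  nlinarith [norm_nonneg u, norm_nonneg v, norm_nonneg (u + v), sq_nonneg (‖u + v‖ - ‖v‖)]

variable {V : Type*} [NormedAddCommGroup V] [InnerProductSpace ℝ V]

variable (Λ : Submodule ℤ V) [FiniteDimensional ℝ V] [DiscreteTopology Λ] [IsZLattice ℝ Λ]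

theorem summable_exp_neg_mul_norm_sq {c : ℝ} (hc : 0 < c) :
    Summable fun l : Λ => Real.exp (-c * ‖(l : V)‖ ^ 2) := by
  let N := finrank ℤ Λ + 1
  have hs := (ZLattice.summable_norm_pow_inv Λ (2 * N) (by omega)).mul_left
    (N.factorial / c ^ N : ℝ)
  refine Summable.of_norm_bounded_eventually hs ?_
  rw [Filter.eventually_cofinite]
  refine (Set.finite_singleton (0 : Λ)).subset fun l hl => ?_
  by_contra h0
  refine hl ?_
  have hpos : 0 < ‖(l : V)‖ := norm_pos_iff.2 fun h => h0 (Subtype.ext h)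
  have h := Real.pow_div_factorial_le_exp (c * ‖(l : V)‖ ^ 2) (by positivity) N
  rw [Real.norm_eq_abs, abs_of_pos (Real.exp_pos _), neg_mul, Real.exp_neg]
  have h3 : (0 : ℝ) < N.factorial := by positivity
  calc (Real.exp (c * ‖(l : V)‖ ^ 2))⁻¹ ≤ ((c * ‖(l : V)‖ ^ 2) ^ N / N.factorial)⁻¹ := by gcongr
    _ = N.factorial / c ^ N * (‖l‖⁻¹) ^ (2 * N) := by
      rw [Submodule.coe_norm, mul_pow, ← pow_mul, inv_pow]
      field_simp

theorem summable_exp_neg_mul_norm_add_sq {c : ℝ} (hc : 0 < c) (v : V) :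
    Summable fun l : Λ => Real.exp (-c * ‖(l : V) + v‖ ^ 2) := by
  refine Summable.of_nonneg_of_le (fun l => (Real.exp_pos _).le) (fun l => ?_)
    ((summable_exp_neg_mul_norm_sq Λ (half_pos hc)).mul_left (Real.exp (c * ‖v‖ ^ 2)))
  rw [← Real.exp_add, Real.exp_le_exp]
  nlinarith [half_norm_sq_sub_le (l : V) v]

theorem exists_tsum_exp_neg_mul_norm_add_sq_le {c : ℝ} (hc : 0 < c) :
    ∃ M, ∀ v : V, ∑' l : Λ, Real.exp (-c * ‖(l : V) + v‖ ^ 2) ≤ M := by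
  have := ZLattice.module_finite ℝ Λ
  have := ZLattice.module_free ℝ Λ
  let b := (Module.Free.chooseBasis ℤ Λ).ofZLatticeBasis ℝ Λ
  obtain ⟨R, hR⟩ := (ZSpan.fundamentalDomain_isBounded b).exists_norm_le
  refine ⟨∑' l : Λ, Real.exp (c * R ^ 2) * Real.exp (-(c / 2) * ‖(l : V)‖ ^ 2), fun v => ?_⟩
  obtain ⟨⟨l₀, hl₀⟩, h, -⟩ := ZSpan.exist_unique_vadd_mem_fundamentalDomain b v
  rw [Basis.ofZLatticeBasis_span ℝ Λ] at hl₀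
  have hv : ‖l₀ + v‖ ≤ R := hR _ h
  rw [← (Equiv.addRight (⟨l₀, hl₀⟩ : Λ)).tsum_eq fun l : Λ => Real.exp (-c * ‖(l : V) + v‖ ^ 2)]
  have hle : ∀ l : Λ, Real.exp (-c * ‖((l + ⟨l₀, hl₀⟩ : Λ) : V) + v‖ ^ 2) ≤
      Real.exp (c * R ^ 2) * Real.exp (-(c / 2) * ‖(l : V)‖ ^ 2) := fun l => by
    rw [← Real.exp_add, Real.exp_le_exp, Submodule.coe_add, add_assoc]
    have h1 := half_norm_sq_sub_le (l : V) (l₀ + v)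
    have h2 : ‖l₀ + v‖ ^ 2 ≤ R ^ 2 := by gcongr
    nlinarith
  have hs := (summable_exp_neg_mul_norm_sq Λ (half_pos hc)).mul_left (Real.exp (c * R ^ 2))
  exact (Summable.of_nonneg_of_le (fun l => (Real.exp_pos _).le) hle hs).tsum_le_tsum hle hs

theorem summable_exp_neg_mul_norm_add_sq_mul_exp {c : ℝ} (hc : 0 < c) (v : V) (R : ℝ) :
    Summable fun l : Λ => Real.exp (-c * ‖(l : V) + v‖ ^ 2) * Real.exp (R * ‖(l : V) + v‖) := by
  refine Summable.of_nonneg_of_le (fun l => by positivity) (fun l => ?_)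
    ((summable_exp_neg_mul_norm_add_sq Λ (half_pos hc) v).mul_left (Real.exp (R ^ 2 / (2 * c))))
  rw [← Real.exp_add, ← Real.exp_add, Real.exp_le_exp]
  have : R ^ 2 / (2 * c) + -(c / 2) * ‖(l : V) + v‖ ^ 2 -
      (-c * ‖(l : V) + v‖ ^ 2 + R * ‖(l : V) + v‖) = (R - c * ‖(l : V) + v‖) ^ 2 / (2 * c) := by
    field_simp
    ring
  have h2 : 0 ≤ (R - c * ‖(l : V) + v‖) ^ 2 / (2 * c) := by positivity
  linarith

end GaussianSums

/-! ### Entire functions given by exponential sums -/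

section ExponentialSums

variable {E ι : Type*} [NormedAddCommGroup E] [NormedSpace ℂ E]

/-- The degree `m` term of the power series of `z ↦ a exp(ℓ z)`. -/
noncomputable def expTerm (a : ℂ) (l : E →L[ℂ] ℂ) (m : ℕ) :
    ContinuousMultilinearMap ℂ (fun _ : Fin m => E) ℂ :=
  (a / m.factorial) •
    (ContinuousMultilinearMap.mkPiAlgebraFin ℂ m ℂ).compContinuousLinearMap fun _ => l

theorem expTerm_apply (a : ℂ) (l : E →L[ℂ] ℂ) (m : ℕ) (z : E) :
    expTerm a l m (fun _ => z) = a * ((l z) ^ m / m.factorial) := by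
  simp [expTerm]
  ring

theorem norm_expTerm_le (a : ℂ) (l : E →L[ℂ] ℂ) (m : ℕ) :
    ‖expTerm a l m‖ ≤ ‖a‖ * (‖l‖ ^ m / m.factorial) := by
  rw [expTerm, norm_smul]
  have h := (ContinuousMultilinearMap.mkPiAlgebraFin ℂ m ℂ).norm_compContinuousLinearMap_le
    fun _ => l
  rw [ContinuousMultilinearMap.norm_mkPiAlgebraFin, Finset.prod_const, Finset.card_univ,
    Fintype.card_fin, one_mul] at h
  rw [norm_div, Complex.norm_natCast, mul_div_assoc', mul_comm, mul_div_assoc', mul_comm _ ‖a‖]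
  gcongr

theorem summable_prod_exp_series {a : ι → ℂ} {l : ι → E →L[ℂ] ℂ} {R : ℝ} (hR : 0 ≤ R)
    (h : Summable fun i => ‖a i‖ * Real.exp (R * ‖l i‖)) :
    Summable fun x : ι × ℕ => ‖a x.1‖ * ((R * ‖l x.1‖) ^ x.2 / x.2.factorial) := by
  have hs : ∀ i, HasSum (fun m : ℕ => ‖a i‖ * ((R * ‖l i‖) ^ m / m.factorial))
      (‖a i‖ * Real.exp (R * ‖l i‖)) := fun i => by
    rw [Real.exp_eq_exp_ℝ]
    exact (NormedSpace.expSeries_div_hasSum_exp (R * ‖l i‖)).mul_left _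
  rw [summable_prod_of_nonneg (fun x => by positivity)]
  refine ⟨fun i => (hs i).summable, ?_⟩
  simpa only [(hs _).tsum_eq] using h

theorem hasFPowerSeriesOnBall_tsum_exp {a : ι → ℂ} {l : ι → E →L[ℂ] ℂ}
    (h : ∀ R : ℝ, Summable fun i => ‖a i‖ * Real.exp (R * ‖l i‖)) :
    HasFPowerSeriesOnBall (fun z => ∑' i, a i * Complex.exp (l i z))
      (fun m => ∑' i, expTerm (a i) (l i) m) 0 ⊤ := by
  have hsum : ∀ (R : ℝ), 0 ≤ R → Summable fun x : ι × ℕ =>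
      ‖a x.1‖ * ((R * ‖l x.1‖) ^ x.2 / x.2.factorial) := fun R hR =>
    summable_prod_exp_series hR (h R)
  have hterm : ∀ m, Summable fun i => ‖a i‖ * (‖l i‖ ^ m / m.factorial) := fun m => by
    have := (hsum 1 zero_le_one).prod_symm.prod_factor m
    simpa using this
  have htermS : ∀ m, Summable fun i => expTerm (a i) (l i) m := fun m =>
    Summable.of_norm_bounded (hterm m) fun i => norm_expTerm_le _ _ _
  refine ⟨?_, by simp, fun {z} _ => ?_⟩
  · rw [top_le_iff]
    refine FormalMultilinearSeries.radius_eq_top_of_summable_norm _ fun r => ?_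
    refine Summable.of_nonneg_of_le (fun m => by positivity) (fun m => ?_)
      (hsum r r.2).prod_symm.prod
    have h1 : ‖∑' i, expTerm (a i) (l i) m‖ ≤ ∑' i, ‖a i‖ * (‖l i‖ ^ m / m.factorial) :=
      tsum_of_norm_bounded (hterm m).hasSum fun i => norm_expTerm_le _ _ _
    refine (mul_le_mul_of_nonneg_right h1 (by positivity)).trans_eq ?_
    rw [← tsum_mul_right]
    refine tsum_congr fun i => ?_
    simp only [Prod.swap_prod_mk, mul_pow]
    ring
  · have hz : Summable fun x : ι × ℕ => a x.1 * ((l x.1 z) ^ x.2 / x.2.factorial) := by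
      refine Summable.of_norm_bounded (hsum ‖z‖ (norm_nonneg z)) fun x => ?_
      rw [norm_mul, norm_div, norm_pow, Complex.norm_natCast]
      gcongr
      rw [mul_comm]
      exact (l x.1).le_opNorm z
    have h1 : ∀ i, HasSum (fun m : ℕ => a i * ((l i z) ^ m / m.factorial))
        (a i * Complex.exp (l i z)) := fun i => by
      rw [Complex.exp_eq_exp_ℂ]
      exact (NormedSpace.expSeries_div_hasSum_exp (l i z)).mul_left _
    have h2 := hz.hasSum.prod_fiberwise h1
    have h3 : ∀ m : ℕ, HasSum (fun i => a i * ((l i z) ^ m / m.factorial))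
        ((∑' i, expTerm (a i) (l i) m) fun _ => z) := fun m => by
      have := ContinuousMultilinearMap.hasSum_eval (htermS m).hasSum fun _ => z
      simpa only [expTerm_apply] using this
    have h4 := hz.prod_symm.hasSum.prod_fiberwise h3
    rw [zero_add, h2.tsum_eq, ← (Equiv.prodComm ℕ ι).tsum_eq]
    exact h4

theorem contDiff_tsum_exp {a : ι → ℂ} {l : ι → E →L[ℂ] ℂ}
    (h : ∀ R : ℝ, Summable fun i => ‖a i‖ * Real.exp (R * ‖l i‖)) :
    ContDiff ℂ ∞ fun z => ∑' i, a i * Complex.exp (l i z) := by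
  refine contDiff_iff_contDiffAt.2 fun z => ?_
  exact ((hasFPowerSeriesOnBall_tsum_exp h).analyticAt_of_mem (by simp)).contDiffAt

end ExponentialSums

/-! ### Theta sections are holomorphic sections -/

section Holomorphic

variable {V : Type*} [NormedAddCommGroup V] [InnerProductSpace ℝ V]

/-- The function `f` on `V × V` satisfies the Cauchy–Riemann equations for `j_τ`. -/
def IsCauchyRiemann (τ : ℍ) (f : V × V → ℂ) : Prop :=
  ∀ x X, fderiv ℝ f x (complexStructure V τ X) = Complex.I * fderiv ℝ f x X

/-- The pairing `B(ζ_τ(x), v)`, complex linear in `ζ_τ = p + τ q`. -/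
noncomputable def zetaInner (τ : ℍ) (x : V × V) (v : V) : ℂ :=
  (⟪x.1, v⟫_ℝ : ℂ) + (τ : ℂ) * (⟪x.2, v⟫_ℝ : ℂ)

theorem complexStructure_fst (τ : ℍ) (X : V × V) : (complexStructure V τ X).1 =
    -(τ.re / τ.im) • X.1 - (Complex.normSq τ / τ.im) • X.2 := rfl

theorem complexStructure_snd (τ : ℍ) (X : V × V) : (complexStructure V τ X).2 =
    (1 / τ.im) • X.1 + (τ.re / τ.im) • X.2 := rfl

theorem coe_eq_re_add_im_mul_I (τ : ℍ) : (τ : ℂ) = τ.re + τ.im * Complex.I := by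
  apply Complex.ext <;> simp

theorem zetaInner_complexStructure (τ : ℍ) (X : V × V) (v : V) :
    zetaInner τ (complexStructure V τ X) v = Complex.I * zetaInner τ X v := by
  have h : (τ.im : ℂ) ≠ 0 := by exact_mod_cast τ.im_pos.ne'
  simp only [zetaInner, complexStructure_fst, complexStructure_snd, inner_sub_left,
    inner_add_left, inner_smul_left, Complex.normSq_apply, UpperHalfPlane.coe_re,
    UpperHalfPlane.coe_im]
  rw [coe_eq_re_add_im_mul_I τ]
  push_cast
  simp only [map_neg, map_div₀, conj_trivial, map_add, map_mul, map_one]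
  push_cast
  field_simp
  ring_nf
  simp only [Complex.I_sq]
  ring

/-- The exponent of `s_τ = exp(iπ B(ζ, q))`. -/
noncomputable def baseExponent (τ : ℍ) (x : V × V) : ℂ :=
  Complex.I * Real.pi * ((⟪x.1, x.2⟫_ℝ : ℂ) + (τ : ℂ) * (⟪x.2, x.2⟫_ℝ : ℂ))

theorem hasFDerivAt_ofReal_inner {W : Type*} [NormedAddCommGroup W] [NormedSpace ℝ W]
    (L M : W →L[ℝ] V) (x : W) :
    ∃ D : W →L[ℝ] ℂ, HasFDerivAt (fun x => ((⟪L x, M x⟫_ℝ : ℝ) : ℂ)) D x ∧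
      ∀ X, D X = ⟪L x, M X⟫_ℝ + ⟪L X, M x⟫_ℝ :=
  ⟨_, Complex.ofRealCLM.hasFDerivAt.comp x (L.hasFDerivAt.inner ℝ M.hasFDerivAt),
    fun X => by simp [fderivInnerCLM_apply]⟩

theorem hasFDerivAt_baseExponent (τ : ℍ) (x : V × V) :
    ∃ D : V × V →L[ℝ] ℂ, HasFDerivAt (baseExponent τ) D x ∧
      ∀ X, D X = 2 * Real.pi * Complex.I * zetaInner τ X x.2 - connForm x X := by
  obtain ⟨D₁, h₁, e₁⟩ := hasFDerivAt_ofReal_inner (ContinuousLinearMap.fst ℝ V V)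
    (ContinuousLinearMap.snd ℝ V V) x
  obtain ⟨D₂, h₂, e₂⟩ := hasFDerivAt_ofReal_inner (ContinuousLinearMap.snd ℝ V V)
    (ContinuousLinearMap.snd ℝ V V) x
  refine ⟨_, (h₁.add (h₂.const_mul (τ : ℂ))).const_mul (Complex.I * Real.pi), fun X => ?_⟩
  simp only [smul_apply, add_apply, e₁, e₂, smul_eq_mul, zetaInner, connForm,
    ContinuousLinearMap.coe_fst', ContinuousLinearMap.coe_snd', div_eq_mul_inv, Complex.inv_I,
    real_inner_comm x.2 X.1, real_inner_comm X.2 x.2]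
  push_cast
  ring

theorem baseSection_pow (τ : ℍ) (k : ℕ) (x : V × V) :
    baseSection τ x ^ k = Complex.exp (k * baseExponent τ x) := by
  rw [baseSection, ← Complex.exp_nat_mul, baseExponent]

theorem contDiff_baseExponent (τ : ℍ) : ContDiff ℝ ∞ (baseExponent τ : V × V → ℂ) := by
  have h : ∀ {L M : V × V → V}, ContDiff ℝ ∞ L → ContDiff ℝ ∞ M →
      ContDiff ℝ ∞ fun x => ((⟪L x, M x⟫_ℝ : ℝ) : ℂ) := fun hL hM =>
    Complex.ofRealCLM.contDiff.comp (hL.inner ℝ hM)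
  exact contDiff_const.mul ((h contDiff_fst contDiff_snd).add
    (contDiff_const.mul (h contDiff_snd contDiff_snd)))

theorem nabla_mul_baseSection_pow (τ : ℍ) (k : ℕ) {f : V × V → ℂ} {x : V × V}
    (hf : DifferentiableAt ℝ f x) (X : V × V) :
    nabla k (fun y => f y * baseSection τ y ^ k) x X = baseSection τ x ^ k *
      (fderiv ℝ f x X + f x * (k * (2 * Real.pi * Complex.I * zetaInner τ X x.2))) := by
  obtain ⟨D, hD, e⟩ := hasFDerivAt_baseExponent τ x
  simp only [baseSection_pow]
  have h := hf.hasFDerivAt.mul (hD.const_mul (k : ℂ)).cexp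
  rw [nabla]
  change fderiv ℝ (f * fun y => Complex.exp (k * baseExponent τ y)) x X + _ = _
  rw [h.fderiv]
  simp only [add_apply, smul_apply, smul_eq_mul, e]
  ring

theorem isCauchyRiemann_iff_nabla (τ : ℍ) (k : ℕ) {f : V × V → ℂ} (hf : Differentiable ℝ f) :
    IsCauchyRiemann τ f ↔ ∀ x X, nabla k (fun y => f y * baseSection τ y ^ k) x
      (complexStructure V τ X) =
        Complex.I * nabla k (fun y => f y * baseSection τ y ^ k) x X := by
  refine forall_congr' fun x => forall_congr' fun X => ?_
  rw [nabla_mul_baseSection_pow τ k (hf x), nabla_mul_baseSection_pow τ k (hf x),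
    zetaInner_complexStructure]
  have h0 : baseSection τ x ^ k ≠ 0 := pow_ne_zero _ (Complex.exp_ne_zero _)
  constructor
  · intro h
    rw [h]
    ring
  · intro h
    refine add_right_cancel (b := f x * (k * (2 * Real.pi * Complex.I *
      (Complex.I * zetaInner τ X x.2)))) (mul_left_cancel₀ h0 ?_)
    rw [h]
    ring

end Holomorphic

section ThetaSections

variable {V : Type*} [NormedAddCommGroup V] [InnerProductSpace ℝ V]

/-- The term of index `g ∈ μ + Λ` of the section `Θ_{μ,k} s_τ^k`. -/
noncomputable def thetaTerm (τ : ℍ) (k : ℕ) (g : V) (x : V × V) : ℂ :=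
  Complex.exp (Complex.I * Real.pi * k * (⟪x.1, x.2⟫_ℝ : ℂ)) *
    Complex.exp (Complex.I * Real.pi * k * τ * (‖g - x.2‖ ^ 2 : ℝ)) * latticeChar k (-g) x.1

theorem thetaSection_eq_tsum (Λ : Submodule ℤ V) (τ : ℍ) (k : ℕ) (μ : V) (x : V × V) :
    thetaSection Λ τ k μ x = ∑' l : Λ, thetaTerm τ k (μ + l) x := by
  rw [thetaSection, theta, ← tsum_mul_right]
  refine tsum_congr fun l => ?_
  rw [baseSection_pow, thetaTerm, latticeChar, ← Complex.exp_add, ← Complex.exp_add,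
    ← Complex.exp_add, baseExponent, ← real_inner_self_eq_norm_sq]
  congr 1
  simp only [inner_sub_left, inner_sub_right, inner_neg_right,
    real_inner_comm x.2 (μ + (l : V))]
  push_cast
  ring

theorem norm_thetaTerm (τ : ℍ) (k : ℕ) (g : V) (x : V × V) :
    ‖thetaTerm τ k g x‖ = Real.exp (-(Real.pi * k * τ.im) * ‖g - x.2‖ ^ 2) := by
  rw [thetaTerm, norm_mul, norm_latticeChar, mul_one, norm_mul, Complex.norm_exp, Complex.norm_exp,
    ← Real.exp_add]
  congr 1
  simp [Complex.mul_re, Complex.mul_im, -Complex.ofReal_pow]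

theorem norm_multiplier (l x : V × V) : ‖multiplier l x‖ = 1 := by
  rw [multiplier, norm_mul, Complex.norm_exp, Complex.norm_exp]
  simp

theorem thetaTerm_add {Λ : Submodule ℤ V} (hΛ : ∀ a ∈ Λ, ∀ b ∈ Λ, ∃ m : ℤ, ⟪a, b⟫_ℝ = m)
    (τ : ℍ) {k : ℕ} {g : V} (hg : g ∈ scaledDual Λ k) {l : V × V} (h1 : l.1 ∈ Λ) (h2 : l.2 ∈ Λ)
    (x : V × V) :
    thetaTerm τ k (g + l.2) (l + x) = multiplier l x ^ k * thetaTerm τ k g x := by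
  obtain ⟨m, hm⟩ := hΛ _ h1 _ h2
  obtain ⟨m', hm'⟩ := hg _ h1
  have hm'' : (k : ℂ) * (⟪g, l.1⟫_ℝ : ℂ) = m' := by exact_mod_cast hm'
  have e : (g + l.2 - (l + x).2) = g - x.2 := by
    rw [Prod.snd_add]; abel
  rw [thetaTerm, thetaTerm, e, multiplier, ← Complex.exp_add (Complex.I * _ * _),
    ← Complex.exp_nat_mul]
  simp only [latticeChar, ← Complex.exp_add]
  rw [Complex.exp_eq_exp_iff_exists_int]
  refine ⟨-(k * m) - m', ?_⟩
  rw [symplForm_apply]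
  simp only [Prod.fst_add, Prod.snd_add, inner_add_left, inner_add_right, inner_neg_right, hm,
    real_inner_comm x.1 l.2, real_inner_comm g l.1]
  push_cast
  linear_combination (-2 * Real.pi * Complex.I) * hm''

variable (Λ : Submodule ℤ V)

theorem isInvariant_thetaSection (hΛ : ∀ a ∈ Λ, ∀ b ∈ Λ, ∃ m : ℤ, ⟪a, b⟫_ℝ = m) (τ : ℍ) (k : ℕ)
    {μ : V} (hμ : μ ∈ scaledDual Λ k) : IsInvariant Λ k (thetaSection Λ τ k μ) := by
  intro l h1 h2 x
  rw [thetaSection_eq_tsum, thetaSection_eq_tsum, ← tsum_mul_left,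
    ← (Equiv.addRight (⟨l.2, h2⟩ : Λ)).tsum_eq]
  refine tsum_congr fun a => ?_
  have ha : (a : V) ∈ scaledDual Λ k := fun b hb => by
    obtain ⟨m, hm⟩ := hΛ a a.2 b hb
    exact ⟨k * m, by rw [hm]; push_cast; rfl⟩
  rw [← thetaTerm_add hΛ τ (add_mem hμ ha) h1 h2, Equiv.coe_addRight, Submodule.coe_add, add_assoc]

theorem thetaSection_add_of_mem (τ : ℍ) (k : ℕ) (μ : V) {l : V} (hl : l ∈ Λ) :
    thetaSection Λ τ k (μ + l) = thetaSection Λ τ k μ := by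
  ext x
  rw [thetaSection_eq_tsum, thetaSection_eq_tsum,
    ← (Equiv.addLeft (⟨l, hl⟩ : Λ)).tsum_eq fun a : Λ => thetaTerm τ k (μ + a) x]
  refine tsum_congr fun a => ?_
  rw [Equiv.coe_addLeft, Submodule.coe_add, ← add_assoc]

variable [FiniteDimensional ℝ V] [DiscreteTopology Λ] [IsZLattice ℝ Λ]

theorem summable_thetaTerm (τ : ℍ) {k : ℕ} (hk : k ≠ 0) (μ : V) (x : V × V) :
    Summable fun l : Λ => ‖thetaTerm τ k (μ + l) x‖ := by
  have hc : 0 < Real.pi * k * τ.im := by have := τ.im_pos; positivity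
  refine (summable_exp_neg_mul_norm_add_sq Λ hc (μ - x.2)).congr fun l => ?_
  rw [norm_thetaTerm]
  congr 4
  abel

variable (V) in
/-- The complex coordinates `ζ_τ = p + τ q` of `V × V` in an orthonormal basis of `V`. -/
noncomputable def zetaCoord (τ : ℍ) : V × V →L[ℝ] (Fin (finrank ℝ V) → ℂ) :=
  ContinuousLinearMap.pi fun i =>
    Complex.ofRealCLM ∘L innerSL ℝ (stdOrthonormalBasis ℝ V i) ∘L ContinuousLinearMap.fst ℝ V V +
    (τ : ℂ) • (Complex.ofRealCLM ∘L innerSL ℝ (stdOrthonormalBasis ℝ V i) ∘L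
      ContinuousLinearMap.snd ℝ V V)

theorem zetaCoord_apply (τ : ℍ) (x : V × V) (i : Fin (finrank ℝ V)) :
    zetaCoord V τ x i = zetaInner τ x (stdOrthonormalBasis ℝ V i) := by
  simp [zetaCoord, zetaInner, real_inner_comm]

theorem sum_zetaCoord_mul (τ : ℍ) (x : V × V) (v : V) :
    ∑ i, zetaCoord V τ x i * (⟪stdOrthonormalBasis ℝ V i, v⟫_ℝ : ℂ) = zetaInner τ x v := by
  simp only [zetaCoord_apply, zetaInner, add_mul, Finset.sum_add_distrib, mul_assoc,
    ← Finset.mul_sum]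
  rw [← (stdOrthonormalBasis ℝ V).sum_inner_mul_inner x.1 v,
    ← (stdOrthonormalBasis ℝ V).sum_inner_mul_inner x.2 v]
  push_cast
  rfl

theorem zetaCoord_complexStructure (τ : ℍ) (X : V × V) :
    zetaCoord V τ (complexStructure V τ X) = Complex.I • zetaCoord V τ X := by
  ext i
  simp [zetaCoord_apply, zetaInner_complexStructure]

theorem isCauchyRiemann_comp_zetaCoord (τ : ℍ) {G : (Fin (finrank ℝ V) → ℂ) → ℂ}
    (hG : Differentiable ℂ G) : IsCauchyRiemann τ fun x => G (zetaCoord V τ x) := fun x X => by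
  have h : HasFDerivAt (fun x => G (zetaCoord V τ x))
      (((fderiv ℂ G (zetaCoord V τ x)).restrictScalars ℝ).comp (zetaCoord V τ)) x :=
    ((hG _).hasFDerivAt.restrictScalars ℝ).comp x (zetaCoord V τ).hasFDerivAt
  rw [h.fderiv]
  simp only [ContinuousLinearMap.comp_apply, ContinuousLinearMap.coe_restrictScalars',
    zetaCoord_complexStructure, map_smul, smul_eq_mul]

/-- The theta function is an entire function of `ζ_τ`. -/
theorem exists_theta_eq_comp_zetaCoord (τ : ℍ) {k : ℕ} (hk : k ≠ 0) (μ : V) :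
    ∃ G : (Fin (finrank ℝ V) → ℂ) → ℂ, ContDiff ℂ ∞ G ∧
      ∀ x, theta Λ τ k μ x = G (zetaCoord V τ x) := by
  let e := stdOrthonormalBasis ℝ V
  let a : Λ → ℂ := fun l =>
    Complex.exp (Complex.I * Real.pi * k * τ * (‖(l : V) + μ‖ ^ 2 : ℝ))
  let ℓ : Λ → (Fin (finrank ℝ V) → ℂ) →L[ℂ] ℂ := fun l =>
    (-(2 * Complex.I * Real.pi * k)) •
      ∑ i, (⟪e i, μ + l⟫_ℝ : ℂ) • ContinuousLinearMap.proj (R := ℂ) (φ := fun _ => ℂ) i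
  have hℓ : ∀ l z, ℓ l z = -(2 * Complex.I * Real.pi * k) * ∑ i, z i * (⟪e i, μ + l⟫_ℝ : ℂ) :=
    fun l z => by simp [ℓ, mul_comm (z _)]
  have ha : ∀ l, ‖a l‖ = Real.exp (-(Real.pi * k * τ.im) * ‖(l : V) + μ‖ ^ 2) := fun l => by
    rw [Complex.norm_exp]
    congr 1
    simp [Complex.mul_re, Complex.mul_im, -Complex.ofReal_pow]
  let C : ℝ := 2 * Real.pi * k * finrank ℝ V
  have hn : ∀ l, ‖ℓ l‖ ≤ C * ‖(l : V) + μ‖ := fun l => by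
    refine ContinuousLinearMap.opNorm_le_bound _ (by positivity) fun z => ?_
    rw [hℓ, norm_mul]
    have h1 : ‖∑ i, z i * (⟪e i, μ + l⟫_ℝ : ℂ)‖ ≤ finrank ℝ V * (‖z‖ * ‖(l : V) + μ‖) := by
      refine (norm_sum_le _ _).trans ((Finset.sum_le_card_nsmul _ _ (‖z‖ * ‖(l : V) + μ‖)
        fun i _ => ?_).trans_eq (by simp))
      rw [norm_mul, Complex.norm_real]
      refine mul_le_mul (norm_le_pi_norm z i) ?_ (norm_nonneg _) (norm_nonneg _)
      have := norm_inner_le_norm (𝕜 := ℝ) (e i) (μ + l)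
      rw [e.orthonormal.1 i, one_mul] at this
      rwa [add_comm (l : V)]
    have h2 : ‖-(2 * Complex.I * Real.pi * k)‖ = 2 * Real.pi * k := by
      simp [abs_of_pos Real.pi_pos]
    rw [h2]
    calc 2 * Real.pi * k * _ ≤ 2 * Real.pi * k * (finrank ℝ V * (‖z‖ * ‖(l : V) + μ‖)) := by gcongr
      _ = C * ‖(l : V) + μ‖ * ‖z‖ := by simp only [C]; ring
  have hc : 0 < Real.pi * k * τ.im := by have := τ.im_pos; positivity
  refine ⟨fun z => ∑' l, a l * Complex.exp (ℓ l z), contDiff_tsum_exp fun R => ?_, fun x => ?_⟩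
  · refine Summable.of_nonneg_of_le (fun l => by positivity) (fun l => ?_)
      (summable_exp_neg_mul_norm_add_sq_mul_exp Λ hc μ (|R| * C))
    rw [ha]
    refine mul_le_mul_of_nonneg_left (Real.exp_le_exp.2 ?_) (Real.exp_pos _).le
    rw [mul_assoc]
    exact mul_le_mul (le_abs_self R) (hn l) (norm_nonneg _) (abs_nonneg R)
  · refine tsum_congr fun l => ?_
    rw [hℓ, sum_zetaCoord_mul, ← Complex.exp_add, add_comm (l : V), real_inner_self_eq_norm_sq]
    congr 1
    simp only [zetaInner]
    push_cast
    ring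

theorem contDiff_theta (τ : ℍ) {k : ℕ} (hk : k ≠ 0) (μ : V) : ContDiff ℝ ∞ (theta Λ τ k μ) := by
  obtain ⟨G, hG, h⟩ := exists_theta_eq_comp_zetaCoord Λ τ hk μ
  rw [funext h]
  exact (hG.restrict_scalars ℝ).comp (zetaCoord V τ).contDiff

theorem isCauchyRiemann_theta (τ : ℍ) {k : ℕ} (hk : k ≠ 0) (μ : V) :
    IsCauchyRiemann τ (theta Λ τ k μ) := by
  obtain ⟨G, hG, h⟩ := exists_theta_eq_comp_zetaCoord Λ τ hk μ
  rw [funext h]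
  exact isCauchyRiemann_comp_zetaCoord τ (hG.differentiable (by simp))

theorem thetaSection_mem_quantumSpace (hΛ : ∀ a ∈ Λ, ∀ b ∈ Λ, ∃ m : ℤ, ⟪a, b⟫_ℝ = m) (τ : ℍ)
    {k : ℕ} (hk : k ≠ 0) {μ : V} (hμ : μ ∈ scaledDual Λ k) :
    thetaSection Λ τ k μ ∈ quantumSpace Λ τ k := by
  refine ⟨(contDiff_theta Λ τ hk μ).mul ?_, isInvariant_thetaSection Λ hΛ τ k hμ, ?_⟩
  · simp only [baseSection_pow]
    exact (contDiff_const.mul (contDiff_baseExponent τ)).cexp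
  · exact (isCauchyRiemann_iff_nabla τ k ((contDiff_theta Λ τ hk μ).differentiable (by simp))).1
      (isCauchyRiemann_theta Λ τ hk μ)

end ThetaSections

/-! ### Fourier coefficients of sections and the theta basis -/

section FiberCoefficients

variable {V : Type*} [NormedAddCommGroup V] [InnerProductSpace ℝ V]

/-- The restriction of a section of `L^k` to the fibre `V × {q}`, in the trivialisation in which
invariance under `Λ × {0}` becomes periodicity. -/
noncomputable def sectionFiber (k : ℕ) (s : V × V → ℂ) (q p : V) : ℂ :=
  s (p, q) * Complex.exp (-(Complex.I * Real.pi * k * (⟪p, q⟫_ℝ : ℂ)))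

theorem continuous_sectionFiber (k : ℕ) {s : V × V → ℂ} (hs : Continuous s) (q : V) :
    Continuous (sectionFiber k s q) := by
  unfold sectionFiber
  fun_prop

theorem sectionFiber_add {Λ : Submodule ℤ V} {k : ℕ} {s : V × V → ℂ} (hs : IsInvariant Λ k s)
    (q : V) {l : V} (hl : l ∈ Λ) (p : V) : sectionFiber k s q (l + p) = sectionFiber k s q p := by
  have h := hs (l, 0) hl (zero_mem Λ) (p, q)
  rw [Prod.mk_add_mk, zero_add] at h
  rw [sectionFiber, h, sectionFiber, multiplier, ← Complex.exp_add (Complex.I * _ * _),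
    ← Complex.exp_nat_mul, symplForm_apply, mul_right_comm, ← Complex.exp_add, mul_comm]
  congr 2
  simp only [inner_add_left, inner_zero_right, inner_zero_left]
  push_cast
  ring

theorem sectionFiber_add_base {Λ : Submodule ℤ V} {k : ℕ} {s : V × V → ℂ}
    (hs : IsInvariant Λ k s) {l : V} (hl : l ∈ Λ) (q p : V) :
    sectionFiber k s (l + q) p = sectionFiber k s q p * latticeChar k (-l) p := by
  have h := hs (0, l) (zero_mem Λ) hl (p, q)
  rw [Prod.mk_add_mk, zero_add] at h
  rw [sectionFiber, h, sectionFiber, multiplier, ← Complex.exp_add (Complex.I * _ * _),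
    ← Complex.exp_nat_mul, symplForm_apply, mul_right_comm, ← Complex.exp_add, mul_comm,
    latticeChar, mul_assoc (s (p, q)), ← Complex.exp_add]
  congr 2
  simp only [inner_add_right, inner_zero_left, inner_neg_right, real_inner_comm p l]
  push_cast
  ring

theorem mem_scaledDual_of_mem {Λ : Submodule ℤ V}
    (hΛ : ∀ a ∈ Λ, ∀ b ∈ Λ, ∃ m : ℤ, ⟪a, b⟫_ℝ = m) (k : ℕ) {l : V} (hl : l ∈ Λ) :
    l ∈ scaledDual Λ k := fun b hb => by
  obtain ⟨m, hm⟩ := hΛ l hl b hb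
  exact ⟨k * m, by rw [hm]; push_cast; rfl⟩

theorem sectionFiber_thetaTerm (τ : ℍ) (k : ℕ) (g q p : V) :
    sectionFiber k (thetaTerm τ k g) q p =
      Complex.exp (Complex.I * Real.pi * k * τ * (‖g - q‖ ^ 2 : ℝ)) * latticeChar k (-g) p := by
  rw [sectionFiber, thetaTerm, mul_comm, ← mul_assoc, ← mul_assoc, ← Complex.exp_add,
    neg_add_cancel, Complex.exp_zero, one_mul]

variable {Λ : Submodule ℤ V} [FiniteDimensional ℝ V] [DiscreteTopology Λ] [IsZLattice ℝ Λ]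
  [MeasurableSpace V] [BorelSpace V]

/-- The Fourier coefficients along the fibres `V × {q}` of a section of `L^k`. -/
noncomputable def fiberCoef (γ : Basis (Fin (finrank ℝ V)) ℤ Λ) (k : ℕ) (s : V × V → ℂ)
    (q g : V) : ℂ :=
  ∫ p in latticeCell γ, sectionFiber k s q p * latticeChar k g p

theorem fiberCoef_add (γ : Basis (Fin (finrank ℝ V)) ℤ Λ) (k : ℕ) {s t : V × V → ℂ}
    (hs : Continuous s) (ht : Continuous t) (q g : V) :
    fiberCoef γ k (s + t) q g = fiberCoef γ k s q g + fiberCoef γ k t q g := by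
  have h : ∀ {u : V × V → ℂ}, Continuous u → Integrable
      (fun p => sectionFiber k u q p * latticeChar k g p) (volume.restrict (latticeCell γ)) :=
    fun hu => integrableOn_latticeCell_of_continuous γ
      ((continuous_sectionFiber k hu q).mul (continuous_latticeChar k g))
  rw [fiberCoef, fiberCoef, fiberCoef, ← integral_add (h hs) (h ht)]
  simp only [sectionFiber, Pi.add_apply, add_mul]

theorem fiberCoef_smul (γ : Basis (Fin (finrank ℝ V)) ℤ Λ) (k : ℕ) (c : ℂ) (s : V × V → ℂ)
    (q g : V) : fiberCoef γ k (c • s) q g = c * fiberCoef γ k s q g := by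
  rw [fiberCoef, fiberCoef, ← integral_const_mul]
  simp only [sectionFiber, Pi.smul_apply, smul_eq_mul, mul_assoc]

theorem fiberCoef_sum (γ : Basis (Fin (finrank ℝ V)) ℤ Λ) (k : ℕ) {ι : Type*} (S : Finset ι)
    (c : ι → ℂ) {s : ι → V × V → ℂ} (hs : ∀ i, Continuous (s i)) (q g : V) :
    fiberCoef γ k (∑ i ∈ S, c i • s i) q g = ∑ i ∈ S, c i * fiberCoef γ k (s i) q g := by
  classical
  induction S using Finset.induction_on with
  | empty => simp [fiberCoef, sectionFiber]
  | insert i S hi ih =>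
    rw [Finset.sum_insert hi, Finset.sum_insert hi, fiberCoef_add γ k ((hs i).const_smul _), ih,
      fiberCoef_smul]
    have := continuous_finsetSum S fun i _ => (hs i).const_smul (c i)
    simpa only [← Finset.sum_apply] using this

/-- A continuous section of `L^k` is determined by its Fourier coefficients. -/
theorem eq_of_fiberCoef_eq (γ : Basis (Fin (finrank ℝ V)) ℤ Λ) {k : ℕ} (hk : k ≠ 0)
    {s t : V × V → ℂ} (hs : Continuous s) (ht : Continuous t) {q : V}
    (hs' : ∀ l ∈ Λ, ∀ p, sectionFiber k s q (l + p) = sectionFiber k s q p)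
    (ht' : ∀ l ∈ Λ, ∀ p, sectionFiber k t q (l + p) = sectionFiber k t q p)
    (h : ∀ g ∈ scaledDual Λ k, fiberCoef γ k s q g = fiberCoef γ k t q g) (p : V) :
    s (p, q) = t (p, q) := by
  have hsub : ∀ p, sectionFiber k (s + (-1 : ℂ) • t) q p =
      sectionFiber k s q p - sectionFiber k t q p := fun p => by
    simp only [sectionFiber, Pi.add_apply, Pi.smul_apply, smul_eq_mul]
    ring
  have h0 := eq_zero_of_setIntegral_latticeChar_eq_zero γ hk
    (continuous_sectionFiber k (hs.add (ht.const_smul (-1 : ℂ))) q)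
    (fun l hl p => by rw [hsub, hsub, hs' l hl, ht' l hl])
    (fun g hg => by
      have := fiberCoef_add γ k hs (ht.const_smul (-1 : ℂ)) q g
      rw [fiberCoef_smul, h g hg, neg_one_mul, add_neg_cancel] at this
      exact this) p
  rw [hsub, sectionFiber, sectionFiber, ← sub_mul] at h0
  exact sub_eq_zero.1 ((mul_eq_zero.1 h0).resolve_right (Complex.exp_ne_zero _))

open Classical in
theorem setIntegral_tsum_mul_latticeChar (γ : Basis (Fin (finrank ℝ V)) ℤ Λ) {k : ℕ} (hk : k ≠ 0)
    {c : Λ → ℂ} (hc : Summable fun l => ‖c l‖) {ν : Λ → V} (hν : ∀ l, ν l ∈ scaledDual Λ k) :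
    ∫ p in latticeCell γ, ∑' l, c l * latticeChar k (ν l) p =
      ∑' l, c l * if ν l = 0 then ((volume : Measure V).real (latticeCell γ) : ℂ) else 0 := by
  have hint : ∀ l, Integrable (fun p => c l * latticeChar k (ν l) p)
      (volume.restrict (latticeCell γ)) := fun l =>
    integrableOn_latticeCell_of_continuous γ
      (continuous_const.mul (continuous_latticeChar k _))
  have h := hasSum_integral_of_summable_integral_norm hint (by
    simp only [norm_mul, norm_latticeChar, mul_one, integral_const, smul_eq_mul]
    exact hc.mul_left _)
  rw [← h.tsum_eq]
  refine tsum_congr fun l => ?_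
  rw [integral_const_mul, setIntegral_latticeChar γ hk (hν l)]

open Classical in
theorem fiberCoef_thetaSection (hΛ : ∀ a ∈ Λ, ∀ b ∈ Λ, ∃ m : ℤ, ⟪a, b⟫_ℝ = m)
    (γ : Basis (Fin (finrank ℝ V)) ℤ Λ) (τ : ℍ) {k : ℕ} (hk : k ≠ 0)
    {μ g : V} (hμ : μ ∈ scaledDual Λ k) (hg : g ∈ scaledDual Λ k) (q : V) :
    fiberCoef γ k (thetaSection Λ τ k μ) q g = if g - μ ∈ Λ then
      ((volume : Measure V).real (latticeCell γ) : ℂ) *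
        Complex.exp (Complex.I * Real.pi * k * τ * (‖g - q‖ ^ 2 : ℝ)) else 0 := by
  let c : Λ → ℂ := fun l => Complex.exp (Complex.I * Real.pi * k * τ * (‖μ + l - q‖ ^ 2 : ℝ))
  have hc : Summable fun l => ‖c l‖ := by
    refine (summable_thetaTerm Λ τ hk μ (0, q)).congr fun l => ?_
    rw [thetaTerm, norm_mul, norm_latticeChar]
    simp [c]
  have h1 : ∀ p, sectionFiber k (thetaSection Λ τ k μ) q p * latticeChar k g p =
      ∑' l, c l * latticeChar k (g - (μ + l)) p := fun p => by
    rw [sectionFiber, thetaSection_eq_tsum, ← tsum_mul_right, ← tsum_mul_right]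
    refine tsum_congr fun l => ?_
    rw [sub_eq_neg_add, latticeChar_add_left, ← mul_assoc]
    congr 1
    exact sectionFiber_thetaTerm τ k (μ + l) q p
  simp only [fiberCoef, h1]
  rw [setIntegral_tsum_mul_latticeChar γ hk hc fun l =>
    sub_mem hg (add_mem hμ (mem_scaledDual_of_mem hΛ k l.2))]
  split_ifs with h
  · rw [tsum_eq_single (⟨g - μ, h⟩ : Λ), if_pos (by simp), mul_comm]
    · simp [c]
    · intro l hl
      rw [if_neg, mul_zero]
      intro h0
      refine hl (Subtype.ext ?_)
      rw [← sub_eq_zero, ← neg_eq_zero, ← h0]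
      simp only
      abel
  · refine (tsum_congr fun l : Λ => ?_).trans tsum_zero
    rw [if_neg, mul_zero]
    intro h0
    refine h ?_
    have : g - μ = l := by
      rw [← sub_eq_zero, ← h0]
      abel
    rw [this]
    exact l.2

end FiberCoefficients

section ThetaIndex

variable {V : Type*} [NormedAddCommGroup V] [InnerProductSpace ℝ V]

theorem quotientMk_eq_iff {Λ : Submodule ℤ V} {k : ℕ} (μ ν : scaledDual Λ k) :
    (Submodule.Quotient.mk μ : ThetaIndex Λ k) = Submodule.Quotient.mk ν ↔ (μ : V) - ν ∈ Λ := by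
  rw [Submodule.Quotient.eq]
  rfl

theorem coe_out_sub_mem {Λ : Submodule ℤ V} {k : ℕ} (μ : scaledDual Λ k) :
    ((Submodule.Quotient.mk μ : ThetaIndex Λ k).out : V) - μ ∈ Λ := by
  rw [← quotientMk_eq_iff]
  exact Quotient.out_eq _

variable {Λ : Submodule ℤ V} [FiniteDimensional ℝ V] [DiscreteTopology Λ] [IsZLattice ℝ Λ]

theorem finite_scaledDual_inter (γ : Basis (Fin (finrank ℝ V)) ℤ Λ) {k : ℕ} (hk : k ≠ 0) {S : Set V}
    (hS : Bornology.IsBounded S) : {v | v ∈ scaledDual Λ k ∧ v ∈ S}.Finite := by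
  obtain ⟨R, hR⟩ := hS.exists_norm_le
  let b := γ.ofZLatticeBasis ℝ Λ
  have hb : ∀ i, b i ∈ Λ := fun i => by
    rw [γ.ofZLatticeBasis_apply ℝ Λ]
    exact (γ i).2
  -- an element of `k⁻¹ Λ*` is determined by the integers `k B(v, γ_i)`
  let φ : V → Fin (finrank ℝ V) → ℤ := fun v i => ⌊(k : ℝ) * ⟪v, b i⟫_ℝ⌋
  have hφ : ∀ v ∈ scaledDual Λ k, ∀ i, (φ v i : ℝ) = k * ⟪v, b i⟫_ℝ := fun v hv i => by
    obtain ⟨m, hm⟩ := hv (b i) (hb i)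
    simp only [φ, hm, Int.floor_intCast]
  refine Set.Finite.of_finite_image (f := φ) ?_ fun v hv w hw hvw => ?_
  · refine (Set.Finite.pi' (t := fun i => Set.Icc (-⌈k * (R * ‖b i‖)⌉) ⌈k * (R * ‖b i‖)⌉)
      fun i => Set.finite_Icc _ _).subset ?_
    rintro _ ⟨v, hv, rfl⟩ i
    have h1 : |(φ v i : ℝ)| ≤ k * (R * ‖b i‖) := by
      rw [hφ v hv.1, abs_mul, Nat.abs_cast]
      gcongr
      exact (abs_real_inner_le_norm _ _).trans (by gcongr; exact hR v hv.2)
    have h2 := (abs_le.1 (h1.trans (Int.le_ceil _)))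
    exact ⟨by exact_mod_cast h2.1, by exact_mod_cast h2.2⟩
  · refine InnerProductSpace.ext_inner_right_basis b fun i => ?_
    have hk' : (k : ℝ) ≠ 0 := by exact_mod_cast hk
    have := congrArg (Int.cast : ℤ → ℝ) (congrFun hvw i)
    rw [hφ v hv.1, hφ w hw.1] at this
    exact mul_left_cancel₀ hk' this

theorem finite_thetaIndex (hΛ : ∀ a ∈ Λ, ∀ b ∈ Λ, ∃ m : ℤ, ⟪a, b⟫_ℝ = m)
    (γ : Basis (Fin (finrank ℝ V)) ℤ Λ) {k : ℕ} (hk : k ≠ 0) : Finite (ThetaIndex Λ k) := by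
  have hfin := finite_scaledDual_inter γ hk
    (ZSpan.fundamentalDomain_isBounded (γ.ofZLatticeBasis ℝ Λ))
  have : Finite {v | v ∈ scaledDual Λ k ∧ v ∈ latticeCell γ} := hfin
  refine Finite.of_surjective (fun v : {v | v ∈ scaledDual Λ k ∧ v ∈ latticeCell γ} =>
    (Submodule.Quotient.mk ⟨v.1, v.2.1⟩ : ThetaIndex Λ k)) fun x => ?_
  obtain ⟨μ, rfl⟩ := Submodule.Quotient.mk_surjective _ x
  obtain ⟨l, hl, hl'⟩ := exists_add_mem_latticeCell γ (μ : V)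
  refine ⟨⟨l + μ, add_mem (mem_scaledDual_of_mem hΛ k hl) μ.2, hl'⟩, ?_⟩
  rw [Submodule.Quotient.eq]
  change l + (μ : V) - μ ∈ Λ
  rwa [add_sub_cancel_right]

end ThetaIndex

section Spanning

variable {V : Type*} [NormedAddCommGroup V] [InnerProductSpace ℝ V]
  {Λ : Submodule ℤ V} [FiniteDimensional ℝ V] [DiscreteTopology Λ] [IsZLattice ℝ Λ]
  [MeasurableSpace V] [BorelSpace V]

theorem hasFDerivAt_setIntegral_latticeCell (γ : Basis (Fin (finrank ℝ V)) ℤ Λ) {F : V × V → ℂ}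
    (hF : ContDiff ℝ 1 F) (z : V × V) :
    HasFDerivAt (fun z => ∫ p in latticeCell γ, F ((p, 0) + z))
      (∫ p in latticeCell γ, fderiv ℝ F ((p, 0) + z)) z := by
  have hb : Bornology.IsBounded (latticeCell γ) := ZSpan.fundamentalDomain_isBounded _
  have hd := hF.continuous_fderiv one_ne_zero
  have hK : IsCompact ((fun y : V × (V × V) => ((y.1, (0 : V)) + y.2)) ''
      (closure (latticeCell γ) ×ˢ Metric.closedBall z 1)) :=
    (hb.isCompact_closure.prod (isCompact_closedBall z 1)).image (by fun_prop)
  obtain ⟨C, hC⟩ := hK.exists_bound_of_continuousOn hd.continuousOn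
  have : IsFiniteMeasure ((volume : Measure V).restrict (latticeCell γ)) :=
    ⟨by simpa using volume_latticeCell_lt_top γ⟩
  refine hasFDerivAt_integral_of_dominated_of_fderiv_le (s := Metric.ball z 1) (bound := fun _ => C)
    (F' := fun z p => fderiv ℝ F ((p, 0) + z)) (Metric.ball_mem_nhds z one_pos) ?_ ?_ ?_ ?_
    (integrable_const C) ?_
  · refine Filter.Eventually.of_forall fun y => ?_
    exact (hF.continuous.comp (by fun_prop)).aestronglyMeasurable
  · exact integrableOn_latticeCell_of_continuous γ (hF.continuous.comp (by fun_prop))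
  · exact (hd.comp (by fun_prop)).aestronglyMeasurable
  · refine (ae_restrict_iff' (measurableSet_latticeCell γ)).2 (Filter.Eventually.of_forall ?_)
    intro p hp y hy
    exact hC _ ⟨(p, y), ⟨subset_closure hp, Metric.ball_subset_closedBall hy⟩, rfl⟩
  · refine Filter.Eventually.of_forall fun p y _ => ?_
    exact ((hF.differentiable one_ne_zero) _).hasFDerivAt.comp y
      ((hasFDerivAt_id y).const_add (p, (0 : V)))

/-- The integral in `p` over a cell of a function that is holomorphic for `j_τ` and `Λ`-periodic in
`p` does not depend on `q`. Indeed a translation of `p` does not change it, and the Cauchy–Riemann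
equations express its derivative in `q` by its derivative under translations of `p`. -/
theorem setIntegral_latticeCell_const (γ : Basis (Fin (finrank ℝ V)) ℤ Λ) (τ : ℍ)
    {F : V × V → ℂ} (hF : ContDiff ℝ ∞ F) (hCR : IsCauchyRiemann τ F)
    (hper : ∀ l ∈ Λ, ∀ p q, F (l + p, q) = F (p, q)) (q : V) :
    ∫ p in latticeCell γ, F (p, q) = ∫ p in latticeCell γ, F (p, 0) := by
  have hF1 : ContDiff ℝ 1 F := hF.of_le (by exact_mod_cast le_top)
  let Φ : V × V → ℂ := fun z => ∫ p in latticeCell γ, F ((p, 0) + z)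
  have hΦ : ∀ z, HasFDerivAt Φ (∫ p in latticeCell γ, fderiv ℝ F ((p, 0) + z)) z :=
    hasFDerivAt_setIntegral_latticeCell γ hF1
  have hint := fun z : V × V => integrableOn_latticeCell_of_continuous γ
    (h := fun p => fderiv ℝ F ((p, 0) + z))
    ((hF1.continuous_fderiv one_ne_zero).comp (by fun_prop))
  have hCRΦ : IsCauchyRiemann τ Φ := fun z X => by
    rw [(hΦ z).fderiv, ContinuousLinearMap.integral_apply (hint z),
      ContinuousLinearMap.integral_apply (hint z), ← integral_const_mul]
    simp only [hCR _ X]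
  have hinv : ∀ v z, Φ ((v, 0) + z) = Φ z := fun v z => by
    have := setIntegral_latticeCell_add γ (h := fun p => F ((p, 0) + z))
      (fun l hl p => by
        have := hper l hl (p + z.1) (0 + z.2)
        rwa [← add_assoc] at this) v
    refine Eq.trans ?_ this
    refine integral_congr_ae (Filter.Eventually.of_forall fun p => ?_)
    simp only [← add_assoc, Prod.mk_add_mk, add_zero, add_comm v p]
  have h1 : ∀ z v, fderiv ℝ Φ z (v, 0) = 0 := fun z v => by
    have h := ((hΦ z).comp_hasDerivAt_of_eq (0 : ℝ)
      (((hasDerivAt_id (0 : ℝ)).smul_const ((v, 0) : V × V)).add_const z) (by simp))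
    have h' : (Φ ∘ fun t : ℝ => id t • ((v, 0) : V × V) + z) = fun _ => Φ z := by
      funext t
      simpa using hinv (t • v) z
    rw [h'] at h
    have := h.unique (hasDerivAt_const (0 : ℝ) (Φ z))
    rw [(hΦ z).fderiv]
    simpa using this
  have h2 : ∀ z w, fderiv ℝ Φ z (0, w) = 0 := fun z w => by
    have h := hCRΦ z (τ.im • w, 0)
    have e : complexStructure V τ (τ.im • w, 0) = (-(τ.re / τ.im) • (τ.im • w), 0) + (0, w) := by
      refine Prod.ext ?_ ?_
      · simp [complexStructure_fst]
      · simp [complexStructure_snd, smul_smul, τ.im_pos.ne']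
    rwa [h1, e, map_add, h1, zero_add, mul_zero] at h
  have h3 : ∀ z, fderiv ℝ Φ z = 0 := fun z => by
    ext X
    · simpa using h1 z X
    · simpa using h2 z X
  have h4 := is_const_of_fderiv_eq_zero (fun z => (hΦ z).differentiableAt) h3 (0, q) (0, 0)
  simpa [Φ] using h4

/-- The Fourier coefficients of a holomorphic section are determined, up to a constant, by the
Cauchy–Riemann equations. -/
theorem exists_fiberCoef_eq (γ : Basis (Fin (finrank ℝ V)) ℤ Λ) (τ : ℍ) {k : ℕ}
    {s : V × V → ℂ} (hs : s ∈ quantumSpace Λ τ k) {g : V} (hg : g ∈ scaledDual Λ k) :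
    ∃ c : ℂ, ∀ q, fiberCoef γ k s q g =
      c * Complex.exp (Complex.I * Real.pi * k * τ * (‖g - q‖ ^ 2 : ℝ)) := by
  obtain ⟨hs1, hs2, hs3⟩ := hs
  let f : V × V → ℂ := fun x => s x * Complex.exp (-(k * baseExponent τ x))
  have hf : ContDiff ℝ ∞ f := hs1.mul (contDiff_const.mul (contDiff_baseExponent τ)).neg.cexp
  have hfs : s = fun x => f x * baseSection τ x ^ k := by
    funext x
    rw [baseSection_pow, mul_assoc, ← Complex.exp_add, neg_add_cancel, Complex.exp_zero, mul_one]
  have hfCR : IsCauchyRiemann τ f := by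
    rw [isCauchyRiemann_iff_nabla τ k (hf.differentiable (by simp)), ← hfs]
    exact hs3
  -- multiplying by the holomorphic function `exp(2πik B(ζ, g))` gives a function of `p` whose
  -- integral is the coefficient, up to a Gaussian factor
  obtain ⟨G, hG, hGx⟩ : ∃ G : (Fin (finrank ℝ V) → ℂ) → ℂ, ContDiff ℂ ∞ G ∧ ∀ x : V × V,
      G (zetaCoord V τ x) = Complex.exp (2 * Real.pi * Complex.I * k * zetaInner τ x g) := by
    refine ⟨fun z => Complex.exp (2 * Real.pi * Complex.I * k *
      ∑ i, z i * (⟪stdOrthonormalBasis ℝ V i, g⟫_ℝ : ℂ)), ?_, fun x => by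
        simp only [sum_zetaCoord_mul]⟩
    fun_prop
  let F : V × V → ℂ := fun x => f x * G (zetaCoord V τ x)
  have hG' : ContDiff ℝ ∞ fun x => G (zetaCoord V τ x) :=
    (hG.restrict_scalars ℝ).comp (zetaCoord V τ).contDiff
  have hF : ContDiff ℝ ∞ F := hf.mul hG'
  have hFCR : IsCauchyRiemann τ F := fun x X => by
    have h := fderiv_mul (hf.differentiable (by simp) x) (hG'.differentiable (by simp) x)
    change fderiv ℝ (f * fun x => G (zetaCoord V τ x)) x _ =
      _ * fderiv ℝ (f * fun x => G (zetaCoord V τ x)) x _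
    rw [h]
    simp only [add_apply, smul_apply, smul_eq_mul, hfCR x X,
      isCauchyRiemann_comp_zetaCoord τ (hG.differentiable (by simp)) x X]
    ring
  have hFeq : ∀ p q, F (p, q) = sectionFiber k s q p * latticeChar k g p *
      (Complex.exp (-(Complex.I * Real.pi * k * τ * (‖g - q‖ ^ 2 : ℝ))) *
        Complex.exp (Complex.I * Real.pi * k * τ * (‖g‖ ^ 2 : ℝ))) := fun p q => by
    simp only [F, f, hGx, sectionFiber, latticeChar, mul_assoc, ← Complex.exp_add]
    congr 2
    rw [← real_inner_self_eq_norm_sq, ← real_inner_self_eq_norm_sq]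
    simp only [baseExponent, zetaInner, inner_sub_left, inner_sub_right, real_inner_comm q g]
    push_cast
    ring
  have hper : ∀ l ∈ Λ, ∀ p q, F (l + p, q) = F (p, q) := fun l hl p q => by
    rw [hFeq, hFeq, sectionFiber_add hs2 q hl, latticeChar_add_right, latticeChar_of_mem hg hl,
      one_mul]
  refine ⟨(∫ p in latticeCell γ, F (p, 0)) *
    Complex.exp (-(Complex.I * Real.pi * k * τ * (‖g‖ ^ 2 : ℝ))), fun q => ?_⟩
  rw [← setIntegral_latticeCell_const γ τ hF hFCR hper q]
  simp only [hFeq]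
  rw [integral_mul_const, ← fiberCoef, mul_assoc, mul_assoc, ← Complex.exp_add, ← Complex.exp_add,
    ← Complex.exp_add]
  ring_nf
  simp

theorem fiberCoef_add_of_mem (γ : Basis (Fin (finrank ℝ V)) ℤ Λ) {k : ℕ} {s : V × V → ℂ}
    (hs : IsInvariant Λ k s) {l : V} (hl : l ∈ Λ) (q g : V) :
    fiberCoef γ k s (l + q) (l + g) = fiberCoef γ k s q g := by
  simp only [fiberCoef, sectionFiber_add_base hs hl, mul_assoc, ← latticeChar_add_left,
    neg_add_cancel_left]

open Classical in
theorem fiberCoef_sum_thetaSection (hΛ : ∀ a ∈ Λ, ∀ b ∈ Λ, ∃ m : ℤ, ⟪a, b⟫_ℝ = m)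
    (γ : Basis (Fin (finrank ℝ V)) ℤ Λ) (τ : ℍ) {k : ℕ} (hk : k ≠ 0) [Fintype (ThetaIndex Λ k)]
    (c : ThetaIndex Λ k → ℂ) (g : scaledDual Λ k) (q : V) :
    fiberCoef γ k (∑ μ : ThetaIndex Λ k, c μ • thetaSection Λ τ k (μ.out : V)) q g =
      c (Submodule.Quotient.mk g) * (((volume : Measure V).real (latticeCell γ) : ℂ) *
        Complex.exp (Complex.I * Real.pi * k * τ * (‖(g : V) - q‖ ^ 2 : ℝ))) := by
  have hcont : ∀ μ : ThetaIndex Λ k, Continuous (thetaSection Λ τ k (μ.out : V)) := fun μ =>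
    (thetaSection_mem_quantumSpace Λ hΛ τ hk (Subtype.coe_prop _)).1.continuous
  rw [fiberCoef_sum γ k _ _ hcont]
  have h : ∀ μ : ThetaIndex Λ k, (g : V) - μ.out ∈ Λ ↔ μ = Submodule.Quotient.mk g := fun μ => by
    rw [← quotientMk_eq_iff, eq_comm (a := μ)]
    exact Iff.of_eq (congrArg _ (Quotient.out_eq _))
  simp only [fiberCoef_thetaSection hΛ γ τ hk (Subtype.coe_prop _) g.2, h, mul_ite, mul_zero,
    Finset.sum_ite_eq', Finset.mem_univ, if_true]

/-- The theta sections attached to representatives of `k⁻¹ Λ* mod Λ` form a basis: a holomorphic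
section has the Fourier coefficients `c_g exp(iπkτ|g - q|²)`, where the constant `c_g` only depends
on the class of `g` because the section is invariant under `{0} × Λ`. -/
theorem exists_isThetaBasis (hΛ : ∀ a ∈ Λ, ∀ b ∈ Λ, ∃ m : ℤ, ⟪a, b⟫_ℝ = m)
    (γ : Basis (Fin (finrank ℝ V)) ℤ Λ) (τ : ℍ) {k : ℕ} (hk : k ≠ 0) :
    ∃ b : Basis (ThetaIndex Λ k) ℂ (quantumSpace Λ τ k), IsThetaBasis b := by
  have := finite_thetaIndex hΛ γ hk
  have := Fintype.ofFinite (ThetaIndex Λ k)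
  let v : ThetaIndex Λ k → quantumSpace Λ τ k := fun μ =>
    ⟨thetaSection Λ τ k (μ.out : V), thetaSection_mem_quantumSpace Λ hΛ τ hk μ.out.2⟩
  have hv : ∀ c : ThetaIndex Λ k → ℂ, ((∑ μ, c μ • v μ : quantumSpace Λ τ k) : V × V → ℂ) =
      ∑ μ, c μ • thetaSection Λ τ k (μ.out : V) := fun c => by
    simp [v]
  have hvol : ((volume : Measure V).real (latticeCell γ) : ℂ) ≠ 0 := by
    exact_mod_cast (volume_real_latticeCell_pos γ).ne'
  have hli : LinearIndependent ℂ v := by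
    rw [Fintype.linearIndependent_iff]
    intro c hc μ
    obtain ⟨g, rfl⟩ := Submodule.Quotient.mk_surjective _ μ
    have h := fiberCoef_sum_thetaSection hΛ γ τ hk c g 0
    rw [← hv, hc] at h
    have h0 : fiberCoef γ k ((0 : quantumSpace Λ τ k) : V × V → ℂ) 0 g = 0 := by
      simp [fiberCoef, sectionFiber]
    rw [h0] at h
    exact (mul_eq_zero.1 h.symm).resolve_right (mul_ne_zero hvol (Complex.exp_ne_zero _))
  have hsp : ⊤ ≤ Submodule.span ℂ (Set.range v) := by
    rintro ⟨s, hs⟩ -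
    choose c hc using fun g : scaledDual Λ k => exists_fiberCoef_eq γ τ hs g.2
    have hcl : ∀ g g' : scaledDual Λ k, (g : V) - g' ∈ Λ → c g = c g' := fun g g' h => by
      have h1 := fiberCoef_add_of_mem γ hs.2.1 h 0 (g' : V)
      rw [sub_add_cancel, hc g, hc g'] at h1
      have e : (g : V) - ((g : V) - g' + 0) = g' - 0 := by abel
      rw [e] at h1
      exact mul_right_cancel₀ (Complex.exp_ne_zero _) h1
    let a : ThetaIndex Λ k → ℂ := fun μ => c μ.out / ((volume : Measure V).real (latticeCell γ) : ℂ)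
    have hst : s = ∑ μ : ThetaIndex Λ k, a μ • thetaSection Λ τ k (μ.out : V) := by
      have ht := (∑ μ, a μ • v μ : quantumSpace Λ τ k).2
      rw [hv a] at ht
      funext ⟨p, q⟩
      refine eq_of_fiberCoef_eq γ hk hs.1.continuous ht.1.continuous
        (fun l hl p => sectionFiber_add hs.2.1 q hl p)
        (fun l hl p => sectionFiber_add ht.2.1 q hl p) (fun g hg => ?_) p
      rw [fiberCoef_sum_thetaSection hΛ γ τ hk a ⟨g, hg⟩ q, hc ⟨g, hg⟩ q, ← mul_assoc]
      congr 1
      simp only [a]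
      rw [div_mul_cancel₀ _ hvol]
      exact (hcl _ _ (coe_out_sub_mem _)).symm
    rw [Submodule.mem_span_range_iff_exists_fun]
    exact ⟨a, Subtype.ext ((hv a).trans hst.symm)⟩
  refine ⟨Basis.mk hli hsp, fun μ => ?_⟩
  rw [Basis.mk_apply]
  have h := thetaSection_add_of_mem Λ τ k (μ : V) (coe_out_sub_mem μ)
  rwa [add_sub_cancel] at h

end Spanning

/-! ### Half-forms -/

section ComplexifiedTangent

variable (V : Type*) [NormedAddCommGroup V] [InnerProductSpace ℝ V]

/-- The `p`-component of a complex tangent vector. -/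
noncomputable def fstTangent : ComplexTangent V →ₗ[ℂ] ℂ ⊗[ℝ] V :=
  (LinearMap.fst ℝ V V).baseChange ℂ

/-- The `q`-component of a complex tangent vector. -/
noncomputable def sndTangent : ComplexTangent V →ₗ[ℂ] ℂ ⊗[ℝ] V :=
  (LinearMap.snd ℝ V V).baseChange ℂ

/-- The complex tangent vector with the given components. -/
noncomputable def mkTangent : (ℂ ⊗[ℝ] V) × (ℂ ⊗[ℝ] V) →ₗ[ℂ] ComplexTangent V :=
  ((LinearMap.inl ℝ V V).baseChange ℂ).coprod ((LinearMap.inr ℝ V V).baseChange ℂ)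

variable {V}

@[simp] theorem fstTangent_tmul (z : ℂ) (x : V × V) : fstTangent V (z ⊗ₜ x) = z ⊗ₜ x.1 := rfl

@[simp] theorem sndTangent_tmul (z : ℂ) (x : V × V) : sndTangent V (z ⊗ₜ x) = z ⊗ₜ x.2 := rfl

theorem mkTangent_fst_snd (X : ComplexTangent V) :
    mkTangent V (fstTangent V X, sndTangent V X) = X := by
  induction X using TensorProduct.induction_on with
  | zero =>
    rw [map_zero, map_zero]
    exact map_zero (mkTangent V)
  | tmul z x => simp [mkTangent, ← TensorProduct.tmul_add]
  | add X Y hX hY => rw [map_add, map_add, ← Prod.mk_add_mk, map_add, hX, hY]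

theorem fstTangent_mkTangent (a b : ℂ ⊗[ℝ] V) : fstTangent V (mkTangent V (a, b)) = a := by
  have h1 : fstTangent V ∘ₗ (LinearMap.inl ℝ V V).baseChange ℂ = LinearMap.id := by
    rw [fstTangent, ← LinearMap.baseChange_comp, LinearMap.fst_comp_inl, LinearMap.baseChange_id]
  have h2 : fstTangent V ∘ₗ (LinearMap.inr ℝ V V).baseChange ℂ = 0 := by
    rw [fstTangent, ← LinearMap.baseChange_comp, LinearMap.fst_comp_inr, LinearMap.baseChange_zero]
  rw [mkTangent, LinearMap.coprod_apply, map_add]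
  have h1' := LinearMap.congr_fun h1 a
  have h2' := LinearMap.congr_fun h2 b
  simp only [LinearMap.comp_apply] at h1' h2'
  rw [h1', h2']
  simp

theorem sndTangent_mkTangent (a b : ℂ ⊗[ℝ] V) : sndTangent V (mkTangent V (a, b)) = b := by
  have h1 : sndTangent V ∘ₗ (LinearMap.inl ℝ V V).baseChange ℂ = 0 := by
    rw [sndTangent, ← LinearMap.baseChange_comp, LinearMap.snd_comp_inl, LinearMap.baseChange_zero]
  have h2 : sndTangent V ∘ₗ (LinearMap.inr ℝ V V).baseChange ℂ = LinearMap.id := by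
    rw [sndTangent, ← LinearMap.baseChange_comp, LinearMap.snd_comp_inr, LinearMap.baseChange_id]
  rw [mkTangent, LinearMap.coprod_apply, map_add]
  have h1' := LinearMap.congr_fun h1 a
  have h2' := LinearMap.congr_fun h2 b
  simp only [LinearMap.comp_apply] at h1' h2'
  rw [h1', h2']
  simp

theorem complexTangent_ext {X Y : ComplexTangent V} (h1 : fstTangent V X = fstTangent V Y)
    (h2 : sndTangent V X = sndTangent V Y) : X = Y := by
  rw [← mkTangent_fst_snd X, ← mkTangent_fst_snd Y, h1, h2]

theorem ofReal_smul_tmul (r : ℝ) (z : ℂ) (v : V) :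
    z ⊗ₜ[ℝ] (r • v) = (r : ℂ) • (z ⊗ₜ[ℝ] v) := by
  rw [TensorProduct.tmul_smul, TensorProduct.smul_tmul', TensorProduct.smul_tmul',
    Complex.real_smul, smul_eq_mul]

theorem fstTangent_baseChange_complexStructure (τ : ℍ) (X : ComplexTangent V) :
    fstTangent V ((complexStructure V τ).baseChange ℂ X) =
      (-(τ.re / τ.im) : ℂ) • fstTangent V X -
        (Complex.normSq τ / τ.im : ℂ) • sndTangent V X := by
  induction X using TensorProduct.induction_on with
  | zero => simp
  | tmul z x =>
    simp only [LinearMap.baseChange_tmul, fstTangent_tmul, sndTangent_tmul, complexStructure_fst,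
      TensorProduct.tmul_sub, ofReal_smul_tmul]
    push_cast
    rfl
  | add X Y hX hY =>
    simp only [map_add, hX, hY, smul_add]
    abel

theorem sndTangent_baseChange_complexStructure (τ : ℍ) (X : ComplexTangent V) :
    sndTangent V ((complexStructure V τ).baseChange ℂ X) =
      (1 / τ.im : ℂ) • fstTangent V X + (τ.re / τ.im : ℂ) • sndTangent V X := by
  induction X using TensorProduct.induction_on with
  | zero => simp
  | tmul z x =>
    simp only [LinearMap.baseChange_tmul, fstTangent_tmul, sndTangent_tmul, complexStructure_snd,
      TensorProduct.tmul_add, ofReal_smul_tmul]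
    push_cast
    rfl
  | add X Y hX hY =>
    simp only [map_add, hX, hY, smul_add]
    abel

theorem conj_coe_eq (τ : ℍ) : conj (τ : ℂ) = τ.re - τ.im * Complex.I := by
  apply Complex.ext <;> simp

theorem normSq_coe_eq (τ : ℍ) : (Complex.normSq τ : ℂ) = (τ.re : ℂ) ^ 2 + (τ.im : ℂ) ^ 2 := by
  rw [Complex.normSq_apply]
  push_cast
  simp only [UpperHalfPlane.coe_re, UpperHalfPlane.coe_im]
  ring

theorem mem_holTangent_iff (τ : ℍ) (X : ComplexTangent V) :
    X ∈ holTangent V τ ↔ fstTangent V X = -conj (τ : ℂ) • sndTangent V X := by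
  have h0 : (τ.im : ℂ) ≠ 0 := by exact_mod_cast τ.im_pos.ne'
  rw [holTangent, LinearMap.mem_ker, LinearMap.sub_apply, sub_eq_zero, conj_coe_eq]
  constructor
  · intro h
    have h2 := congrArg (fun Y => (τ.im : ℂ) • sndTangent V Y) h
    simp only [sndTangent_baseChange_complexStructure, LinearMap.smul_apply, LinearMap.id_apply,
      map_smul, smul_add, smul_smul, mul_div_cancel₀ _ h0, one_smul] at h2
    rw [eq_sub_of_add_eq h2]
    module
  · intro h
    refine complexTangent_ext ?_ ?_
    · rw [fstTangent_baseChange_complexStructure, normSq_coe_eq, LinearMap.smul_apply,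
        LinearMap.id_apply, map_smul, h, smul_smul, smul_smul, ← sub_smul]
      congr 1
      field_simp
      ring_nf
      simp only [Complex.I_sq]
      ring
    · rw [sndTangent_baseChange_complexStructure, LinearMap.smul_apply,
        LinearMap.id_apply, map_smul, h, smul_smul, ← add_smul]
      congr 1
      field_simp
      ring

theorem mem_antiholTangent_of (τ : ℍ) {X : ComplexTangent V}
    (h : fstTangent V X = -(τ : ℂ) • sndTangent V X) : X ∈ antiholTangent V τ := by
  have h0 : (τ.im : ℂ) ≠ 0 := by exact_mod_cast τ.im_pos.ne'
  rw [antiholTangent, LinearMap.mem_ker]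
  rw [coe_eq_re_add_im_mul_I] at h
  refine complexTangent_ext ?_ ?_
  · rw [LinearMap.add_apply, map_add, fstTangent_baseChange_complexStructure, normSq_coe_eq,
      LinearMap.smul_apply, LinearMap.id_apply, map_smul, h, smul_smul, smul_smul, ← sub_smul,
      ← add_smul, map_zero]
    convert zero_smul ℂ (sndTangent V X)
    field_simp
    ring_nf
    simp only [Complex.I_sq]
    ring
  · rw [LinearMap.add_apply, map_add, sndTangent_baseChange_complexStructure,
      LinearMap.smul_apply, LinearMap.id_apply, map_smul, h, smul_smul, ← add_smul,
      ← add_smul, map_zero]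
    convert zero_smul ℂ (sndTangent V X)
    field_simp
    ring

theorem dzeta_apply (τ : ℍ) (X : ComplexTangent V) :
    dzeta V τ X = fstTangent V X + (τ : ℂ) • sndTangent V X := by
  induction X using TensorProduct.induction_on with
  | zero => simp
  | tmul z x =>
    simp [dzeta, TensorProduct.smul_tmul', mul_comm]
  | add X Y hX hY =>
    simp only [map_add, hX, hY, smul_add]
    abel

theorem dzeta_of_mem_holTangent (τ : ℍ) {X : ComplexTangent V} (hX : X ∈ holTangent V τ) :
    dzeta V τ X = ((τ : ℂ) - conj (τ : ℂ)) • sndTangent V X := by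
  rw [dzeta_apply, (mem_holTangent_iff τ X).1 hX]
  module

/-- The vector of type `(1, 0)` with a given `q`-component. -/
noncomputable def holLift (τ : ℍ) : ℂ ⊗[ℝ] V →ₗ[ℂ] holTangent V τ :=
  LinearMap.codRestrict _ (mkTangent V ∘ₗ (-conj (τ : ℂ) • LinearMap.id).prod LinearMap.id)
    fun a => by
      rw [mem_holTangent_iff]
      change fstTangent V (mkTangent V (-conj (τ : ℂ) • a, a)) =
        -conj (τ : ℂ) • sndTangent V (mkTangent V (-conj (τ : ℂ) • a, a))
      rw [fstTangent_mkTangent, sndTangent_mkTangent]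

theorem coe_holLift (τ : ℍ) (a : ℂ ⊗[ℝ] V) :
    (holLift τ a : ComplexTangent V) = mkTangent V (-conj (τ : ℂ) • a, a) := rfl

theorem sndTangent_holLift (τ : ℍ) (a : ℂ ⊗[ℝ] V) :
    sndTangent V (holLift τ a : ComplexTangent V) = a := by
  rw [coe_holLift, sndTangent_mkTangent]

/-- The Hermitian extension of the inner product of `V` to `V ⊗ ℂ`. -/
noncomputable def hermInner (a b : ℂ ⊗[ℝ] V) : ℂ :=
  LinearMap.BilinForm.baseChange ℂ (innerₗ V) a
    (TensorProduct.map Complex.conjAe.toLinearMap LinearMap.id b)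

theorem hermInner_tmul (z w : ℂ) (v u : V) :
    hermInner (z ⊗ₜ[ℝ] v) (w ⊗ₜ[ℝ] u) = z * conj w * ⟪v, u⟫_ℝ := by
  simp [hermInner, mul_comm]

theorem hermInner_add_left (a a' b : ℂ ⊗[ℝ] V) :
    hermInner (a + a') b = hermInner a b + hermInner a' b := by
  simp [hermInner]

theorem hermInner_add_right (a b b' : ℂ ⊗[ℝ] V) :
    hermInner a (b + b') = hermInner a b + hermInner a b' := by
  simp [hermInner]

theorem hermInner_zero_left (b : ℂ ⊗[ℝ] V) : hermInner 0 b = 0 := by simp [hermInner]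

theorem hermInner_zero_right (a : ℂ ⊗[ℝ] V) : hermInner a 0 = 0 := by simp [hermInner]

theorem hermInner_smul_left (c : ℂ) (a b : ℂ ⊗[ℝ] V) :
    hermInner (c • a) b = c * hermInner a b := by
  simp [hermInner]

theorem hermInner_smul_right (c : ℂ) (a b : ℂ ⊗[ℝ] V) :
    hermInner a (c • b) = conj c * hermInner a b := by
  induction b using TensorProduct.induction_on with
  | zero => simp [hermInner_zero_right]
  | tmul w u =>
    induction a using TensorProduct.induction_on with
    | zero => simp [hermInner_zero_left]
    | tmul z v =>
      rw [TensorProduct.smul_tmul', hermInner_tmul, hermInner_tmul, smul_eq_mul, map_mul]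
      ring
    | add a a' h h' => rw [hermInner_add_left, h, h', hermInner_add_left, mul_add]
  | add b b' h h' => rw [smul_add, hermInner_add_right, h, h', hermInner_add_right, mul_add]

theorem tangentHerm_add_left (X X' Y : ComplexTangent V) :
    tangentHerm (X + X') Y = tangentHerm X Y + tangentHerm X' Y := by
  simp [tangentHerm, mul_add]

theorem tangentHerm_add_right (X Y Y' : ComplexTangent V) :
    tangentHerm X (Y + Y') = tangentHerm X Y + tangentHerm X Y' := by
  simp [tangentHerm, conjTangent, mul_add]

theorem tangentHerm_eq (X Y : ComplexTangent V) :
    tangentHerm X Y = 2 * Real.pi / Complex.I *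
      (hermInner (fstTangent V X) (sndTangent V Y) -
        hermInner (sndTangent V X) (fstTangent V Y)) := by
  induction X using TensorProduct.induction_on with
  | zero => simp [tangentHerm, hermInner_zero_left]
  | tmul z x =>
    induction Y using TensorProduct.induction_on with
    | zero => simp [tangentHerm, conjTangent, hermInner_zero_right]
    | tmul w y =>
      simp only [fstTangent_tmul, sndTangent_tmul, hermInner_tmul, tangentHerm, conjTangent,
        TensorProduct.map_tmul, LinearMap.BilinForm.baseChange_tmul, symplForm_apply]
      simp
      ring
    | add Y Y' h h' =>
      rw [tangentHerm_add_right, h, h']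
      simp only [map_add, hermInner_add_right]
      ring
  | add X X' h h' =>
    rw [tangentHerm_add_left, h, h']
    simp only [map_add, hermInner_add_left]
    ring

theorem coe_sub_conj (τ : ℍ) : (τ : ℂ) - conj (τ : ℂ) = 2 * τ.im * Complex.I := by
  rw [conj_coe_eq, coe_eq_re_add_im_mul_I]
  ring

theorem tangentHerm_of_mem_holTangent (τ : ℍ) {X Y : ComplexTangent V} (hX : X ∈ holTangent V τ)
    (hY : Y ∈ holTangent V τ) :
    tangentHerm X Y = 4 * Real.pi * τ.im * hermInner (sndTangent V X) (sndTangent V Y) := by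
  rw [tangentHerm_eq, (mem_holTangent_iff τ X).1 hX, (mem_holTangent_iff τ Y).1 hY,
    hermInner_smul_left, hermInner_smul_right, map_neg, Complex.conj_conj]
  have h := coe_sub_conj τ
  have hI := Complex.I_ne_zero
  field_simp
  linear_combination (2 * hermInner (sndTangent V X) (sndTangent V Y)) * h

variable {ι : Type*} [Fintype ι]

theorem hermInner_eq_sum (e : OrthonormalBasis ι ℝ V) (a b : ℂ ⊗[ℝ] V) :
    hermInner a b =
      ∑ i, (e.toBasis.baseChange ℂ).repr a i * conj ((e.toBasis.baseChange ℂ).repr b i) := by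
  induction a using TensorProduct.induction_on with
  | zero => simp [hermInner_zero_left]
  | tmul z v =>
    induction b using TensorProduct.induction_on with
    | zero => simp [hermInner_zero_right]
    | tmul w u =>
      simp only [hermInner_tmul, Basis.baseChange_repr_tmul,
        OrthonormalBasis.coe_toBasis_repr_apply, OrthonormalBasis.repr_apply_apply]
      rw [← e.sum_inner_mul_inner v u]
      push_cast
      rw [Finset.mul_sum]
      refine Finset.sum_congr rfl fun i _ => ?_
      simp [Complex.real_smul, real_inner_comm v]
      ring
    | add b b' h h' =>
      rw [hermInner_add_right, h, h', ← Finset.sum_add_distrib]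
      simp only [map_add, Finsupp.add_apply, mul_add]
  | add a a' h h' =>
    rw [hermInner_add_left, h, h', ← Finset.sum_add_distrib]
    simp only [map_add, Finsupp.add_apply, add_mul]

end ComplexifiedTangent

section HalfFormNorm

variable {V : Type*} [NormedAddCommGroup V] [InnerProductSpace ℝ V]
  {Λ : Submodule ℤ V} [FiniteDimensional ℝ V] [DiscreteTopology Λ] [IsZLattice ℝ Λ]
  [MeasurableSpace V] [BorelSpace V]

theorem abs_det_latticeBasis_mul_volume (γ : Basis (Fin (finrank ℝ V)) ℤ Λ)
    (e : OrthonormalBasis (Fin (finrank ℝ V)) ℝ V) :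
    |(γ.ofZLatticeBasis ℝ Λ).det e| * (volume : Measure V).real (latticeCell γ) = 1 := by
  have h := ZSpan.measureReal_fundamentalDomain e.toBasis (volume : Measure V)
    (γ.ofZLatticeBasis ℝ Λ)
  rw [e.coe_toBasis] at h
  rw [← h, measureReal_congr (ZSpan.fundamentalDomain_ae_parallelepiped e.toBasis volume),
    e.coe_toBasis, measureReal_def, e.volume_parallelepiped, ENNReal.toReal_one]

theorem norm_latticeForm_mul_volume (γ : Basis (Fin (finrank ℝ V)) ℤ Λ)
    (e : OrthonormalBasis (Fin (finrank ℝ V)) ℝ V) (w : Fin (finrank ℝ V) → ℂ ⊗[ℝ] V) :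
    ‖latticeForm γ w‖ * (volume : Measure V).real (latticeCell γ) =
      ‖((e.toBasis.baseChange ℂ).toMatrix w).det‖ := by
  have h1 : latticeForm γ w = (((γ.ofZLatticeBasis ℝ Λ).det e : ℝ) : ℂ) *
      ((e.toBasis.baseChange ℂ).toMatrix w).det := by
    rw [latticeForm, Basis.det_apply, ← Basis.toMatrix_mul_toMatrix _ (e.toBasis.baseChange ℂ),
      Matrix.det_mul, Basis.det_apply]
    congr 1
    rw [← Complex.ofRealHom_eq_coe, RingHom.map_det]
    congr 1
    ext i j
    simp [Basis.toMatrix_apply, Basis.baseChange_apply, Basis.baseChange_repr_tmul]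
  rw [h1, norm_mul, Complex.norm_real, Real.norm_eq_abs, mul_right_comm,
    abs_det_latticeBasis_mul_volume, one_mul]

/-- The value of `‖Ω^{1/2}‖²`: an orthonormal frame of type `(1, 0)` is mapped by `dζ_τ` to
`√(Im τ / π)` times a unitary frame of `V ⊗ ℂ`. -/
theorem halfFormNormSq_eq (γ : Basis (Fin (finrank ℝ V)) ℤ Λ) (τ : ℍ) :
    halfFormNormSq γ τ = Real.sqrt (τ.im / Real.pi) ^ finrank ℝ V /
      (volume : Measure V).real (latticeCell γ) := by
  have hτ := τ.im_pos
  have hvol := volume_real_latticeCell_pos γ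
  let e := stdOrthonormalBasis ℝ V
  let eC := e.toBasis.baseChange ℂ
  have key : ∀ X : Fin (finrank ℝ V) → holTangent V τ,
      (∀ i j, tangentHerm (X i : ComplexTangent V) (X j) = if i = j then 1 else 0) →
      ‖halfFormSquare γ τ 1 1 X‖ = Real.sqrt (τ.im / Real.pi) ^ finrank ℝ V /
        (volume : Measure V).real (latticeCell γ) := fun X hX => by
    let w : Fin (finrank ℝ V) → ℂ ⊗[ℝ] V := fun i => dzeta V τ (X i)
    let M := eC.toMatrix w
    have hval : halfFormSquare γ τ 1 1 X = latticeForm γ w := by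
      rw [halfFormSquare, mul_one, one_smul]
      rfl
    have hMM : M.transpose * M.transpose.conjTranspose =
        ((τ.im / Real.pi : ℝ) : ℂ) • (1 : Matrix (Fin (finrank ℝ V)) (Fin (finrank ℝ V)) ℂ) := by
      ext i j
      have h1 := hermInner_eq_sum e (w i) (w j)
      have h2 := hX i j
      rw [tangentHerm_of_mem_holTangent τ (X i).2 (X j).2] at h2
      simp only [w, dzeta_of_mem_holTangent τ (X _).2, hermInner_smul_left, hermInner_smul_right,
        coe_sub_conj] at h1
      have h3 : (M.transpose * M.transpose.conjTranspose) i j =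
          ∑ a, eC.repr (w i) a * conj (eC.repr (w j) a) := by
        simp [Matrix.mul_apply, M, Basis.toMatrix_apply]
      rw [h3]
      simp only [w, dzeta_of_mem_holTangent τ (X _).2, coe_sub_conj]
      rw [← h1, Matrix.smul_apply, Matrix.one_apply, ← h2]
      have hπ : (Real.pi : ℂ) ≠ 0 := by exact_mod_cast Real.pi_ne_zero
      simp only [map_mul, Complex.conj_I, Complex.conj_ofReal, smul_eq_mul, Complex.conj_ofNat]
      push_cast
      field_simp
      ring_nf
      simp only [Complex.I_sq]
      ring
    have hdet : ‖M.det‖ ^ 2 = (τ.im / Real.pi) ^ finrank ℝ V := by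
      have h := congrArg (fun A => ‖Matrix.det A‖) hMM
      simp only [Matrix.det_mul, Matrix.det_conjTranspose, Matrix.det_transpose, Matrix.det_smul,
        Matrix.det_one, mul_one, norm_mul, norm_star, norm_pow, Complex.norm_real,
        Fintype.card_fin] at h
      rw [sq, h, Real.norm_eq_abs, abs_of_pos (by positivity)]
    have hdet' : ‖M.det‖ = Real.sqrt (τ.im / Real.pi) ^ finrank ℝ V := by
      refine (pow_left_inj₀ (norm_nonneg _) (by positivity) two_ne_zero).1 ?_
      rw [hdet, ← pow_mul, mul_comm, pow_mul, Real.sq_sqrt (by positivity)]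
    rw [eq_div_iff hvol.ne', hval, norm_latticeForm_mul_volume γ e, ← hdet']
  -- an orthonormal frame exists
  let r : ℝ := (Real.sqrt (4 * Real.pi * τ.im))⁻¹
  let X₀ : Fin (finrank ℝ V) → holTangent V τ := fun i => holLift τ ((r : ℂ) • eC i)
  have hX₀ : ∀ i j, tangentHerm (X₀ i : ComplexTangent V) (X₀ j) = if i = j then 1 else 0 :=
    fun i j => by
      rw [tangentHerm_of_mem_holTangent τ (X₀ i).2 (X₀ j).2, sndTangent_holLift,
        sndTangent_holLift, hermInner_smul_left, hermInner_smul_right, hermInner_eq_sum e]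
      have hr : 4 * Real.pi * τ.im * (r * r) = 1 := by
        simp only [r]
        rw [← mul_inv, Real.mul_self_sqrt (by positivity)]
        exact mul_inv_cancel₀ (by positivity)
      have hr' : (4 * Real.pi * τ.im * (r * r) : ℂ) = 1 := by exact_mod_cast hr
      have hs : ∑ a, eC.repr (eC i) a * conj (eC.repr (eC j) a) = if i = j then (1 : ℂ) else 0 := by
        simp [Finsupp.single_apply]
      rw [hs, Complex.conj_ofReal]
      linear_combination (if i = j then (1 : ℂ) else 0) * hr'
  have hset : {s : ℝ | ∃ X : Fin (finrank ℝ V) → holTangent V τ,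
      (∀ i j, tangentHerm (X i : ComplexTangent V) (X j) = if i = j then 1 else 0) ∧
        s = ‖halfFormSquare γ τ 1 1 X‖} =
      {Real.sqrt (τ.im / Real.pi) ^ finrank ℝ V / (volume : Measure V).real (latticeCell γ)} := by
    ext s
    constructor
    · rintro ⟨X, hX, rfl⟩
      exact key X hX
    · rintro rfl
      exact ⟨X₀, hX₀, (key X₀ hX₀).symm⟩
  rw [halfFormNormSq, canonicalNorm, hset, csSup_singleton]

theorem halfFormNormSq_pos (γ : Basis (Fin (finrank ℝ V)) ℤ Λ) (τ : ℍ) :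
    0 < halfFormNormSq γ τ := by
  have := volume_real_latticeCell_pos γ
  have := τ.im_pos
  rw [halfFormNormSq_eq]
  positivity

end HalfFormNorm

section HalfFormIso

variable {V : Type*} [NormedAddCommGroup V] [InnerProductSpace ℝ V]

theorem symbol_mul_self (τ₁ τ₂ : ℍ) : symbol V τ₁ τ₂ * symbol V τ₁ τ₂ =
    (((τ₁ : ℂ) - conj (τ₁ : ℂ)) / ((τ₂ : ℂ) - conj (τ₁ : ℂ))) ^ finrank ℝ V := by
  rw [← sq, symbol, ← Complex.cpow_nat_mul, ← Complex.cpow_natCast]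
  congr 1
  push_cast
  ring

variable {Λ : Submodule ℤ V} [FiniteDimensional ℝ V] [DiscreteTopology Λ] [IsZLattice ℝ Λ]

theorem sub_conj_ne_zero (τ₁ τ₂ : ℍ) : (τ₂ : ℂ) - conj (τ₁ : ℂ) ≠ 0 := fun h => by
  have h1 := τ₁.im_pos
  have h2 := τ₂.im_pos
  have := congrArg Complex.im h
  simp at this
  linarith

/-- The projection `E_{τ₂} → E_{τ₁}` with kernel `Ē_{τ₂}` multiplies `dζ` by
`(τ₁ - τ̄₁)/(τ₂ - τ̄₁)`. -/
theorem isHalfFormIso_symbol (γ : Basis (Fin (finrank ℝ V)) ℤ Λ) (τ₁ τ₂ : ℍ) :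
    IsHalfFormIso γ τ₁ τ₂ fun _ => symbol V τ₁ τ₂ := by
  have hw := sub_conj_ne_zero τ₁ τ₂
  let c : ℂ := ((τ₂ : ℂ) - conj (τ₂ : ℂ)) / ((τ₂ : ℂ) - conj (τ₁ : ℂ))
  let π : holTangent V τ₂ →ₗ[ℂ] holTangent V τ₁ :=
    c • holLift τ₁ ∘ₗ sndTangent V ∘ₗ (holTangent V τ₂).subtype
  have hs : ∀ X, sndTangent V (π X : ComplexTangent V) = c • sndTangent V X := fun X => by
    change sndTangent V (c • (holLift τ₁ (sndTangent V X) : ComplexTangent V)) = _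
    rw [map_smul, sndTangent_holLift]
  have hf : ∀ X, fstTangent V (π X : ComplexTangent V) =
      (-conj (τ₁ : ℂ) * c) • sndTangent V X := fun X => by
    rw [(mem_holTangent_iff τ₁ _).1 (π X).2, hs, smul_smul]
  refine ⟨π, fun X => mem_antiholTangent_of τ₂ ?_, fun x u v => ?_⟩
  · rw [map_sub, map_sub, hf, hs, (mem_holTangent_iff τ₂ _).1 X.2, smul_sub, smul_smul, ← sub_smul,
      ← sub_smul]
    congr 1
    simp only [c]
    field_simp
    ring
  · ext X
    have hz : ∀ i, dzeta V τ₁ (π (X i) : ComplexTangent V) =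
        (((τ₁ : ℂ) - conj (τ₁ : ℂ)) / ((τ₂ : ℂ) - conj (τ₁ : ℂ))) • dzeta V τ₂ (X i) := fun i => by
      rw [dzeta_of_mem_holTangent τ₁ (π (X i)).2, dzeta_of_mem_holTangent τ₂ (X i).2, hs, smul_smul,
        smul_smul]
      congr 1
      simp only [c]
      ring
    have h1 : canonicalForm γ τ₁ (fun i => π (X i)) =
        latticeForm γ fun i => dzeta V τ₁ (π (X i) : ComplexTangent V) := rfl
    have h2 : canonicalForm γ τ₂ X = latticeForm γ fun i => dzeta V τ₂ (X i : ComplexTangent V) :=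
      rfl
    rw [AlternatingMap.compLinearMap_apply, halfFormSquare, halfFormSquare,
      AlternatingMap.smul_apply, AlternatingMap.smul_apply]
    change _ = (u * v) • canonicalForm γ τ₁ (fun i => π (X i))
    rw [h1, h2]
    simp only [hz]
    rw [(latticeForm γ).map_smul_univ (fun _ => _), Finset.prod_const, Finset.card_univ,
      Fintype.card_fin, ← symbol_mul_self]
    simp only [smul_eq_mul]
    ring

end HalfFormIso

/-! ### Scalar products of theta sections -/

section ScalarProduct

variable {V : Type*} [NormedAddCommGroup V] [InnerProductSpace ℝ V]

theorem identification_apply {Λ : Submodule ℤ V} {τ₁ τ₂ : ℍ} {k : ℕ}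
    [Fintype (ThetaIndex Λ k)]
    (b₁ : Basis (ThetaIndex Λ k) ℂ (quantumSpace Λ τ₁ k))
    (b₂ : Basis (ThetaIndex Λ k) ℂ (quantumSpace Λ τ₂ k)) (s : quantumSpace Λ τ₁ k) :
    identification b₁ b₂ s = ∑ μ, b₁.repr s μ • b₂ μ := by
  rw [identification]
  nth_rewrite 1 [← b₁.sum_repr s]
  rw [map_sum]
  simp only [map_smul, Basis.equiv_apply, Equiv.refl_apply]

theorem IsThetaBasis.coe_apply {Λ : Submodule ℤ V} {τ : ℍ} {k : ℕ}
    {b : Basis (ThetaIndex Λ k) ℂ (quantumSpace Λ τ k)}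
    (hb : IsThetaBasis b) (μ : ThetaIndex Λ k) :
    (b μ : V × V → ℂ) = thetaSection Λ τ k (μ.out : V) := by
  have h := hb μ.out
  rwa [Submodule.Quotient.mk_out] at h

variable {Λ : Submodule ℤ V} [FiniteDimensional ℝ V] [DiscreteTopology Λ] [IsZLattice ℝ Λ]
  [MeasurableSpace V] [BorelSpace V]

theorem integrableOn_fundDomain_of_continuous (γ : Basis (Fin (finrank ℝ V)) ℤ Λ)
    {h : V × V → ℂ} (hh : Continuous h) : IntegrableOn h (fundDomain γ) := by
  have hb : Bornology.IsBounded (fundDomain γ) :=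
    (ZSpan.fundamentalDomain_isBounded _).prod (ZSpan.fundamentalDomain_isBounded _)
  exact (hh.continuousOn.integrableOn_compact hb.isCompact_closure).mono_set subset_closure

theorem sectionInner_eq_integral (γ : Basis (Fin (finrank ℝ V)) ℤ Λ) (τ : ℍ) (s t : V × V → ℂ) :
    sectionInner γ τ s t = ((2 * Real.pi) ^ finrank ℝ V * halfFormNormSq γ τ : ℝ) *
      ∫ x in fundDomain γ, s x * conj (t x) := by
  have h0 : (0 : ℝ) ≤ (2 * Real.pi) ^ finrank ℝ V := by positivity
  rw [sectionInner, liouville, Measure.restrict_smul, integral_smul_measure, integral_mul_const,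
    ENNReal.toReal_ofReal h0, Complex.real_smul]
  push_cast
  ring

theorem sectionInner_sum_sum (γ : Basis (Fin (finrank ℝ V)) ℤ Λ) (τ : ℍ) {ι : Type*} [Fintype ι]
    (a b : ι → ℂ) {s t : ι → V × V → ℂ} (hs : ∀ i, Continuous (s i)) (ht : ∀ i, Continuous (t i)) :
    sectionInner γ τ (∑ i, a i • s i) (∑ i, b i • t i) =
      ∑ i, ∑ j, a i * conj (b j) * sectionInner γ τ (s i) (t j) := by
  have hexp : ∀ x, (∑ i, a i • s i) x * conj ((∑ j, b j • t j) x) =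
      ∑ i, ∑ j, a i * conj (b j) * (s i x * conj (t j x)) := fun x => by
    simp only [Finset.sum_apply, Pi.smul_apply, smul_eq_mul, map_sum, map_mul, Finset.sum_mul_sum]
    refine Finset.sum_congr rfl fun i _ => Finset.sum_congr rfl fun j _ => ?_
    ring
  have hc : ∀ i j, Continuous fun x => a i * conj (b j) * (s i x * conj (t j x)) := fun i j =>
    continuous_const.mul ((hs i).mul (Complex.continuous_conj.comp (ht j)))
  simp only [sectionInner_eq_integral, hexp]
  rw [integral_finsetSum _ fun i _ => integrableOn_fundDomain_of_continuous γ
    (continuous_finsetSum _ fun j _ => hc i j), Finset.mul_sum]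
  refine Finset.sum_congr rfl fun i _ => ?_
  rw [integral_finsetSum _ fun j _ => integrableOn_fundDomain_of_continuous γ (hc i j),
    Finset.mul_sum]
  refine Finset.sum_congr rfl fun j _ => ?_
  rw [integral_const_mul]
  ring

open Classical in
theorem setIntegral_thetaSection_mul_conj (hΛ : ∀ a ∈ Λ, ∀ b ∈ Λ, ∃ m : ℤ, ⟪a, b⟫_ℝ = m)
    (γ : Basis (Fin (finrank ℝ V)) ℤ Λ) (τ : ℍ) {k : ℕ} (hk : k ≠ 0) {μ ν : V}
    (hμ : μ ∈ scaledDual Λ k) (hν : ν ∈ scaledDual Λ k) (q : V) :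
    ∫ p in latticeCell γ, thetaSection Λ τ k μ (p, q) * conj (thetaSection Λ τ k ν (p, q)) =
      if μ - ν ∈ Λ then ((volume : Measure V).real (latticeCell γ) : ℂ) *
        ∑' l : Λ, (Real.exp (-(2 * Real.pi * k * τ.im) * ‖(l : V) + q - ν‖ ^ 2) : ℂ) else 0 := by
  let c : Λ → ℂ := fun l => Complex.exp (Complex.I * Real.pi * k * τ * (‖ν + l - q‖ ^ 2 : ℝ))
  have hcn : ∀ l, ‖c l‖ = ‖thetaTerm τ k (ν + l) (0, q)‖ := fun l => by
    rw [thetaTerm, norm_mul, norm_latticeChar]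
    simp [c]
  have hc : Summable fun l => ‖c l‖ := by
    simpa only [hcn] using summable_thetaTerm Λ τ hk ν (0, q)
  have hcont := (thetaSection_mem_quantumSpace Λ hΛ τ hk hμ).1.continuous
  have hfib := continuous_sectionFiber k hcont q
  have h1 : ∀ p, thetaSection Λ τ k μ (p, q) * conj (thetaSection Λ τ k ν (p, q)) =
      ∑' l, conj (c l) * (sectionFiber k (thetaSection Λ τ k μ) q p *
        latticeChar k (ν + l) p) := fun p => by
    rw [thetaSection_eq_tsum Λ τ k ν, Complex.conj_tsum, ← tsum_mul_left]
    refine tsum_congr fun l => ?_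
    rw [sectionFiber, thetaTerm, latticeChar_neg_left, map_mul, map_mul, Complex.conj_conj,
      ← Complex.exp_conj]
    have : conj (Complex.I * Real.pi * k * (⟪p, q⟫_ℝ : ℂ)) =
        -(Complex.I * Real.pi * k * (⟪p, q⟫_ℝ : ℂ)) := by simp
    simp only [this, c]
    ring
  simp only [h1]
  have hint : ∀ l : Λ, Integrable (fun p => conj (c l) *
      (sectionFiber k (thetaSection Λ τ k μ) q p * latticeChar k (ν + l) p))
      (volume.restrict (latticeCell γ)) := fun l =>
    integrableOn_latticeCell_of_continuous γ
      (continuous_const.mul (hfib.mul (continuous_latticeChar k _)))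
  have h := hasSum_integral_of_summable_integral_norm hint (by
    simp only [norm_mul, norm_latticeChar, mul_one, RCLike.norm_conj]
    simp only [integral_const_mul]
    exact hc.mul_right _)
  have hterm : ∀ l : Λ, ∫ p in latticeCell γ, conj (c l) *
      (sectionFiber k (thetaSection Λ τ k μ) q p * latticeChar k (ν + l) p) =
      if μ - ν ∈ Λ then ((volume : Measure V).real (latticeCell γ) : ℂ) *
        (Real.exp (-(2 * Real.pi * k * τ.im) * ‖((-l : Λ) : V) + q - ν‖ ^ 2) : ℂ) else 0 :=
    fun l => by
      have hl : ν + l - μ ∈ Λ ↔ μ - ν ∈ Λ := by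
        rw [← neg_mem_iff, ← Λ.sub_mem_iff_left l.2 (x := μ - ν)]
        congr! 1
        abel
      rw [integral_const_mul, ← fiberCoef, fiberCoef_thetaSection hΛ γ τ hk hμ
        (add_mem hν (mem_scaledDual_of_mem hΛ k l.2))]
      simp only [hl, mul_ite, mul_zero]
      congr 1
      rw [mul_left_comm]
      congr 1
      change conj (c l) * c l = _
      rw [mul_comm, Complex.mul_conj, Complex.normSq_eq_norm_sq, hcn, norm_thetaTerm,
        ← Real.exp_nat_mul]
      congr 2
      have e : ((-l : Λ) : V) + q - ν = -(ν + l - q) := by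
        rw [Submodule.coe_neg]
        abel
      rw [e, norm_neg]
      push_cast
      ring
  rw [← h.tsum_eq]
  simp only [hterm]
  split_ifs with hmem
  · rw [tsum_mul_left]
    congr 1
    exact (Equiv.neg Λ).tsum_eq fun l : Λ =>
      (Real.exp (-(2 * Real.pi * k * τ.im) * ‖(l : V) + q - ν‖ ^ 2) : ℂ)
  · exact tsum_zero

theorem integral_exp_neg_mul_norm_sub_sq {c : ℝ} (hc : 0 < c) (ν : V) :
    ∫ q : V, (Real.exp (-c * ‖q - ν‖ ^ 2) : ℂ) = (Real.sqrt (Real.pi / c) ^ finrank ℝ V : ℝ) := by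
  rw [integral_complex_ofReal, integral_sub_right_eq_self fun q => Real.exp (-c * ‖q‖ ^ 2),
    GaussianFourier.integral_rexp_neg_mul_sq_norm hc]
  have := Real.pi_pos
  rw [Real.sqrt_eq_rpow, ← Real.rpow_mul_natCast (by positivity)]
  congr 2
  ring

open Classical in
/-- The theta sections are orthogonal, and their norm does not depend on `τ`: the Gaussian integral
`(2 k Im τ)^{-n/2}` is balanced by the factor `(Im τ)^{n/2}` in the norm of `Ω^{1/2}`. -/
theorem sectionInner_thetaSection (hΛ : ∀ a ∈ Λ, ∀ b ∈ Λ, ∃ m : ℤ, ⟪a, b⟫_ℝ = m)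
    (γ : Basis (Fin (finrank ℝ V)) ℤ Λ) (τ : ℍ) {k : ℕ} (hk : k ≠ 0) {μ ν : V}
    (hμ : μ ∈ scaledDual Λ k) (hν : ν ∈ scaledDual Λ k) :
    sectionInner γ τ (thetaSection Λ τ k μ) (thetaSection Λ τ k ν) =
      if μ - ν ∈ Λ then ((Real.sqrt (2 * Real.pi / k) ^ finrank ℝ V : ℝ) : ℂ) else 0 := by
  have hτ := τ.im_pos
  have hπ := Real.pi_pos
  have hk' : (0 : ℝ) < k := by positivity
  have hc : 0 < 2 * Real.pi * k * τ.im := by positivity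
  have hvol := volume_real_latticeCell_pos γ
  have hcont : ∀ {μ : V}, μ ∈ scaledDual Λ k → Continuous (thetaSection Λ τ k μ) := fun h =>
    (thetaSection_mem_quantumSpace Λ hΛ τ hk h).1.continuous
  have hI : Integrable (fun x => thetaSection Λ τ k μ x * conj (thetaSection Λ τ k ν x))
      (volume.restrict (fundDomain γ)) := integrableOn_fundDomain_of_continuous γ
    ((hcont hμ).mul (Complex.continuous_conj.comp (hcont hν)))
  rw [sectionInner_eq_integral]
  rw [fundDomain, Measure.volume_eq_prod, ← Measure.prod_restrict] at hI ⊢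
  rw [integral_prod_symm _ hI]
  simp only [setIntegral_thetaSection_mul_conj hΛ γ τ hk hμ hν]
  split_ifs with hmem
  · have hF : Integrable fun q : V =>
        (Real.exp (-(2 * Real.pi * k * τ.im) * ‖q - ν‖ ^ 2) : ℂ) := by
      have h0 := (GaussianFourier.integrable_cexp_neg_mul_sq_norm_add (V := V)
        (b := (2 * Real.pi * k * τ.im : ℝ)) (by simpa using hc) 0 0).comp_sub_right ν
      refine h0.congr (Filter.Eventually.of_forall fun q => ?_)
      simp
    rw [integral_const_mul]
    have hunf := setIntegral_latticeCell_tsum γ hF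
    simp only [integral_exp_neg_mul_norm_sub_sq hc] at hunf
    rw [hunf, halfFormNormSq_eq]
    rw [← Complex.ofReal_mul, ← Complex.ofReal_mul]
    congr 1
    have e : Real.sqrt (2 * Real.pi / k) = 2 * Real.pi * Real.sqrt (τ.im / Real.pi) *
        Real.sqrt (Real.pi / (2 * Real.pi * k * τ.im)) := by
      have h5 : 2 * Real.pi / k =
          (2 * Real.pi) ^ 2 * (τ.im / Real.pi * (Real.pi / (2 * Real.pi * k * τ.im))) := by
        field_simp
      rw [h5, Real.sqrt_mul (by positivity), Real.sqrt_sq (by positivity),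
        Real.sqrt_mul (by positivity)]
      ring
    rw [e, mul_pow, mul_pow]
    field_simp
    rw [mul_pow, mul_pow]
    ring
  · simp

open Classical in
theorem IsThetaBasis.sectionInner_apply (hΛ : ∀ a ∈ Λ, ∀ b ∈ Λ, ∃ m : ℤ, ⟪a, b⟫_ℝ = m)
    (γ : Basis (Fin (finrank ℝ V)) ℤ Λ) {τ : ℍ} {k : ℕ} (hk : k ≠ 0)
    {b : Basis (ThetaIndex Λ k) ℂ (quantumSpace Λ τ k)} (hb : IsThetaBasis b)
    (μ ν : ThetaIndex Λ k) : sectionInner γ τ (b μ : V × V → ℂ) (b ν : V × V → ℂ) =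
      if μ = ν then ((Real.sqrt (2 * Real.pi / k) ^ finrank ℝ V : ℝ) : ℂ) else 0 := by
  rw [hb.coe_apply, hb.coe_apply, sectionInner_thetaSection hΛ γ τ hk (Subtype.coe_prop _)
    (Subtype.coe_prop _)]
  congr 1
  rw [← quotientMk_eq_iff, Submodule.Quotient.mk_out, Submodule.Quotient.mk_out]

theorem IsThetaBasis.sectionInner_sum (hΛ : ∀ a ∈ Λ, ∀ b ∈ Λ, ∃ m : ℤ, ⟪a, b⟫_ℝ = m)
    (γ : Basis (Fin (finrank ℝ V)) ℤ Λ) {τ : ℍ} {k : ℕ} (hk : k ≠ 0) [Fintype (ThetaIndex Λ k)]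
    {b : Basis (ThetaIndex Λ k) ℂ (quantumSpace Λ τ k)} (hb : IsThetaBasis b)
    (c d : ThetaIndex Λ k → ℂ) :
    sectionInner γ τ ((∑ μ, c μ • b μ : quantumSpace Λ τ k) : V × V → ℂ)
        ((∑ μ, d μ • b μ : quantumSpace Λ τ k) : V × V → ℂ) =
      (∑ μ, c μ * conj (d μ)) * (Real.sqrt (2 * Real.pi / k) ^ finrank ℝ V : ℝ) := by
  classical
  have e : ∀ c : ThetaIndex Λ k → ℂ, ((∑ μ, c μ • b μ : quantumSpace Λ τ k) : V × V → ℂ) =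
      ∑ μ, c μ • (b μ : V × V → ℂ) := fun c => by simp
  have hcont : ∀ μ, Continuous (b μ : V × V → ℂ) := fun μ => (b μ).2.1.continuous
  rw [e, e, sectionInner_sum_sum γ τ c d hcont hcont, Finset.sum_mul]
  simp only [hb.sectionInner_apply hΛ γ hk, mul_ite, mul_zero, Finset.sum_ite_eq, Finset.mem_univ,
    if_true]

theorem sectionInner_identification (hΛ : ∀ a ∈ Λ, ∀ b ∈ Λ, ∃ m : ℤ, ⟪a, b⟫_ℝ = m)
    (γ : Basis (Fin (finrank ℝ V)) ℤ Λ) {τ₁ τ₂ : ℍ} {k : ℕ} (hk : k ≠ 0)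
    {b₁ : Basis (ThetaIndex Λ k) ℂ (quantumSpace Λ τ₁ k)} (h₁ : IsThetaBasis b₁)
    {b₂ : Basis (ThetaIndex Λ k) ℂ (quantumSpace Λ τ₂ k)} (h₂ : IsThetaBasis b₂)
    (s t : quantumSpace Λ τ₁ k) :
    sectionInner γ τ₂ (identification b₁ b₂ s : V × V → ℂ) (identification b₁ b₂ t : V × V → ℂ) =
      sectionInner γ τ₁ (s : V × V → ℂ) (t : V × V → ℂ) := by
  have := finite_thetaIndex hΛ γ hk
  have := Fintype.ofFinite (ThetaIndex Λ k)
  conv_rhs => rw [← b₁.sum_repr s, ← b₁.sum_repr t]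
  rw [identification_apply, identification_apply, h₁.sectionInner_sum hΛ γ hk,
    h₂.sectionInner_sum hΛ γ hk]

/-- The Schwartz kernel of `Ψ_{τ₁,τ₂,k}`. -/
theorem isSchwartzKernel_identification (hΛ : ∀ a ∈ Λ, ∀ b ∈ Λ, ∃ m : ℤ, ⟪a, b⟫_ℝ = m)
    (γ : Basis (Fin (finrank ℝ V)) ℤ Λ) {τ₁ τ₂ : ℍ} {k : ℕ} (hk : k ≠ 0)
    [Fintype (ThetaIndex Λ k)]
    {b₁ : Basis (ThetaIndex Λ k) ℂ (quantumSpace Λ τ₁ k)} (h₁ : IsThetaBasis b₁)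
    {b₂ : Basis (ThetaIndex Λ k) ℂ (quantumSpace Λ τ₂ k)} (h₂ : IsThetaBasis b₂) :
    IsSchwartzKernel γ τ₁ τ₂ k (identification b₁ b₂).toLinearMap fun z =>
      (Real.sqrt (k / (2 * Real.pi)) ^ finrank ℝ V : ℝ) * ∑ μ : ThetaIndex Λ k,
        thetaSection Λ τ₂ k (μ.out : V) z.1 * conj (thetaSection Λ τ₁ k (μ.out : V) z.2) := by
  classical
  let r : ℝ := Real.sqrt (k / (2 * Real.pi)) ^ finrank ℝ V
  have hr : r * Real.sqrt (2 * Real.pi / k) ^ finrank ℝ V = 1 := by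
    have := Real.pi_pos
    have hk' : (0 : ℝ) < k := by positivity
    simp only [r]
    rw [← mul_pow, ← Real.sqrt_mul (by positivity)]
    have : (k : ℝ) / (2 * Real.pi) * (2 * Real.pi / k) = 1 := by field_simp
    rw [this, Real.sqrt_one, one_pow]
  let σ := Fintype.equivFin (ThetaIndex Λ k)
  refine ⟨Fintype.card (ThetaIndex Λ k), fun i => b₂ (σ.symm i), fun i => (r : ℂ) • b₁ (σ.symm i),
    fun ψ => ?_, fun x y => ?_⟩
  · change identification b₁ b₂ ψ = _
    rw [identification_apply, ← σ.symm.sum_comp]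
    refine Finset.sum_congr rfl fun i _ => ?_
    congr 1
    change _ = sectionInner γ τ₁ ψ ((r : ℂ) • b₁ (σ.symm i) : quantumSpace Λ τ₁ k)
    have h3 : (r : ℂ) • b₁ (σ.symm i) = ∑ μ, (if μ = σ.symm i then (r : ℂ) else 0) • b₁ μ := by
      simp
    conv_rhs => rw [← b₁.sum_repr ψ, h3]
    rw [h₁.sectionInner_sum hΛ γ hk]
    simp only [apply_ite conj, Complex.conj_ofReal, map_zero, mul_ite, mul_zero,
      Finset.sum_ite_eq', Finset.mem_univ, if_true]
    rw [mul_assoc, ← Complex.ofReal_mul, hr, Complex.ofReal_one, mul_one]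
  · change _ * ∑ μ : ThetaIndex Λ k, thetaSection Λ τ₂ k (μ.out : V) x *
      conj (thetaSection Λ τ₁ k (μ.out : V) y) = _
    rw [Finset.mul_sum, ← σ.symm.sum_comp]
    refine Finset.sum_congr rfl fun i _ => ?_
    rw [h₂.coe_apply, Submodule.coe_smul, h₁.coe_apply]
    simp only [Pi.smul_apply, smul_eq_mul, map_mul, Complex.conj_ofReal, r]
    ring

end ScalarProduct

/-! ### The Gaussian kernel on `V × V` -/

section GaussKernel

variable {V : Type*} [NormedAddCommGroup V] [InnerProductSpace ℝ V]

/-- The quadratic form `B(p + τ₂ q, p + τ̄₁ q)`. -/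
noncomputable def boxQuad (τ₁ τ₂ : ℍ) (u : V × V) : ℂ :=
  (⟪u.1, u.1⟫_ℝ : ℂ) + ((τ₂ : ℂ) + conj (τ₁ : ℂ)) * (⟪u.1, u.2⟫_ℝ : ℂ) +
    (τ₂ : ℂ) * conj (τ₁ : ℂ) * (⟪u.2, u.2⟫_ℝ : ℂ)

/-- The logarithm of `gaussKernel`. -/
noncomputable def gaussExponent (τ₁ τ₂ : ℍ) (z : (V × V) × (V × V)) : ℂ :=
  Complex.I / 2 * (symplForm V z.2 z.1 : ℂ) -
    Complex.I * Real.pi / ((τ₂ : ℂ) - conj (τ₁ : ℂ)) * boxQuad τ₁ τ₂ (z.1 - z.2)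

/-- The section of the lift of `L ⊠ L̄` to `V² × V²` which is holomorphic for `(j_{τ₂}, -j_{τ₁})`
and equal to `1` on the diagonal. -/
noncomputable def gaussKernel (τ₁ τ₂ : ℍ) (z : (V × V) × (V × V)) : ℂ :=
  Complex.exp (gaussExponent τ₁ τ₂ z)

theorem gaussKernel_self (τ₁ τ₂ : ℍ) (x : V × V) : gaussKernel τ₁ τ₂ (x, x) = 1 := by
  simp [gaussKernel, gaussExponent, boxQuad, symplForm_apply, real_inner_comm x.1 x.2]

theorem contDiff_gaussKernel (τ₁ τ₂ : ℍ) :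
    ContDiff ℝ ∞ (gaussKernel τ₁ τ₂ : (V × V) × (V × V) → ℂ) := by
  have h : ∀ {f g : (V × V) × (V × V) → V}, ContDiff ℝ ∞ f → ContDiff ℝ ∞ g →
      ContDiff ℝ ∞ fun z => ((⟪f z, g z⟫_ℝ : ℝ) : ℂ) := fun hf hg =>
    Complex.ofRealCLM.contDiff.comp (hf.inner ℝ hg)
  have hw : ContDiff ℝ ∞ (gaussExponent τ₁ τ₂ : (V × V) × (V × V) → ℂ) := by
    unfold gaussExponent boxQuad
    simp only [symplForm_apply, Complex.ofReal_mul, Complex.ofReal_sub]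
    refine ContDiff.sub (contDiff_const.mul (contDiff_const.mul (ContDiff.sub (h ?_ ?_) (h ?_ ?_))))
      (contDiff_const.mul (ContDiff.add (ContDiff.add (h ?_ ?_) (contDiff_const.mul (h ?_ ?_)))
        (contDiff_const.mul (h ?_ ?_)))) <;> fun_prop
  exact hw.cexp

/-- The norm of the Gaussian kernel decreases like a Gaussian in `x - y`. -/
theorem exists_norm_gaussKernel_le (τ₁ τ₂ : ℍ) : ∃ c : ℝ, 0 < c ∧ ∀ x y : V × V,
    ‖gaussKernel τ₁ τ₂ (x, y)‖ ≤ Real.exp (-c * (‖x.1 - y.1‖ ^ 2 + ‖x.2 - y.2‖ ^ 2)) := by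
  have h1 := τ₁.im_pos
  have h2 := τ₂.im_pos
  have hπ := Real.pi_pos
  have hw := Complex.normSq_pos.2 (sub_conj_ne_zero τ₁ τ₂)
  set w := (τ₂ : ℂ) - conj (τ₁ : ℂ) with hwdef
  let a := τ₁.re
  let b := τ₁.im
  have hab : 0 < a ^ 2 + b ^ 2 := by positivity
  let θ := b ^ 2 / (2 * (a ^ 2 + b ^ 2))
  let c₀ := min (θ / 2) (b ^ 2 / 2)
  have hθ : 0 < θ := by positivity
  have hθ1 : θ ≤ 1 := by
    rw [div_le_one (by positivity)]
    nlinarith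
  have hθ2 : θ * a ^ 2 ≤ b ^ 2 / 2 := by
    have : θ * a ^ 2 = b ^ 2 / 2 * (a ^ 2 / (a ^ 2 + b ^ 2)) := by
      simp only [θ]
      field_simp
    rw [this]
    refine mul_le_of_le_one_right (by positivity) ((div_le_one hab).2 ?_)
    nlinarith
  have hc₀ : 0 < c₀ := lt_min (by positivity) (by positivity)
  -- the Hermitian form of the metric of `τ₁` is positive definite
  have hpos : ∀ u v : V, c₀ * (‖u‖ ^ 2 + ‖v‖ ^ 2) ≤ ‖u + a • v‖ ^ 2 + b ^ 2 * ‖v‖ ^ 2 :=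
    fun u v => by
      have h3 := half_norm_sq_sub_le u (a • v)
      rw [norm_smul, mul_pow, Real.norm_eq_abs, sq_abs] at h3
      have h4 : θ * (‖u‖ ^ 2 / 2 - a ^ 2 * ‖v‖ ^ 2) ≤ ‖u + a • v‖ ^ 2 := by
        nlinarith [sq_nonneg ‖u + a • v‖]
      have h5 : c₀ * ‖u‖ ^ 2 ≤ θ / 2 * ‖u‖ ^ 2 := by gcongr; exact min_le_left _ _
      have h6 : c₀ * ‖v‖ ^ 2 ≤ b ^ 2 / 2 * ‖v‖ ^ 2 := by gcongr; exact min_le_right _ _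
      nlinarith [sq_nonneg ‖v‖]
  refine ⟨Real.pi * (τ₂.im * c₀ / Complex.normSq w), by positivity, fun x y => ?_⟩
  rw [gaussKernel, Complex.norm_exp, Real.exp_le_exp]
  have hre : (gaussExponent τ₁ τ₂ (x, y)).re = -(Real.pi / Complex.normSq w *
      (τ₂.im * (‖x.1 - y.1 + a • (x.2 - y.2)‖ ^ 2 + b ^ 2 * ‖x.2 - y.2‖ ^ 2) +
        τ₁.im * (‖x.1 - y.1 + τ₂.re • (x.2 - y.2)‖ ^ 2 + τ₂.im ^ 2 * ‖x.2 - y.2‖ ^ 2))) := by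
    have e : gaussExponent τ₁ τ₂ (x, y) = Complex.I * ((symplForm V y x / 2 : ℝ) : ℂ) +
        (Real.pi / Complex.normSq w : ℝ) *
          (-(Complex.I * (conj w * boxQuad τ₁ τ₂ (x - y)))) := by
      have hw' := sub_conj_ne_zero τ₁ τ₂
      have h7 : (Complex.normSq w : ℂ) = conj w * w := Complex.normSq_eq_conj_mul_self
      have h8 : conj w ≠ 0 := (map_ne_zero _).2 hw'
      rw [gaussExponent, ← hwdef]
      push_cast
      rw [h7]
      field_simp
      ring
    rw [e, Complex.add_re, Complex.re_ofReal_mul, Complex.neg_re, Complex.I_mul_re,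
      Complex.I_mul_re, Complex.ofReal_im, neg_zero, zero_add, hwdef, boxQuad]
    have hn : ∀ (t : ℝ) (u v : V), ‖u + t • v‖ ^ 2 =
        ⟪u, u⟫_ℝ + 2 * t * ⟪u, v⟫_ℝ + t ^ 2 * ⟪v, v⟫_ℝ := fun t u v => by
      rw [norm_add_sq_real, norm_smul, real_inner_smul_right, mul_pow, Real.norm_eq_abs, sq_abs,
        real_inner_self_eq_norm_sq, real_inner_self_eq_norm_sq]
      ring
    rw [hn, hn, ← real_inner_self_eq_norm_sq, Prod.fst_sub, Prod.snd_sub]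
    generalize ⟪x.1 - y.1, x.1 - y.1⟫_ℝ = P
    generalize ⟪x.1 - y.1, x.2 - y.2⟫_ℝ = S
    generalize ⟪x.2 - y.2, x.2 - y.2⟫_ℝ = D
    simp [a, b]
    ring
  rw [hre, neg_mul, neg_le_neg_iff]
  have h3 := hpos (x.1 - y.1) (x.2 - y.2)
  have h4 : 0 ≤ τ₁.im * (‖x.1 - y.1 + τ₂.re • (x.2 - y.2)‖ ^ 2 + τ₂.im ^ 2 * ‖x.2 - y.2‖ ^ 2) := by
    positivity
  have h5 := mul_le_mul_of_nonneg_left h3 h2.le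
  calc _ = Real.pi / Complex.normSq w *
        (τ₂.im * (c₀ * (‖x.1 - y.1‖ ^ 2 + ‖x.2 - y.2‖ ^ 2))) := by ring
    _ ≤ _ := by
      gcongr
      linarith

theorem gaussKernel_add (τ₁ τ₂ : ℍ) (l x y : V × V) :
    gaussKernel τ₁ τ₂ (l + x, l + y) =
      multiplier l x * conj (multiplier l y) * gaussKernel τ₁ τ₂ (x, y) := by
  simp only [gaussKernel, gaussExponent, multiplier, ← Complex.exp_conj,
    ← Complex.exp_add, add_sub_add_left_eq_sub]
  congr 1
  simp only [symplForm_apply, Prod.fst_add, Prod.snd_add, inner_add_left, inner_add_right]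
  simp only [map_add, map_mul, Complex.conj_I, Complex.conj_ofReal, map_div₀, Complex.conj_ofNat]
  rw [real_inner_comm l.1 l.2, real_inner_comm l.2 y.1, real_inner_comm l.1 y.2]
  push_cast
  ring

/-- The Gaussian kernel is holomorphic. -/
theorem boxDbar_gaussKernel (τ₁ τ₂ : ℍ) (z Z : (V × V) × (V × V)) :
    boxDbar τ₁ τ₂ (gaussKernel τ₁ τ₂) z Z = 0 := by
  have hw := sub_conj_ne_zero τ₁ τ₂
  set w := (τ₂ : ℂ) - conj (τ₁ : ℂ) with hwdef
  let F1 := ContinuousLinearMap.fst ℝ V V ∘L ContinuousLinearMap.fst ℝ (V × V) (V × V)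
  let F2 := ContinuousLinearMap.snd ℝ V V ∘L ContinuousLinearMap.fst ℝ (V × V) (V × V)
  let G1 := ContinuousLinearMap.fst ℝ V V ∘L ContinuousLinearMap.snd ℝ (V × V) (V × V)
  let G2 := ContinuousLinearMap.snd ℝ V V ∘L ContinuousLinearMap.snd ℝ (V × V) (V × V)
  obtain ⟨D1, hD1, hD1'⟩ := hasFDerivAt_ofReal_inner G1 F2 z
  obtain ⟨D2, hD2, hD2'⟩ := hasFDerivAt_ofReal_inner G2 F1 z
  obtain ⟨D3, hD3, hD3'⟩ := hasFDerivAt_ofReal_inner (F1 - G1) (F1 - G1) z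
  obtain ⟨D4, hD4, hD4'⟩ := hasFDerivAt_ofReal_inner (F1 - G1) (F2 - G2) z
  obtain ⟨D5, hD5, hD5'⟩ := hasFDerivAt_ofReal_inner (F2 - G2) (F2 - G2) z
  have hexp : gaussExponent τ₁ τ₂ = fun z : (V × V) × (V × V) =>
      Complex.I * Real.pi * ((⟪G1 z, F2 z⟫_ℝ : ℂ) - (⟪G2 z, F1 z⟫_ℝ : ℂ)) -
        Complex.I * Real.pi / w * ((⟪(F1 - G1) z, (F1 - G1) z⟫_ℝ : ℂ) +
          ((τ₂ : ℂ) + conj (τ₁ : ℂ)) * (⟪(F1 - G1) z, (F2 - G2) z⟫_ℝ : ℂ) +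
          (τ₂ : ℂ) * conj (τ₁ : ℂ) * (⟪(F2 - G2) z, (F2 - G2) z⟫_ℝ : ℂ)) := by
    funext z
    rw [gaussExponent, symplForm_apply, ← hwdef]
    congr 1
    simp only [F1, F2, G1, G2, ContinuousLinearMap.comp_apply, ContinuousLinearMap.coe_fst',
      ContinuousLinearMap.coe_snd']
    push_cast
    ring
  have h := (((hD1.sub hD2).const_mul (Complex.I * Real.pi)).sub
    (((hD3.add (hD4.const_mul ((τ₂ : ℂ) + conj (τ₁ : ℂ)))).add
      (hD5.const_mul ((τ₂ : ℂ) * conj (τ₁ : ℂ)))).const_mul (Complex.I * Real.pi / w)))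
  have hD : HasFDerivAt (gaussExponent τ₁ τ₂) ((Complex.I * Real.pi) • (D1 - D2) -
      (Complex.I * Real.pi / w) •
        (D3 + ((τ₂ : ℂ) + conj (τ₁ : ℂ)) • D4 + ((τ₂ : ℂ) * conj (τ₁ : ℂ)) • D5)) z := by
    rw [hexp]
    exact h
  have hG : HasFDerivAt (gaussKernel τ₁ τ₂) _ z := hD.cexp
  -- the covariant derivative is complex linear
  have hnabla : ∀ Z, boxNabla (gaussKernel τ₁ τ₂) z Z = gaussKernel τ₁ τ₂ z *
      (-(2 * Complex.I * Real.pi / w) * (zetaInner τ₂ Z.1 (z.1 - z.2).1 +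
        conj (τ₁ : ℂ) * zetaInner τ₂ Z.1 (z.1 - z.2).2 -
        conj (zetaInner τ₁ Z.2 (z.1 - z.2).1) -
        (τ₂ : ℂ) * conj (zetaInner τ₁ Z.2 (z.1 - z.2).2))) := fun Z => by
    have hre : conj (τ₁ : ℂ) = (τ₂ : ℂ) - w := by rw [hwdef]; ring
    have hconn : connForm z.1 Z.1 + conj (connForm z.2 Z.2) = -(Complex.I * Real.pi) *
        ((⟪z.1.1, Z.1.2⟫_ℝ : ℂ) - ⟪z.1.2, Z.1.1⟫_ℝ - (⟪z.2.1, Z.2.2⟫_ℝ - ⟪z.2.2, Z.2.1⟫_ℝ)) := by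
      simp only [connForm, map_mul, map_neg, Complex.conj_I, Complex.conj_ofReal, div_eq_mul_inv,
        Complex.inv_I]
      push_cast
      ring
    rw [boxNabla, hG.fderiv, hconn, ← gaussKernel]
    simp only [smul_apply, add_apply, sub_apply, smul_eq_mul, hD1', hD2', hD3', hD4', hD5']
    simp only [F1, F2, G1, G2, ContinuousLinearMap.comp_apply, ContinuousLinearMap.coe_fst',
      ContinuousLinearMap.coe_snd', zetaInner, Prod.fst_sub, Prod.snd_sub, map_add,
      map_mul, Complex.conj_ofReal, inner_sub_left, inner_sub_right, hre]
    push_cast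
    simp only [real_inner_comm z.1.1, real_inner_comm z.1.2, real_inner_comm z.2.1,
      real_inner_comm z.2.2]
    field_simp
    ring
  have hconj : ∀ v, conj (zetaInner τ₁ (-complexStructure V τ₁ Z.2) v) =
      Complex.I * conj (zetaInner τ₁ Z.2 v) := fun v => by
    have : zetaInner τ₁ (-complexStructure V τ₁ Z.2) v =
        -zetaInner τ₁ (complexStructure V τ₁ Z.2) v := by
      simp only [zetaInner, Prod.fst_neg, Prod.snd_neg, inner_neg_left]
      push_cast
      ring
    rw [this, zetaInner_complexStructure]
    simp
  rw [boxDbar, hnabla, hnabla, boxComplexStructure]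
  simp only [zetaInner_complexStructure, hconj]
  ring_nf
  simp only [Complex.I_pow_three]
  ring

end GaussKernel

/-! ### Periodisation over `Λ²` -/

section Periodise

variable {V : Type*} [NormedAddCommGroup V] [InnerProductSpace ℝ V]

theorem multiplier_add {Λ : Submodule ℤ V} (hΛ : ∀ a ∈ Λ, ∀ b ∈ Λ, ∃ m : ℤ, ⟪a, b⟫_ℝ = m)
    {m l : V × V} (hm : m.1 ∈ Λ ∧ m.2 ∈ Λ) (hl : l.1 ∈ Λ ∧ l.2 ∈ Λ) (x : V × V) :
    multiplier (m + l) x = multiplier m (l + x) * multiplier l x := by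
  obtain ⟨a, ha⟩ := hΛ m.2 hm.2 l.1 hl.1
  simp only [multiplier, ← Complex.exp_add]
  rw [Complex.exp_eq_exp_iff_exists_int]
  refine ⟨a, ?_⟩
  simp only [symplForm_apply, Prod.fst_add, Prod.snd_add, inner_add_left, inner_add_right]
  rw [real_inner_comm m.2 l.1, ha]
  push_cast
  ring

theorem conj_multiplier_mul_self (l x : V × V) : conj (multiplier l x) * multiplier l x = 1 := by
  rw [← Complex.normSq_eq_conj_mul_self, Complex.normSq_eq_norm_sq, norm_multiplier]
  simp

variable (Λ : Submodule ℤ V)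

/-- The sum of the translates of `F` under the action of `Λ²` on the sections of `L^k`. -/
noncomputable def periodise (k : ℕ) (F : V × V → ℂ) (x : V × V) : ℂ :=
  ∑' l : Λ × Λ, conj (multiplier ((l.1 : V), (l.2 : V)) x) ^ k * F (((l.1 : V), (l.2 : V)) + x)

theorem isInvariant_periodise (hΛ : ∀ a ∈ Λ, ∀ b ∈ Λ, ∃ m : ℤ, ⟪a, b⟫_ℝ = m) (k : ℕ)
    (F : V × V → ℂ) : IsInvariant Λ k (periodise Λ k F) := by
  intro l h1 h2 x
  rw [periodise, periodise, ← tsum_mul_left]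
  conv_rhs => rw [← (Equiv.addRight ((⟨l.1, h1⟩, ⟨l.2, h2⟩) : Λ × Λ)).tsum_eq]
  refine tsum_congr fun m => ?_
  have h := multiplier_add hΛ (m := (m.1, m.2)) ⟨m.1.2, m.2.2⟩ (l := l) ⟨h1, h2⟩ x
  have e : (((m + (⟨l.1, h1⟩, ⟨l.2, h2⟩) : Λ × Λ).1 : V),
      ((m + (⟨l.1, h1⟩, ⟨l.2, h2⟩) : Λ × Λ).2 : V)) =
      ((m.1 : V), (m.2 : V)) + l := rfl
  rw [Equiv.coe_addRight, e, h, add_assoc, map_mul, ← mul_assoc, ← mul_pow, mul_left_comm,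
    mul_comm (multiplier l x), conj_multiplier_mul_self, mul_one]

end Periodise

/-! ### A Gaussian integral and the Gaussian sum over `Λ²` -/

section GaussianIntegral

variable {V : Type*} [NormedAddCommGroup V] [InnerProductSpace ℝ V] [FiniteDimensional ℝ V]
  [MeasurableSpace V] [BorelSpace V]

theorem integral_cexp_neg_mul_norm_sq_add_add {b : ℂ} (hb : 0 < b.re) (c₁ c₂ : ℂ) (v₁ v₂ : V) :
    ∫ p : V, Complex.exp (-b * (⟪p, p⟫_ℝ : ℂ) + (c₁ * (⟪v₁, p⟫_ℝ : ℂ) + c₂ * (⟪v₂, p⟫_ℝ : ℂ))) =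
      (Real.pi / b) ^ ((finrank ℝ V : ℂ) / 2) * Complex.exp ((c₁ ^ 2 * (⟪v₁, v₁⟫_ℝ : ℂ) +
        2 * c₁ * c₂ * (⟪v₁, v₂⟫_ℝ : ℂ) + c₂ ^ 2 * (⟪v₂, v₂⟫_ℝ : ℂ)) / (4 * b)) := by
  let e := (stdOrthonormalBasis ℝ V).repr.symm
  rw [← e.measurePreserving.integral_comp e.toHomeomorph.measurableEmbedding,
    ← (PiLp.volume_preserving_toLp _).integral_comp
    (MeasurableEquiv.toLp 2 _).measurableEmbedding]
  have hin : ∀ (v : V) (u : Fin (finrank ℝ V) → ℝ),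
      ⟪v, e (WithLp.toLp 2 u)⟫_ℝ = ∑ i, e.symm v i * u i := fun v u => by
    rw [← e.symm.inner_map_map, e.symm_apply_apply, PiLp.inner_apply]
    simp [mul_comm]
  have hin' : ∀ v v' : V, ⟪v, v'⟫_ℝ = ∑ i, e.symm v i * e.symm v' i := fun v v' => by
    rw [← e.symm.inner_map_map, PiLp.inner_apply]
    simp [mul_comm]
  have h := GaussianFourier.integral_cexp_neg_mul_sum_add hb
    fun i => c₁ * (e.symm v₁ i : ℂ) + c₂ * (e.symm v₂ i : ℂ)
  rw [Fintype.card_fin] at h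
  have h1 : ∀ u : Fin (finrank ℝ V) → ℝ, -b * (⟪e (WithLp.toLp 2 u), e (WithLp.toLp 2 u)⟫_ℝ : ℂ) +
      (c₁ * (⟪v₁, e (WithLp.toLp 2 u)⟫_ℝ : ℂ) + c₂ * (⟪v₂, e (WithLp.toLp 2 u)⟫_ℝ : ℂ)) =
      -b * ∑ i, (u i : ℂ) ^ 2 +
        ∑ i, (c₁ * (e.symm v₁ i : ℂ) + c₂ * (e.symm v₂ i : ℂ)) * u i := fun u => by
    rw [hin, hin, hin, e.symm_apply_apply]
    push_cast
    simp only [Finset.mul_sum, ← Finset.sum_add_distrib]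
    refine Finset.sum_congr rfl fun i _ => ?_
    ring
  have h2 : c₁ ^ 2 * (⟪v₁, v₁⟫_ℝ : ℂ) + 2 * c₁ * c₂ * (⟪v₁, v₂⟫_ℝ : ℂ) +
      c₂ ^ 2 * (⟪v₂, v₂⟫_ℝ : ℂ) = ∑ i, (c₁ * (e.symm v₁ i : ℂ) + c₂ * (e.symm v₂ i : ℂ)) ^ 2 := by
    rw [hin', hin', hin']
    push_cast
    simp only [Finset.mul_sum, ← Finset.sum_add_distrib]
    refine Finset.sum_congr rfl fun i _ => ?_
    ring
  rw [h2, ← h]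
  simp only [← h1]

end GaussianIntegral

section GaussianSumsSq

variable {V : Type*} [NormedAddCommGroup V] [InnerProductSpace ℝ V] [FiniteDimensional ℝ V]
variable {Λ : Submodule ℤ V} [DiscreteTopology Λ] [IsZLattice ℝ Λ]

theorem summable_exp_neg_mul_norm_add_sq_prod {c : ℝ} (hc : 0 < c) (x : V × V) :
    Summable fun l : Λ × Λ => Real.exp (-c * (‖(l.1 : V) + x.1‖ ^ 2 + ‖(l.2 : V) + x.2‖ ^ 2)) := by
  simp only [mul_add, Real.exp_add]
  exact (summable_exp_neg_mul_norm_add_sq Λ hc x.1).mul_of_nonneg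
    (summable_exp_neg_mul_norm_add_sq Λ hc x.2) (fun _ => (Real.exp_pos _).le)
    (fun _ => (Real.exp_pos _).le)

theorem exists_tsum_exp_neg_mul_norm_add_sq_prod_le (Λ : Submodule ℤ V) [DiscreteTopology Λ]
    [IsZLattice ℝ Λ] {c : ℝ} (hc : 0 < c) : ∃ M, ∀ x : V × V,
    ∑' l : Λ × Λ, Real.exp (-c * (‖(l.1 : V) + x.1‖ ^ 2 + ‖(l.2 : V) + x.2‖ ^ 2)) ≤ M := by
  obtain ⟨M, hM⟩ := exists_tsum_exp_neg_mul_norm_add_sq_le Λ hc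
  have h0 : ∀ v : V, 0 ≤ ∑' l : Λ, Real.exp (-c * ‖(l : V) + v‖ ^ 2) := fun v =>
    tsum_nonneg fun _ => (Real.exp_pos _).le
  refine ⟨M * M, fun x => ?_⟩
  have h := (summable_exp_neg_mul_norm_add_sq Λ hc x.1).tsum_mul_tsum
    (summable_exp_neg_mul_norm_add_sq Λ hc x.2) (by
      simpa only [mul_add, Real.exp_add] using summable_exp_neg_mul_norm_add_sq_prod hc x)
  simp only [mul_add, Real.exp_add]
  rw [← h]
  exact mul_le_mul (hM _) (hM _) (h0 _) ((h0 0).trans (hM 0))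

/-- A sum over `Λ²` of continuous functions is continuous if its terms have Gaussian decay. -/
theorem continuous_tsum_of_norm_le_exp {f : Λ × Λ → V × V → ℂ} (hf : ∀ l, Continuous (f l)) {c : ℝ}
    (hc : 0 < c) (a : V × V) (h : ∀ l x, ‖f l x‖ ≤
      Real.exp (-c * (‖(l.1 : V) + (x.1 - a.1)‖ ^ 2 + ‖(l.2 : V) + (x.2 - a.2)‖ ^ 2))) :
    Continuous fun x => ∑' l, f l x := by
  rw [continuous_iff_continuousAt]
  intro x₀
  have hs := (summable_exp_neg_mul_norm_add_sq_prod (Λ := Λ) (half_pos hc) (x₀ - a)).mul_left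
    (Real.exp (2 * c))
  have hcont : ContinuousOn (fun x => ∑' l, f l x) (Metric.ball x₀ 1) := by
    refine continuousOn_tsum (fun l => (hf l).continuousOn) hs fun l x hx => (h l x).trans ?_
    rw [← Real.exp_add, Real.exp_le_exp]
    rw [mem_ball_iff_norm] at hx
    have h1 : ‖x.1 - x₀.1‖ ≤ 1 := (norm_fst_le (x - x₀)).trans hx.le
    have h2 : ‖x.2 - x₀.2‖ ≤ 1 := (norm_snd_le (x - x₀)).trans hx.le
    have h3 := half_norm_sq_sub_le ((l.1 : V) + (x₀.1 - a.1)) (x.1 - x₀.1)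
    have h4 := half_norm_sq_sub_le ((l.2 : V) + (x₀.2 - a.2)) (x.2 - x₀.2)
    have e1 : (l.1 : V) + (x₀.1 - a.1) + (x.1 - x₀.1) = (l.1 : V) + (x.1 - a.1) := by abel
    have e2 : (l.2 : V) + (x₀.2 - a.2) + (x.2 - x₀.2) = (l.2 : V) + (x.2 - a.2) := by abel
    rw [e1] at h3
    rw [e2] at h4
    have h5 : ‖x.1 - x₀.1‖ ^ 2 ≤ 1 := pow_le_one₀ (norm_nonneg _) h1
    have h6 : ‖x.2 - x₀.2‖ ^ 2 ≤ 1 := pow_le_one₀ (norm_nonneg _) h2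
    rw [Prod.fst_sub, Prod.snd_sub]
    nlinarith
  exact hcont.continuousAt (Metric.ball_mem_nhds _ one_pos)

variable [MeasurableSpace V] [BorelSpace V]

/-- Exchange of the sum and of the integral over a cell, for a uniformly bounded sum. -/
theorem hasSum_setIntegral_latticeCell (γ : Basis (Fin (finrank ℝ V)) ℤ Λ) {ι : Type*}
    [Countable ι] {f : ι → V → ℂ} (hf : ∀ i, Continuous (f i)) {M : ℝ}
    (hs : ∀ p, Summable fun i => ‖f i p‖) (hM : ∀ p, ∑' i, ‖f i p‖ ≤ M) :
    HasSum (fun i => ∫ p in latticeCell γ, f i p) (∫ p in latticeCell γ, ∑' i, f i p) := by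
  refine hasSum_integral_of_summable_integral_norm
    (fun i => integrableOn_latticeCell_of_continuous γ (hf i)) ?_
  refine summable_of_sum_le (c := (volume : Measure V).real (latticeCell γ) * M)
    (fun i => integral_nonneg fun p => norm_nonneg _) fun S => ?_
  rw [← integral_finsetSum _ fun i _ => integrableOn_latticeCell_of_continuous γ (hf i).norm]
  have hle : ∫ p in latticeCell γ, ∑ i ∈ S, ‖f i p‖ ≤ ∫ p in latticeCell γ, M := by
    refine integral_mono (integrableOn_latticeCell_of_continuous γ
      (continuous_finsetSum _ fun i _ => (hf i).norm))
      (integrableOn_latticeCell_of_continuous γ continuous_const) fun p => ?_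
    exact ((hs p).sum_le_tsum S fun i _ => norm_nonneg _).trans (hM p)
  refine hle.trans_eq ?_
  simp

/-- The unfolding of an integral over a cell, as a sum over the translates of the cell. -/
theorem tsum_setIntegral_latticeCell_add (γ : Basis (Fin (finrank ℝ V)) ℤ Λ) {F : V → ℂ}
    (hF : Integrable F) :
    ∑' l : Λ, ∫ p in latticeCell γ, F (l + p) = ∫ p, F p := by
  have := ZLattice.module_finite ℝ Λ
  rw [(isAddFundamentalDomain_latticeCell γ).integral_eq_tsum'' F hF]
  rfl

end GaussianSumsSq

/-! ### Fourier coefficients of the periodised Gaussian kernel -/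

section GaussFiber

variable {V : Type*} [NormedAddCommGroup V] [InnerProductSpace ℝ V]

/-- The integrand of the Fourier coefficients of the periodised Gaussian kernel, after unfolding of
the sum over the first factor of `Λ²`. -/
noncomputable def gaussFiber (τ₁ τ₂ : ℍ) (k : ℕ) (y : V × V) (g q l p : V) : ℂ :=
  Complex.exp (Complex.I * Real.pi * k * (⟪l, p⟫_ℝ : ℂ)) * gaussKernel τ₁ τ₂ ((p, l + q), y) ^ k *
    Complex.exp (-(Complex.I * Real.pi * k * (⟪p, q⟫_ℝ : ℂ))) * latticeChar k g p

theorem gaussKernel_pow (τ₁ τ₂ : ℍ) (k : ℕ) (z : (V × V) × (V × V)) :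
    gaussKernel τ₁ τ₂ z ^ k = Complex.exp (k * gaussExponent τ₁ τ₂ z) := by
  rw [gaussKernel, ← Complex.exp_nat_mul]

theorem continuous_gaussFiber (τ₁ τ₂ : ℍ) (k : ℕ) (y : V × V) (g q l : V) :
    Continuous (gaussFiber τ₁ τ₂ k y g q l) := by
  have h1 := (contDiff_gaussKernel (V := V) τ₁ τ₂).continuous
  have h2 := continuous_latticeChar k g
  unfold gaussFiber
  fun_prop

theorem norm_gaussFiber (τ₁ τ₂ : ℍ) (k : ℕ) (y : V × V) (g q l p : V) :
    ‖gaussFiber τ₁ τ₂ k y g q l p‖ = ‖gaussKernel τ₁ τ₂ ((p, l + q), y)‖ ^ k := by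
  rw [gaussFiber, norm_mul, norm_mul, norm_mul, norm_latticeChar, Complex.norm_exp,
    Complex.norm_exp, norm_pow]
  simp

theorem norm_gaussKernel_pow_le {τ₁ τ₂ : ℍ} {c : ℝ} (h : ∀ x y : V × V, ‖gaussKernel τ₁ τ₂ (x, y)‖ ≤
    Real.exp (-c * (‖x.1 - y.1‖ ^ 2 + ‖x.2 - y.2‖ ^ 2))) (k : ℕ) (x y : V × V) :
    ‖gaussKernel τ₁ τ₂ (x, y)‖ ^ k ≤
      Real.exp (-(k * c) * (‖x.1 - y.1‖ ^ 2 + ‖x.2 - y.2‖ ^ 2)) := by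
  refine (pow_le_pow_left₀ (norm_nonneg _) (h x y) k).trans_eq ?_
  rw [← Real.exp_nat_mul]
  congr 1
  ring

/-- The terms of the periodised Gaussian kernel with a given component in the second factor of `Λ²`
are the translates of a single function of `p`. -/
theorem conj_multiplier_mul_gaussKernel {Λ : Submodule ℤ V}
    (hΛ : ∀ a ∈ Λ, ∀ b ∈ Λ, ∃ m : ℤ, ⟪a, b⟫_ℝ = m) (τ₁ τ₂ : ℍ) (k : ℕ) (y : V × V) {g : V}
    (hg : g ∈ scaledDual Λ k) {l₁ l₂ : V} (h₁ : l₁ ∈ Λ) (h₂ : l₂ ∈ Λ) (q p : V) :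
    conj (multiplier (l₁, l₂) (p, q)) ^ k * gaussKernel τ₁ τ₂ ((l₁, l₂) + (p, q), y) ^ k *
        Complex.exp (-(Complex.I * Real.pi * k * (⟪p, q⟫_ℝ : ℂ))) * latticeChar k g p =
      gaussFiber τ₁ τ₂ k y g q l₂ (l₁ + p) := by
  obtain ⟨m, hm⟩ := hΛ l₂ h₂ l₁ h₁
  have e : conj (multiplier (l₁, l₂) (p, q)) ^ k *
      Complex.exp (-(Complex.I * Real.pi * k * (⟪p, q⟫_ℝ : ℂ))) =
      Complex.exp (Complex.I * Real.pi * k * (⟪l₂, l₁ + p⟫_ℝ : ℂ)) *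
        Complex.exp (-(Complex.I * Real.pi * k * (⟪l₁ + p, q⟫_ℝ : ℂ))) := by
    rw [multiplier, ← Complex.exp_add (Complex.I * _ * _), ← Complex.exp_conj,
      ← Complex.exp_nat_mul, ← Complex.exp_add, ← Complex.exp_add,
      Complex.exp_eq_exp_iff_exists_int]
    refine ⟨-(k * m), ?_⟩
    simp only [symplForm_apply, inner_add_left, inner_add_right]
    simp only [map_add, map_mul, map_div₀, Complex.conj_I, Complex.conj_ofReal, Complex.conj_ofNat]
    rw [real_inner_comm l₂ l₁, hm]
    push_cast
    ring
  rw [gaussFiber, latticeChar_add_right, latticeChar_of_mem hg h₁, one_mul, Prod.mk_add_mk,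
    mul_right_comm (conj _ ^ k), e]
  ring

theorem norm_conj_multiplier_pow_mul {c : ℝ} {τ₁ τ₂ : ℍ}
    (h : ∀ x y : V × V, ‖gaussKernel τ₁ τ₂ (x, y)‖ ≤
      Real.exp (-c * (‖x.1 - y.1‖ ^ 2 + ‖x.2 - y.2‖ ^ 2))) (k : ℕ) (y l x : V × V) :
    ‖conj (multiplier l x) ^ k * gaussKernel τ₁ τ₂ (l + x, y) ^ k‖ ≤
      Real.exp (-(k * c) * (‖l.1 + (x.1 - y.1)‖ ^ 2 + ‖l.2 + (x.2 - y.2)‖ ^ 2)) := by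
  rw [norm_mul, norm_pow, norm_pow, RCLike.norm_conj, norm_multiplier, one_pow, one_mul,
    ← add_sub_assoc, ← add_sub_assoc]
  exact norm_gaussKernel_pow_le h k (l + x) y

theorem continuous_multiplier (l : V × V) : Continuous (multiplier l) := by
  unfold multiplier
  simp only [symplForm_apply]
  fun_prop

theorem gaussWidth_re_pos (τ₁ τ₂ : ℍ) {k : ℕ} (hk : k ≠ 0) :
    0 < (Complex.I * Real.pi * k / ((τ₂ : ℂ) - conj (τ₁ : ℂ))).re := by
  have h1 := τ₁.im_pos
  have h2 := τ₂.im_pos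
  have hw := Complex.normSq_pos.2 (sub_conj_ne_zero τ₁ τ₂)
  have hk' : (0 : ℝ) < k := by positivity
  have hπ := Real.pi_pos
  rw [Complex.div_re]
  simp
  positivity

variable [FiniteDimensional ℝ V]

theorem continuous_periodise_gaussKernel (Λ : Submodule ℤ V) [DiscreteTopology Λ]
    [IsZLattice ℝ Λ] (τ₁ τ₂ : ℍ) {k : ℕ} (hk : k ≠ 0) (y : V × V) :
    Continuous (periodise Λ k fun x => gaussKernel τ₁ τ₂ (x, y) ^ k) := by
  obtain ⟨c, hc, h⟩ := exists_norm_gaussKernel_le (V := V) τ₁ τ₂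
  have hG := (contDiff_gaussKernel (V := V) τ₁ τ₂).continuous
  refine continuous_tsum_of_norm_le_exp (fun l => ?_) (c := k * c) (by positivity) y fun l x =>
    norm_conj_multiplier_pow_mul h k y ((l.1 : V), (l.2 : V)) x
  have := continuous_multiplier ((l.1 : V), (l.2 : V))
  have := Complex.continuous_conj
  fun_prop

variable [MeasurableSpace V] [BorelSpace V]

/-- The Gaussian integral factors into a Fourier coefficient for `τ₂` and the conjugate of a term of
the theta section for `τ₁`. -/
theorem integral_gaussFiber (τ₁ τ₂ : ℍ) {k : ℕ} (hk : k ≠ 0) (y : V × V) (g q l : V) :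
    ∫ p, gaussFiber τ₁ τ₂ k y g q l p =
      (Real.pi / (Complex.I * Real.pi * k / ((τ₂ : ℂ) - conj (τ₁ : ℂ)))) ^ ((finrank ℝ V : ℂ) / 2) *
        (Complex.exp (Complex.I * Real.pi * k * τ₂ * (‖g - q‖ ^ 2 : ℝ)) *
          conj (thetaTerm τ₁ k (g + l) y)) := by
  have hw := sub_conj_ne_zero τ₁ τ₂
  have hb := gaussWidth_re_pos τ₁ τ₂ hk
  set w := (τ₂ : ℂ) - conj (τ₁ : ℂ) with hwdef
  set b := Complex.I * Real.pi * k / w with hbdef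
  have hre : conj (τ₁ : ℂ) = (τ₂ : ℂ) - w := by rw [hwdef]; ring
  obtain ⟨p', q'⟩ := y
  -- the coefficients of the linear part of the exponent, as a function of `p - p'`
  let v := l - q' - q + (2 : ℝ) • g
  let d := l + q - q'
  let C := Complex.I * Real.pi * k * (⟪p', (2 : ℝ) • l - q' + (2 : ℝ) • g⟫_ℝ : ℂ) -
    b * τ₂ * conj (τ₁ : ℂ) * (⟪d, d⟫_ℝ : ℂ)
  have h1 : ∀ p, gaussFiber τ₁ τ₂ k (p', q') g q l p = Complex.exp C *
      Complex.exp (-b * (⟪p - p', p - p'⟫_ℝ : ℂ) +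
        ((Complex.I * Real.pi * k) * (⟪v, p - p'⟫_ℝ : ℂ) +
          (-b * (τ₂ + conj (τ₁ : ℂ))) * (⟪d, p - p'⟫_ℝ : ℂ))) := fun p => by
    rw [gaussFiber, gaussKernel_pow, latticeChar]
    simp only [← Complex.exp_add]
    congr 1
    rw [gaussExponent, ← hwdef, symplForm_apply, boxQuad]
    simp only [C, v, d, hbdef, Prod.fst_sub, Prod.snd_sub, inner_add_left, inner_add_right,
      inner_sub_left, inner_sub_right, real_inner_smul_left, real_inner_smul_right]
    push_cast
    simp only [real_inner_comm p p', real_inner_comm p l, real_inner_comm p g, real_inner_comm p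
      q, real_inner_comm p q', real_inner_comm p' l, real_inner_comm p' g, real_inner_comm p' q,
      real_inner_comm p' q', real_inner_comm l q, real_inner_comm l q',
      real_inner_comm q q']
    field_simp
    ring
  simp only [h1]
  rw [integral_const_mul, integral_sub_right_eq_self fun p : V =>
    Complex.exp (-b * (⟪p, p⟫_ℝ : ℂ) + ((Complex.I * Real.pi * k) * (⟪v, p⟫_ℝ : ℂ) +
        (-b * (τ₂ + conj (τ₁ : ℂ))) * (⟪d, p⟫_ℝ : ℂ))), integral_cexp_neg_mul_norm_sq_add_add hb,
    mul_left_comm, thetaTerm, map_mul, map_mul, ← latticeChar_neg_left, neg_neg, latticeChar]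
  congr 1
  simp only [← Complex.exp_add, ← Complex.exp_conj]
  congr 1
  have hk' : (k : ℂ) ≠ 0 := by exact_mod_cast hk
  have hπ : (Real.pi : ℂ) ≠ 0 := by exact_mod_cast Real.pi_ne_zero
  have hI := Complex.I_ne_zero
  rw [← real_inner_self_eq_norm_sq, ← real_inner_self_eq_norm_sq]
  simp only [C, v, d, hbdef, inner_add_left, inner_add_right, map_mul, Complex.conj_I,
    Complex.conj_ofReal, Complex.conj_natCast, hre,
    inner_sub_left, inner_sub_right, real_inner_smul_left, real_inner_smul_right]
  push_cast
  simp only [real_inner_comm l g, real_inner_comm l q, real_inner_comm l q', real_inner_comm g q,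
    real_inner_comm g q', real_inner_comm q q']
  field_simp
  ring

theorem integrable_gaussFiber (τ₁ τ₂ : ℍ) {k : ℕ} (hk : k ≠ 0) (y : V × V) (g q l : V) :
    Integrable (gaussFiber τ₁ τ₂ k y g q l) := by
  obtain ⟨c, hc, h⟩ := exists_norm_gaussKernel_le (V := V) τ₁ τ₂
  have hkc : 0 < k * c := by positivity
  have h0 := (GaussianFourier.integrable_cexp_neg_mul_sq_norm_add (V := V)
    (b := (k * c : ℝ)) (by simpa using hkc) 0 0).norm.comp_sub_right y.1
  refine h0.mono' (continuous_gaussFiber τ₁ τ₂ k y g q l).aestronglyMeasurable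
    (Filter.Eventually.of_forall fun p => ?_)
  rw [norm_gaussFiber]
  refine (norm_gaussKernel_pow_le h k _ y).trans ?_
  rw [Complex.norm_exp, Real.exp_le_exp]
  have e : (-((k * c : ℝ) : ℂ) * (‖p - y.1‖ : ℂ) ^ 2 + 0 * ((⟪(0 : V), p - y.1⟫_ℝ : ℝ) : ℂ)).re =
      -(k * c) * ‖p - y.1‖ ^ 2 := by
    rw [zero_mul, add_zero, ← Complex.ofReal_pow, ← Complex.ofReal_neg, ← Complex.ofReal_mul,
      Complex.ofReal_re]
  rw [e]
  nlinarith [sq_nonneg ‖l + q - y.2‖]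

variable {Λ : Submodule ℤ V} [DiscreteTopology Λ] [IsZLattice ℝ Λ]

/-- The sum over the first factor of `Λ²` unfolds the integral over the cell to an integral over
`V`,
and the sum over the second factor gives a theta section for `τ₁`. -/
theorem fiberCoef_periodise_gaussKernel (hΛ : ∀ a ∈ Λ, ∀ b ∈ Λ, ∃ m : ℤ, ⟪a, b⟫_ℝ = m)
    (γ : Basis (Fin (finrank ℝ V)) ℤ Λ) (τ₁ τ₂ : ℍ) {k : ℕ} (hk : k ≠ 0) (y : V × V) {g : V}
    (hg : g ∈ scaledDual Λ k) (q : V) :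
    fiberCoef γ k (periodise Λ k fun x => gaussKernel τ₁ τ₂ (x, y) ^ k) q g =
      (Real.pi / (Complex.I * Real.pi * k / ((τ₂ : ℂ) - conj (τ₁ : ℂ)))) ^ ((finrank ℝ V : ℂ) / 2) *
        (Complex.exp (Complex.I * Real.pi * k * τ₂ * (‖g - q‖ ^ 2 : ℝ)) *
          conj (thetaSection Λ τ₁ k g y)) := by
  obtain ⟨c, hc, h⟩ := exists_norm_gaussKernel_le (V := V) τ₁ τ₂
  have hkc : 0 < k * c := by positivity
  obtain ⟨M, hM⟩ := exists_tsum_exp_neg_mul_norm_add_sq_prod_le Λ hkc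
  have := ZLattice.module_finite ℝ Λ
  have hterm : ∀ p, sectionFiber k (periodise Λ k fun x => gaussKernel τ₁ τ₂ (x, y) ^ k) q p *
      latticeChar k g p = ∑' l : Λ × Λ, gaussFiber τ₁ τ₂ k y g q l.2 (l.1 + p) := fun p => by
    rw [sectionFiber, periodise, mul_assoc, ← tsum_mul_right]
    refine tsum_congr fun l => ?_
    rw [← conj_multiplier_mul_gaussKernel hΛ τ₁ τ₂ k y hg l.1.2 l.2.2]
    simp only [mul_assoc]
  have hle : ∀ (p : V) (l : Λ × Λ), ‖gaussFiber τ₁ τ₂ k y g q l.2 (l.1 + p)‖ ≤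
      Real.exp (-(k * c) * (‖(l.1 : V) + ((p, q) - y).1‖ ^ 2 + ‖(l.2 : V) + ((p, q) - y).2‖ ^ 2)) :=
    fun p l => by
      rw [norm_gaussFiber]
      refine (norm_gaussKernel_pow_le h k _ y).trans_eq ?_
      simp only [Prod.fst_sub, Prod.snd_sub, add_sub_assoc]
  have hsum : ∀ p : V, Summable fun l : Λ × Λ =>
      ‖gaussFiber τ₁ τ₂ k y g q l.2 (l.1 + p)‖ := fun p =>
      Summable.of_nonneg_of_le (fun _ => norm_nonneg _) (hle p)
      (summable_exp_neg_mul_norm_add_sq_prod hkc ((p, q) - y))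
  have hHS := hasSum_setIntegral_latticeCell γ
    (f := fun (l : Λ × Λ) p => gaussFiber τ₁ τ₂ k y g q l.2 (l.1 + p))
    (fun l => (continuous_gaussFiber τ₁ τ₂ k y g q l.2).comp (continuous_const.add continuous_id))
    (M := M) hsum fun p => ((hsum p).tsum_le_tsum (hle p)
      (summable_exp_neg_mul_norm_add_sq_prod hkc ((p, q) - y))).trans (hM _)
  rw [fiberCoef]
  simp only [hterm]
  rw [← hHS.tsum_eq, ← (Equiv.prodComm Λ Λ).tsum_eq]
  refine ((Equiv.prodComm Λ Λ).summable_iff.2 hHS.summable).tsum_prod.trans ?_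
  simp only [Function.comp_def, Equiv.prodComm_apply, Prod.swap]
  simp only [tsum_setIntegral_latticeCell_add γ (integrable_gaussFiber τ₁ τ₂ hk y g q _),
    integral_gaussFiber τ₁ τ₂ hk]
  rw [tsum_mul_left, tsum_mul_left, thetaSection_eq_tsum, Complex.conj_tsum]

end GaussFiber

/-! ### The kernel as a Gaussian sum -/

section KernelIdentity

variable {V : Type*} [NormedAddCommGroup V] [InnerProductSpace ℝ V]

/-- The square root in the Gaussian integral of complex width is the principal one, as in the symbol,
and their product is the positive square root of a positive number. -/
theorem symbol_mul_cpow (τ₁ τ₂ : ℍ) {k : ℕ} (hk : k ≠ 0) : symbol V τ₁ τ₂ *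
    (Real.pi / (Complex.I * Real.pi * k / ((τ₂ : ℂ) - conj (τ₁ : ℂ)))) ^ ((finrank ℝ V : ℂ) / 2) =
      (Real.sqrt (2 * τ₁.im / k) ^ finrank ℝ V : ℝ) := by
  have hw := sub_conj_ne_zero τ₁ τ₂
  have hre := symbol_base_re_pos τ₁ τ₂
  rw [symbol]
  rw [coe_sub_conj] at hre ⊢
  set w := (τ₂ : ℂ) - conj (τ₁ : ℂ)
  set z := 2 * (τ₁.im : ℂ) * Complex.I / w with hz
  have him := τ₁.im_pos
  have hk' : (0 : ℝ) < k := by positivity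
  have hr : 0 < 2 * τ₁.im / k := by positivity
  have hz0 : z ≠ 0 := fun h => by rw [h] at hre; simp at hre
  have harg : z.arg ≠ Real.pi := Complex.slitPlane_arg_ne_pi (Or.inl hre)
  have e : Real.pi / (Complex.I * Real.pi * k / w) = ((2 * τ₁.im / k : ℝ) : ℂ) * z⁻¹ := by
    have h1 : (Real.pi : ℂ) ≠ 0 := by exact_mod_cast Real.pi_ne_zero
    have h2 : (k : ℂ) ≠ 0 := by exact_mod_cast hk
    have h3 : (τ₁.im : ℂ) ≠ 0 := by exact_mod_cast him.ne'
    rw [hz]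
    push_cast
    field_simp
  have hne : ((2 * τ₁.im / k : ℝ) : ℂ) * z⁻¹ ≠ 0 :=
    mul_ne_zero (by exact_mod_cast hr.ne') (inv_ne_zero hz0)
  rw [e, Complex.cpow_def_of_ne_zero hz0, Complex.cpow_def_of_ne_zero hne,
    Complex.log_ofReal_mul hr (inv_ne_zero hz0), Complex.log_inv z harg, ← Complex.exp_add,
    Real.sqrt_eq_rpow, ← Real.rpow_mul_natCast hr.le, Real.rpow_def_of_pos hr, Complex.ofReal_exp]
  congr 1
  push_cast
  ring

variable {Λ : Submodule ℤ V} [FiniteDimensional ℝ V] [DiscreteTopology Λ] [IsZLattice ℝ Λ]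
  [MeasurableSpace V] [BorelSpace V]

/-- The Schwartz kernel of `Ψ_{τ₁,τ₂,k}` is a multiple of the periodisation of the `k`-th power of
the Gaussian kernel: both sides have the same Fourier coefficients. -/
theorem thetaKernel_eq_periodise (hΛ : ∀ a ∈ Λ, ∀ b ∈ Λ, ∃ m : ℤ, ⟪a, b⟫_ℝ = m)
    (γ : Basis (Fin (finrank ℝ V)) ℤ Λ) (τ₁ τ₂ : ℍ) {k : ℕ} (hk : k ≠ 0)
    [Fintype (ThetaIndex Λ k)] (x y : V × V) :
    (Real.sqrt (k / (2 * Real.pi)) ^ finrank ℝ V : ℝ) * ∑ μ : ThetaIndex Λ k,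
        thetaSection Λ τ₂ k (μ.out : V) x * conj (thetaSection Λ τ₁ k (μ.out : V) y) =
      ((k : ℂ) / (2 * Real.pi)) ^ finrank ℝ V * (symbol V τ₁ τ₂ / halfFormNormSq γ τ₁) *
        periodise Λ k (fun x => gaussKernel τ₁ τ₂ (x, y) ^ k) x := by
  have hsym := symbol_mul_cpow (V := V) τ₁ τ₂ hk
  set A := (Real.pi / (Complex.I * Real.pi * k / ((τ₂ : ℂ) - conj (τ₁ : ℂ)))) ^
    ((finrank ℝ V : ℂ) / 2) with hA
  set R := periodise Λ k fun x => gaussKernel τ₁ τ₂ (x, y) ^ k with hR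
  have hvol := volume_real_latticeCell_pos γ
  have him := τ₁.im_pos
  have hπ := Real.pi_pos
  have hk' : (0 : ℝ) < k := by positivity
  have hRc : Continuous R := continuous_periodise_gaussKernel Λ τ₁ τ₂ hk y
  have hcont : ∀ μ : ThetaIndex Λ k, Continuous (thetaSection Λ τ₂ k (μ.out : V)) := fun μ =>
    (thetaSection_mem_quantumSpace Λ hΛ τ₂ hk (Subtype.coe_prop _)).1.continuous
  let c : ThetaIndex Λ k → ℂ := fun μ => A * conj (thetaSection Λ τ₁ k (μ.out : V) y)
  let T : V × V → ℂ := ∑ μ : ThetaIndex Λ k, c μ • thetaSection Λ τ₂ k (μ.out : V)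
  have hTc : Continuous T := by
    have := continuous_finsetSum Finset.univ fun μ _ => (hcont μ).const_smul (c μ)
    simpa only [T, ← Finset.sum_apply] using this
  have hTinv : IsInvariant Λ k T := fun l h1 h2 x => by
    simp only [T, Finset.sum_apply, Pi.smul_apply, smul_eq_mul, Finset.mul_sum]
    refine Finset.sum_congr rfl fun μ _ => ?_
    rw [(thetaSection_mem_quantumSpace Λ hΛ τ₂ hk (Subtype.coe_prop μ.out)).2.1 l h1 h2 x]
    ring
  have hRinv : IsInvariant Λ k R := isInvariant_periodise Λ hΛ k _
  have hVinv : IsInvariant Λ k (((volume : Measure V).real (latticeCell γ) : ℂ) • R) :=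
    fun l h1 h2 x => by
      rw [Pi.smul_apply, Pi.smul_apply, hRinv l h1 h2 x, smul_eq_mul, smul_eq_mul, mul_left_comm]
  have hcl : ∀ g : scaledDual Λ k, c (Submodule.Quotient.mk g) =
      A * conj (thetaSection Λ τ₁ k (g : V) y) := fun g => by
    have h := thetaSection_add_of_mem Λ τ₁ k (g : V) (coe_out_sub_mem g)
    rw [add_sub_cancel] at h
    simp only [c, h]
  have hmain : ((volume : Measure V).real (latticeCell γ) : ℂ) * R x = T x := by
    obtain ⟨p, q⟩ := x
    refine eq_of_fiberCoef_eq γ hk (hRc.const_smul _) hTc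
      (fun l hl p => sectionFiber_add hVinv q hl p)
      (fun l hl p => sectionFiber_add hTinv q hl p) (fun g hg => ?_) p
    rw [fiberCoef_smul, fiberCoef_periodise_gaussKernel hΛ γ τ₁ τ₂ hk y hg,
      fiberCoef_sum_thetaSection hΛ γ τ₂ hk c ⟨g, hg⟩ q, hcl, ← hA]
    ring
  have hT : T x = A * ∑ μ : ThetaIndex Λ k,
      thetaSection Λ τ₂ k (μ.out : V) x * conj (thetaSection Λ τ₁ k (μ.out : V) y) := by
    simp only [T, c, Finset.sum_apply, Pi.smul_apply, smul_eq_mul, Finset.mul_sum]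
    refine Finset.sum_congr rfl fun μ _ => ?_
    ring
  have hsq : Real.sqrt (k / (2 * Real.pi)) * Real.sqrt (τ₁.im / Real.pi) =
      k / (2 * Real.pi) * Real.sqrt (2 * τ₁.im / k) := by
    have h5 : k / (2 * Real.pi) * (τ₁.im / Real.pi) =
        (k / (2 * Real.pi)) ^ 2 * (2 * τ₁.im / k) := by
      field_simp
    rw [← Real.sqrt_mul (by positivity), h5, Real.sqrt_mul (by positivity),
      Real.sqrt_sq (by positivity)]
  have hsq' : ((Real.sqrt (k / (2 * Real.pi)) ^ finrank ℝ V : ℝ) : ℂ) *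
      (Real.sqrt (τ₁.im / Real.pi) ^ finrank ℝ V : ℝ) =
      ((k : ℂ) / (2 * Real.pi)) ^ finrank ℝ V * (Real.sqrt (2 * τ₁.im / k) ^ finrank ℝ V : ℝ) := by
    rw [← Complex.ofReal_mul, ← mul_pow, hsq, mul_pow]
    push_cast
    rfl
  have h1 : ((Real.sqrt (τ₁.im / Real.pi) ^ finrank ℝ V : ℝ) : ℂ) ≠ 0 := by
    have : 0 < Real.sqrt (τ₁.im / Real.pi) ^ finrank ℝ V := by positivity
    exact_mod_cast this.ne'
  have h2 : ((volume : Measure V).real (latticeCell γ) : ℂ) ≠ 0 := by exact_mod_cast hvol.ne'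
  rw [← hsym] at hsq'
  rw [hT] at hmain
  rw [halfFormNormSq_eq, Complex.ofReal_div, div_div_eq_mul_div, ← mul_right_inj' h1]
  generalize ∑ μ : ThetaIndex Λ k, thetaSection Λ τ₂ k (μ.out : V) x *
    conj (thetaSection Λ τ₁ k (μ.out : V) y) = S at hmain ⊢
  generalize ((Real.sqrt (τ₁.im / Real.pi) ^ finrank ℝ V : ℝ) : ℂ) = s at *
  generalize ((Real.sqrt (k / (2 * Real.pi)) ^ finrank ℝ V : ℝ) : ℂ) = s' at *
  field_simp
  linear_combination S * hsq' - ((k : ℂ) / (2 * Real.pi)) ^ finrank ℝ V * symbol V τ₁ τ₂ * hmain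

end KernelIdentity

/-! ### The section `E` of `L ⊠ L̄` -/

section Cutoff

variable {V : Type*} [NormedAddCommGroup V]

/-- A discrete lattice meets a small ball only in `0`. The factor `4` leaves room for the
neighbourhoods of the support of a cutoff function. -/
theorem exists_contDiffBump (Λ : Submodule ℤ V) [DiscreteTopology Λ] :
    ∃ χ : ContDiffBump (0 : V × V), ∀ l : Λ × Λ, ‖((l.1 : V), (l.2 : V))‖ < 4 * χ.rOut → l = 0 := by
  have h : IsOpen {(0 : Λ)} := isOpen_discrete _
  obtain ⟨ε, hε, h⟩ := Metric.isOpen_singleton_iff.1 h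
  refine ⟨⟨ε / 8, ε / 4, by positivity, by linarith⟩, fun l hl => ?_⟩
  change _ < 4 * (ε / 4) at hl
  rw [mul_div_cancel₀ _ (by norm_num)] at hl
  refine Prod.ext (h _ ?_) (h _ ?_)
  · rw [dist_zero_right]
    exact (norm_fst_le ((l.1 : V), (l.2 : V))).trans_lt hl
  · rw [dist_zero_right]
    exact (norm_snd_le ((l.1 : V), (l.2 : V))).trans_lt hl

theorem rOut_le_norm_of_ne {Λ : Submodule ℤ V} {χ : ContDiffBump (0 : V × V)}
    (hχ : ∀ l : Λ × Λ, ‖((l.1 : V), (l.2 : V))‖ < 4 * χ.rOut → l = 0)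
    {l m : Λ × Λ} {u : V × V} (hl : ‖((l.1 : V), (l.2 : V)) + u‖ < 2 * χ.rOut) (hm : m ≠ l) :
    χ.rOut ≤ ‖((m.1 : V), (m.2 : V)) + u‖ := by
  by_contra! h
  refine hm (sub_eq_zero.1 (hχ (m - l) ?_))
  have e : (((m - l).1 : V), ((m - l).2 : V)) =
      (((m.1 : V), (m.2 : V)) + u) - (((l.1 : V), (l.2 : V)) + u) := by
    rw [add_sub_add_right_eq_sub]
    rfl
  have hr := χ.rOut_pos
  rw [e]
  linarith [norm_sub_le (((m.1 : V), (m.2 : V)) + u) (((l.1 : V), (l.2 : V)) + u)]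

end Cutoff

section TorusKernel

variable {V : Type*} [NormedAddCommGroup V] [InnerProductSpace ℝ V]

theorem contDiff_multiplier (l : V × V) : ContDiff ℝ ∞ (multiplier l) := by
  have h : ContDiff ℝ ∞ fun x : V × V => ((symplForm V l x : ℝ) : ℂ) := by
    simp only [symplForm_apply]
    refine Complex.ofRealCLM.contDiff.comp (contDiff_const.mul (ContDiff.sub ?_ ?_))
    · exact contDiff_const.inner ℝ contDiff_snd
    · exact contDiff_const.inner ℝ contDiff_fst
  exact contDiff_const.mul (contDiff_const.mul h).cexp

theorem vanishesOnDiagonal_of_eventuallyEq_zero {g : (V × V) × (V × V) → ℂ}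
    (h : ∀ x, g =ᶠ[nhds (x, x)] 0) : VanishesOnDiagonal g := fun x m => by
  have := (h x).iteratedFDeriv ℝ m
  rw [this.eq_of_nhds]
  simp

variable [FiniteDimensional ℝ V]

variable (Λ : Submodule ℤ V) (χ : ContDiffBump (0 : V × V)) (τ₁ τ₂ : ℍ)

/-- The Gaussian kernel, cut off away from the diagonal. -/
noncomputable def cutKernel (z : (V × V) × (V × V)) : ℂ :=
  (χ (z.1 - z.2) : ℂ) * gaussKernel τ₁ τ₂ z

/-- The section of `L ⊠ L̄` over `T² × T²` obtained by periodisation of `cutKernel`. -/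
noncomputable def torusKernel (z : (V × V) × (V × V)) : ℂ :=
  periodise Λ 1 (fun x => cutKernel χ τ₁ τ₂ (x, z.2)) z.1

theorem contDiff_cutKernel : ContDiff ℝ ∞ (cutKernel χ τ₁ τ₂) := by
  have h : ContDiff ℝ ∞ fun z : (V × V) × (V × V) => ((χ (z.1 - z.2) : ℝ) : ℂ) :=
    Complex.ofRealCLM.contDiff.comp (χ.contDiff.comp (contDiff_fst.sub contDiff_snd))
  exact h.mul (contDiff_gaussKernel τ₁ τ₂)

theorem cutKernel_add (l x y : V × V) : cutKernel χ τ₁ τ₂ (l + x, l + y) =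
    multiplier l x * conj (multiplier l y) * cutKernel χ τ₁ τ₂ (x, y) := by
  rw [cutKernel, cutKernel, gaussKernel_add, add_sub_add_left_eq_sub]
  ring

theorem cutKernel_eq_zero {z : (V × V) × (V × V)} (h : χ.rOut ≤ ‖z.1 - z.2‖) :
    cutKernel χ τ₁ τ₂ z = 0 := by
  rw [cutKernel, χ.zero_of_le_dist (by rwa [dist_zero_right]), Complex.ofReal_zero, zero_mul]

theorem isBoxInvariant_torusKernel (hΛ : ∀ a ∈ Λ, ∀ b ∈ Λ, ∃ m : ℤ, ⟪a, b⟫_ℝ = m) :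
    IsBoxInvariant Λ (torusKernel Λ χ τ₁ τ₂) := by
  intro l l' h1 h2 h1' h2' x y
  have hx := isInvariant_periodise Λ hΛ 1 (fun x => cutKernel χ τ₁ τ₂ (x, l' + y)) l h1 h2 x
  rw [pow_one] at hx
  rw [torusKernel]
  refine hx.trans ?_
  rw [mul_assoc]
  congr 1
  rw [torusKernel, periodise, periodise, ← tsum_mul_left,
    ← (Equiv.addLeft ((⟨l'.1, h1'⟩, ⟨l'.2, h2'⟩) : Λ × Λ)).tsum_eq]
  refine tsum_congr fun m => ?_
  have e : ((((⟨l'.1, h1'⟩, ⟨l'.2, h2'⟩) + m : Λ × Λ).1 : V),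
      (((⟨l'.1, h1'⟩, ⟨l'.2, h2'⟩) + m : Λ × Λ).2 : V)) = l' + ((m.1 : V), (m.2 : V)) := rfl
  rw [Equiv.coe_addLeft, e, multiplier_add hΛ ⟨h1', h2'⟩ ⟨m.1.2, m.2.2⟩, add_assoc, cutKernel_add,
    pow_one, pow_one, map_mul]
  linear_combination (conj (multiplier ((m.1 : V), (m.2 : V)) x) * conj (multiplier l' y) *
    cutKernel χ τ₁ τ₂ (((m.1 : V), (m.2 : V)) + x, y)) *
      conj_multiplier_mul_self l' (((m.1 : V), (m.2 : V)) + x)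

variable {Λ χ}

theorem torusKernel_eq_of_norm_lt
    (hχ : ∀ l : Λ × Λ, ‖((l.1 : V), (l.2 : V))‖ < 4 * χ.rOut → l = 0) (l : Λ × Λ)
    {z : (V × V) × (V × V)} (hl : ‖((l.1 : V), (l.2 : V)) + (z.1 - z.2)‖ < 2 * χ.rOut) :
    torusKernel Λ χ τ₁ τ₂ z = conj (multiplier ((l.1 : V), (l.2 : V)) z.1) *
      cutKernel χ τ₁ τ₂ (((l.1 : V), (l.2 : V)) + z.1, z.2) := by
  rw [torusKernel, periodise, tsum_eq_single l fun m hm => ?_, pow_one]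
  rw [cutKernel_eq_zero, mul_zero]
  rw [add_sub_assoc]
  exact rOut_le_norm_of_ne hχ hl hm

theorem torusKernel_eq_zero {z : (V × V) × (V × V)}
    (h : ∀ l : Λ × Λ, χ.rOut ≤ ‖((l.1 : V), (l.2 : V)) + (z.1 - z.2)‖) :
    torusKernel Λ χ τ₁ τ₂ z = 0 := by
  rw [torusKernel, periodise, ← tsum_zero]
  refine tsum_congr fun l => ?_
  rw [cutKernel_eq_zero, mul_zero]
  rw [add_sub_assoc]
  exact h l

theorem contDiff_torusKernel
    (hχ : ∀ l : Λ × Λ, ‖((l.1 : V), (l.2 : V))‖ < 4 * χ.rOut → l = 0) :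
    ContDiff ℝ ∞ (torusKernel Λ χ τ₁ τ₂) := by
  have hr := χ.rOut_pos
  refine contDiff_iff_contDiffAt.2 fun z₀ => ?_
  by_cases h : ∃ l : Λ × Λ, ‖((l.1 : V), (l.2 : V)) + (z₀.1 - z₀.2)‖ < 2 * χ.rOut
  · obtain ⟨l, hl⟩ := h
    have hc : ContDiff ℝ ∞ fun z : (V × V) × (V × V) =>
        conj (multiplier ((l.1 : V), (l.2 : V)) z.1) *
          cutKernel χ τ₁ τ₂ (((l.1 : V), (l.2 : V)) + z.1, z.2) :=
      (Complex.conjCLE.contDiff.comp ((contDiff_multiplier _).comp contDiff_fst)).mul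
        ((contDiff_cutKernel χ τ₁ τ₂).comp
          ((contDiff_const.add contDiff_fst).prodMk contDiff_snd))
    refine hc.contDiffAt.congr_of_eventuallyEq ?_
    have ho : IsOpen {z : (V × V) × (V × V) |
        ‖((l.1 : V), (l.2 : V)) + (z.1 - z.2)‖ < 2 * χ.rOut} :=
      isOpen_lt (by fun_prop) continuous_const
    filter_upwards [ho.mem_nhds hl] with z hz
    exact torusKernel_eq_of_norm_lt τ₁ τ₂ hχ l hz
  · push Not at h
    refine (contDiffAt_const (c := (0 : ℂ))).congr_of_eventuallyEq ?_
    have ho : IsOpen {z : (V × V) × (V × V) | ‖(z.1 - z.2) - (z₀.1 - z₀.2)‖ < χ.rOut} :=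
      isOpen_lt (by fun_prop) continuous_const
    filter_upwards [ho.mem_nhds (by simpa using hr)] with z hz
    refine torusKernel_eq_zero τ₁ τ₂ fun l => ?_
    have h1 := h l
    have h2 := norm_sub_le (((l.1 : V), (l.2 : V)) + (z.1 - z.2)) ((z.1 - z.2) - (z₀.1 - z₀.2))
    have e : ((l.1 : V), (l.2 : V)) + (z.1 - z.2) - ((z.1 - z.2) - (z₀.1 - z₀.2)) =
        ((l.1 : V), (l.2 : V)) + (z₀.1 - z₀.2) := by abel
    rw [e] at h2
    have h3 : ‖(z.1 - z.2) - (z₀.1 - z₀.2)‖ < χ.rOut := hz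
    linarith

theorem torusKernel_eq_gaussKernel
    (hχ : ∀ l : Λ × Λ, ‖((l.1 : V), (l.2 : V))‖ < 4 * χ.rOut → l = 0) {z : (V × V) × (V × V)}
    (hz : ‖z.1 - z.2‖ < χ.rIn) : torusKernel Λ χ τ₁ τ₂ z = gaussKernel τ₁ τ₂ z := by
  have h1 := χ.rIn_lt_rOut
  have h2 := χ.rIn_pos
  have h0 : (((0 : Λ × Λ).1 : V), ((0 : Λ × Λ).2 : V)) = 0 := rfl
  rw [torusKernel_eq_of_norm_lt τ₁ τ₂ hχ 0 (by rw [h0, zero_add]; linarith), h0, zero_add,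
    cutKernel, χ.one_of_mem_closedBall (by simpa using hz.le)]
  simp [multiplier]

theorem torusKernel_self (hχ : ∀ l : Λ × Λ, ‖((l.1 : V), (l.2 : V))‖ < 4 * χ.rOut → l = 0)
    (x : V × V) : torusKernel Λ χ τ₁ τ₂ (x, x) = 1 := by
  rw [torusKernel_eq_gaussKernel τ₁ τ₂ hχ (by simpa using χ.rIn_pos), gaussKernel_self]

theorem norm_torusKernel_lt_one
    (hχ : ∀ l : Λ × Λ, ‖((l.1 : V), (l.2 : V))‖ < 4 * χ.rOut → l = 0) {x y : V × V}
    (hxy : ¬(x.1 - y.1 ∈ Λ ∧ x.2 - y.2 ∈ Λ)) : ‖torusKernel Λ χ τ₁ τ₂ (x, y)‖ < 1 := by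
  by_cases h : ∃ l : Λ × Λ, ‖((l.1 : V), (l.2 : V)) + (x - y)‖ < 2 * χ.rOut
  · obtain ⟨l, hl⟩ := h
    obtain ⟨c, hc, hG⟩ := exists_norm_gaussKernel_le (V := V) τ₁ τ₂
    rw [torusKernel_eq_of_norm_lt τ₁ τ₂ hχ l hl, norm_mul, RCLike.norm_conj, norm_multiplier,
      one_mul, cutKernel, norm_mul, Complex.norm_real, Real.norm_eq_abs, abs_of_nonneg χ.nonneg]
    refine (mul_le_of_le_one_left (norm_nonneg _) χ.le_one).trans_lt ((hG _ _).trans_lt ?_)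
    rw [Real.exp_lt_one_iff, neg_mul, neg_lt_zero]
    refine mul_pos hc ?_
    by_contra! h0
    change ‖(l.1 : V) + x.1 - y.1‖ ^ 2 + ‖(l.2 : V) + x.2 - y.2‖ ^ 2 ≤ 0 at h0
    have h1 := sq_nonneg ‖(l.1 : V) + x.1 - y.1‖
    have h2 := sq_nonneg ‖(l.2 : V) + x.2 - y.2‖
    have h3 : (l.1 : V) + x.1 - y.1 = 0 := norm_eq_zero.1 (pow_eq_zero_iff two_ne_zero |>.1
      (le_antisymm (by linarith) h1))
    have h4 : (l.2 : V) + x.2 - y.2 = 0 := norm_eq_zero.1 (pow_eq_zero_iff two_ne_zero |>.1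
      (le_antisymm (by linarith) h2))
    refine hxy ⟨?_, ?_⟩
    · rw [add_sub_assoc, add_comm, add_eq_zero_iff_eq_neg] at h3
      rw [h3]
      exact neg_mem l.1.2
    · rw [add_sub_assoc, add_comm, add_eq_zero_iff_eq_neg] at h4
      rw [h4]
      exact neg_mem l.2.2
  · push Not at h
    have hr := χ.rOut_pos
    rw [torusKernel_eq_zero τ₁ τ₂ fun l => by have := h l; dsimp only; linarith, norm_zero]
    exact one_pos

theorem vanishesOnDiagonal_boxDbar_torusKernel
    (hχ : ∀ l : Λ × Λ, ‖((l.1 : V), (l.2 : V))‖ < 4 * χ.rOut → l = 0) (Z : (V × V) × (V × V)) :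
    VanishesOnDiagonal fun z => boxDbar τ₁ τ₂ (torusKernel Λ χ τ₁ τ₂) z Z := by
  refine vanishesOnDiagonal_of_eventuallyEq_zero fun x => ?_
  have ho : IsOpen {z : (V × V) × (V × V) | ‖z.1 - z.2‖ < χ.rIn} :=
    isOpen_lt (by fun_prop) continuous_const
  filter_upwards [ho.mem_nhds (by simpa using χ.rIn_pos)] with z hz
  have he : torusKernel Λ χ τ₁ τ₂ =ᶠ[nhds z] gaussKernel τ₁ τ₂ := by
    filter_upwards [ho.mem_nhds hz] with z' hz'
    exact torusKernel_eq_gaussKernel τ₁ τ₂ hχ hz'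
  have := boxDbar_gaussKernel τ₁ τ₂ z Z
  rw [boxDbar, boxNabla, boxNabla] at this ⊢
  rw [he.fderiv_eq, he.eq_of_nhds]
  exact this

/-- Since at most one term of `torusKernel` is nonzero at each point, its powers can be computed
termwise. -/
theorem torusKernel_pow (hχ : ∀ l : Λ × Λ, ‖((l.1 : V), (l.2 : V))‖ < 4 * χ.rOut → l = 0) {k : ℕ}
    (hk : k ≠ 0) (z : (V × V) × (V × V)) : torusKernel Λ χ τ₁ τ₂ z ^ k =
      periodise Λ k (fun x => cutKernel χ τ₁ τ₂ (x, z.2) ^ k) z.1 := by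
  by_cases h : ∃ l : Λ × Λ, ‖((l.1 : V), (l.2 : V)) + (z.1 - z.2)‖ < 2 * χ.rOut
  · obtain ⟨l, hl⟩ := h
    rw [torusKernel_eq_of_norm_lt τ₁ τ₂ hχ l hl, mul_pow, periodise,
      tsum_eq_single l fun m hm => ?_]
    rw [cutKernel_eq_zero, zero_pow hk, mul_zero]
    rw [add_sub_assoc]
    exact rOut_le_norm_of_ne hχ hl hm
  · push Not at h
    have hr := χ.rOut_pos
    have h' : ∀ l : Λ × Λ, χ.rOut ≤ ‖((l.1 : V), (l.2 : V)) + (z.1 - z.2)‖ := fun l => by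
      linarith [h l]
    rw [torusKernel_eq_zero τ₁ τ₂ h', zero_pow hk, periodise, ← tsum_zero]
    refine tsum_congr fun l => ?_
    rw [cutKernel_eq_zero, zero_pow hk, mul_zero]
    rw [add_sub_assoc]
    exact h' l

/-- Away from the diagonal the terms of the Gaussian sum are exponentially small, so that the cutoff
has no effect modulo `O(k^{-∞})`. -/
theorem exists_norm_periodise_sub_torusKernel_pow_le [DiscreteTopology Λ] [IsZLattice ℝ Λ]
    (hχ : ∀ l : Λ × Λ, ‖((l.1 : V), (l.2 : V))‖ < 4 * χ.rOut → l = 0) :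
    ∃ a C : ℝ, 0 < a ∧ ∀ (k : ℕ) (_ : k ≠ 0) (z : (V × V) × (V × V)),
      ‖periodise Λ k (fun x => gaussKernel τ₁ τ₂ (x, z.2) ^ k) z.1 - torusKernel Λ χ τ₁ τ₂ z ^ k‖ ≤
        C * Real.exp (-a * k) := by
  obtain ⟨c, hc, hG⟩ := exists_norm_gaussKernel_le (V := V) τ₁ τ₂
  obtain ⟨M, hM⟩ := exists_tsum_exp_neg_mul_norm_add_sq_prod_le Λ hc
  have hr := χ.rIn_pos
  refine ⟨c * χ.rIn ^ 2, Real.exp (c * χ.rIn ^ 2) * M, by positivity, fun k hk z => ?_⟩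
  have hk1 : (1 : ℝ) ≤ k := by exact_mod_cast Nat.one_le_iff_ne_zero.2 hk
  have hsG : Summable fun l : Λ × Λ => conj (multiplier ((l.1 : V), (l.2 : V)) z.1) ^ k *
      gaussKernel τ₁ τ₂ (((l.1 : V), (l.2 : V)) + z.1, z.2) ^ k :=
    Summable.of_norm_bounded (summable_exp_neg_mul_norm_add_sq_prod (Λ := Λ) (c := k * c)
      (by positivity) (z.1 - z.2)) fun l => norm_conj_multiplier_pow_mul hG k z.2 _ z.1
  have hcut : ∀ x y : V × V, cutKernel χ τ₁ τ₂ (x, y) ^ k =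
      (χ (x - y) : ℂ) ^ k * gaussKernel τ₁ τ₂ (x, y) ^ k := fun x y => by
    rw [cutKernel, mul_pow]
  have hχk : ∀ u : V × V, 0 ≤ χ u ^ k ∧ χ u ^ k ≤ 1 := fun u =>
    ⟨pow_nonneg χ.nonneg k, pow_le_one₀ χ.nonneg χ.le_one⟩
  have hsC : Summable fun l : Λ × Λ => conj (multiplier ((l.1 : V), (l.2 : V)) z.1) ^ k *
      cutKernel χ τ₁ τ₂ (((l.1 : V), (l.2 : V)) + z.1, z.2) ^ k :=
    Summable.of_norm_bounded hsG.norm fun l => by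
      rw [hcut, mul_left_comm, norm_mul, ← Complex.ofReal_pow, Complex.norm_real, Real.norm_eq_abs,
        abs_of_nonneg (hχk _).1]
      exact mul_le_of_le_one_left (norm_nonneg _) (hχk _).2
  rw [torusKernel_pow τ₁ τ₂ hχ hk, periodise, periodise, ← hsG.tsum_sub hsC]
  have hle : ∀ l : Λ × Λ, ‖conj (multiplier ((l.1 : V), (l.2 : V)) z.1) ^ k *
      gaussKernel τ₁ τ₂ (((l.1 : V), (l.2 : V)) + z.1, z.2) ^ k -
      conj (multiplier ((l.1 : V), (l.2 : V)) z.1) ^ k *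
        cutKernel χ τ₁ τ₂ (((l.1 : V), (l.2 : V)) + z.1, z.2) ^ k‖ ≤
      Real.exp (-(c * χ.rIn ^ 2) * (k - 1)) * Real.exp (-c *
        (‖(l.1 : V) + (z.1 - z.2).1‖ ^ 2 + ‖(l.2 : V) + (z.1 - z.2).2‖ ^ 2)) := fun l => by
    set u := ((l.1 : V), (l.2 : V)) + z.1 - z.2 with hu
    have e : conj (multiplier ((l.1 : V), (l.2 : V)) z.1) ^ k *
        gaussKernel τ₁ τ₂ (((l.1 : V), (l.2 : V)) + z.1, z.2) ^ k -
        conj (multiplier ((l.1 : V), (l.2 : V)) z.1) ^ k *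
          cutKernel χ τ₁ τ₂ (((l.1 : V), (l.2 : V)) + z.1, z.2) ^ k =
        ((1 - χ u ^ k : ℝ) : ℂ) * (conj (multiplier ((l.1 : V), (l.2 : V)) z.1) ^ k *
          gaussKernel τ₁ τ₂ (((l.1 : V), (l.2 : V)) + z.1, z.2) ^ k) := by
      rw [hcut]
      push_cast
      ring
    rw [e, norm_mul, Complex.norm_real, Real.norm_eq_abs, abs_of_nonneg (sub_nonneg.2 (hχk u).2)]
    have hG' := norm_conj_multiplier_pow_mul hG k z.2 ((l.1 : V), (l.2 : V)) z.1
    by_cases hin : ‖u‖ ≤ χ.rIn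
    · rw [χ.one_of_mem_closedBall (by simpa using hin), one_pow, sub_self, zero_mul]
      positivity
    · push Not at hin
      have h1 : χ.rIn ^ 2 ≤
          ‖(l.1 : V) + (z.1.1 - z.2.1)‖ ^ 2 + ‖(l.2 : V) + (z.1.2 - z.2.2)‖ ^ 2 := by
        have h2 : ‖u‖ = max ‖(l.1 : V) + (z.1.1 - z.2.1)‖ ‖(l.2 : V) + (z.1.2 - z.2.2)‖ := by
          rw [Prod.norm_def, hu, Prod.fst_sub, Prod.snd_sub, Prod.fst_add, Prod.snd_add,
            add_sub_assoc, add_sub_assoc]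
        rw [h2] at hin
        rcases lt_max_iff.1 hin with h3 | h3
        · nlinarith [sq_nonneg ‖(l.2 : V) + (z.1.2 - z.2.2)‖]
        · nlinarith [sq_nonneg ‖(l.1 : V) + (z.1.1 - z.2.1)‖]
      refine (mul_le_of_le_one_left (norm_nonneg _) (by linarith [(hχk u).1])).trans (hG'.trans ?_)
      rw [← Real.exp_add, Real.exp_le_exp]
      simp only [Prod.fst_sub, Prod.snd_sub]
      nlinarith [mul_le_mul_of_nonneg_left h1 (mul_nonneg hc.le (sub_nonneg.2 hk1))]
  have hs := (summable_exp_neg_mul_norm_add_sq_prod (Λ := Λ) hc (z.1 - z.2)).mul_left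
    (Real.exp (-(c * χ.rIn ^ 2) * (k - 1)))
  refine (tsum_of_norm_bounded hs.hasSum hle).trans ?_
  rw [tsum_mul_left]
  calc _ ≤ Real.exp (-(c * χ.rIn ^ 2) * (k - 1)) * M := by
        gcongr
        exact hM _
    _ = _ := by
        rw [mul_right_comm, ← Real.exp_add]
        congr 2
        ring

end TorusKernel

/-! ### The asymptotics of the kernel -/

section Asymptotics

theorem exists_pow_mul_exp_neg_le {a : ℝ} (ha : 0 < a) (m N : ℕ) :
    ∃ C : ℝ, 0 ≤ C ∧ ∀ k : ℕ+, (k : ℝ) ^ m * Real.exp (-a * k) ≤ C / (k : ℝ) ^ N := by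
  refine ⟨(m + N).factorial / a ^ (m + N), by positivity, fun k => ?_⟩
  have hk : (0 : ℝ) < k := by exact_mod_cast k.pos
  have h := Real.pow_div_factorial_le_exp (a * k) (by positivity) (m + N)
  have h3 : (0 : ℝ) < (m + N).factorial := by positivity
  rw [neg_mul, Real.exp_neg]
  calc (k : ℝ) ^ m * (Real.exp (a * k))⁻¹
      ≤ (k : ℝ) ^ m * ((a * k) ^ (m + N) / (m + N).factorial)⁻¹ := by gcongr
    _ = _ := by
        rw [mul_pow, pow_add (k : ℝ)]
        field_simp

variable {V : Type*} [NormedAddCommGroup V] [InnerProductSpace ℝ V]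

theorem hasExpansion_const (a : ℂ) :
    HasExpansion (V := V) (fun _ _ => a) fun i _ => if i = 0 then a else 0 := by
  intro N l
  refine ⟨‖a‖, fun k z => ?_⟩
  have hk : (0 : ℝ) < k := by exact_mod_cast k.pos
  -- only the empty partial sum differs from `a`
  rcases N with _ | N
  · simp only [Finset.range_zero, Finset.sum_empty, sub_zero, pow_zero, div_one]
    rcases l with _ | l
    · rw [norm_iteratedFDeriv_zero]
    · rw [iteratedFDeriv_succ_const]
      simp
  · have h : ∀ w : (V × V) × (V × V), a - ∑ i ∈ Finset.range (N + 1),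
        ((k : ℂ) ^ i)⁻¹ * (if i = 0 then a else 0) = 0 := fun w => by
      simp
    rw [show (fun w : (V × V) × (V × V) => a - ∑ i ∈ Finset.range (N + 1),
        ((k : ℂ) ^ i)⁻¹ * (if i = 0 then a else 0)) = fun _ => (0 : ℂ) from funext h]
    simp only [iteratedFDeriv_fun_zero, Pi.zero_apply, norm_zero]
    positivity

theorem vanishesOnDiagonal_funDbar_const (τ₁ τ₂ : ℍ) (a : ℂ) (Z : (V × V) × (V × V)) :
    VanishesOnDiagonal fun z => funDbar τ₁ τ₂ (fun _ => a) z Z :=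
  vanishesOnDiagonal_of_eventuallyEq_zero fun x => Filter.Eventually.of_forall fun z => by
    simp [funDbar]

variable {Λ : Submodule ℤ V} [FiniteDimensional ℝ V] [DiscreteTopology Λ] [IsZLattice ℝ Λ]
  [MeasurableSpace V] [BorelSpace V]

theorem isFourierIntegralOperator_identification
    (hΛ : ∀ a ∈ Λ, ∀ b ∈ Λ, ∃ m : ℤ, ⟪a, b⟫_ℝ = m)
    (γ : Basis (Fin (finrank ℝ V)) ℤ Λ) (τ₁ τ₂ : ℍ)
    {b₁ : ∀ k : ℕ+, Basis (ThetaIndex Λ k) ℂ (quantumSpace Λ τ₁ k)} (h₁ : ∀ k, IsThetaBasis (b₁ k))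
    {b₂ : ∀ k : ℕ+, Basis (ThetaIndex Λ k) ℂ (quantumSpace Λ τ₂ k)}
    (h₂ : ∀ k, IsThetaBasis (b₂ k)) :
    IsFourierIntegralOperator γ τ₁ τ₂ (fun k => (identification (b₁ k) (b₂ k)).toLinearMap)
      fun _ => symbol V τ₁ τ₂ := by
  have hfin : ∀ k : ℕ+, Fintype (ThetaIndex Λ k) := fun k =>
    have := finite_thetaIndex hΛ γ k.ne_zero
    Fintype.ofFinite _
  obtain ⟨χ, hχ⟩ := exists_contDiffBump Λ
  have hH : (halfFormNormSq γ τ₁ : ℂ) ≠ 0 := by exact_mod_cast (halfFormNormSq_pos γ τ₁).ne'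
  set c₀ : ℂ := symbol V τ₁ τ₂ / halfFormNormSq γ τ₁ with hc₀
  refine ⟨isHalfFormIso_symbol γ τ₁ τ₂, fun k z =>
      (Real.sqrt (k / (2 * Real.pi)) ^ finrank ℝ V : ℝ) * ∑ μ : ThetaIndex Λ k,
        thetaSection Λ τ₂ k (μ.out : V) z.1 * conj (thetaSection Λ τ₁ k (μ.out : V) z.2),
    torusKernel Λ χ τ₁ τ₂, fun _ _ => c₀, fun i _ => if i = 0 then c₀ else 0,
    fun k => isSchwartzKernel_identification hΛ γ k.ne_zero (h₁ k) (h₂ k),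
    ⟨contDiff_torusKernel τ₁ τ₂ hχ, isBoxInvariant_torusKernel Λ χ τ₁ τ₂ hΛ⟩,
    fun x y hxy => norm_torusKernel_lt_one τ₁ τ₂ hχ hxy, fun x u hu => ?_,
    vanishesOnDiagonal_boxDbar_torusKernel τ₁ τ₂ hχ,
    fun k => ⟨contDiff_const, fun _ _ _ _ _ _ _ _ => rfl⟩,
    fun i => ⟨contDiff_const, fun _ _ _ _ _ _ _ _ => rfl⟩, hasExpansion_const c₀,
    fun i Z => vanishesOnDiagonal_funDbar_const τ₁ τ₂ _ Z, fun x => ?_, fun N => ?_⟩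
  · rw [torusKernel_self τ₁ τ₂ hχ, Complex.mul_conj, Complex.normSq_eq_norm_sq, hu]
    simp
  · beta_reduce
    rw [if_pos rfl, hc₀, div_mul_cancel₀ _ hH]
  · obtain ⟨a, C, ha, hC⟩ := exists_norm_periodise_sub_torusKernel_pow_le τ₁ τ₂ hχ
    obtain ⟨C', hC', hle⟩ := exists_pow_mul_exp_neg_le ha (finrank ℝ V) N
    refine ⟨‖c₀‖ * |C| * C' / (2 * Real.pi) ^ finrank ℝ V, fun k z => ?_⟩
    have hπ := Real.pi_pos
    have hn : ‖((k : ℂ) / (2 * Real.pi)) ^ finrank ℝ V‖ =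
        (k : ℝ) ^ finrank ℝ V / (2 * Real.pi) ^ finrank ℝ V := by
      rw [norm_pow, norm_div, norm_mul, Complex.norm_real, Complex.norm_natCast, Complex.norm_ofNat,
        Real.norm_eq_abs, abs_of_pos hπ, div_pow]
    have hid := thetaKernel_eq_periodise hΛ γ τ₁ τ₂ k.ne_zero z.1 z.2
    rw [← hc₀] at hid
    beta_reduce
    rw [hid, mul_right_comm _ _ c₀, ← mul_sub, norm_mul, norm_mul, hn]
    calc _ ≤ (k : ℝ) ^ finrank ℝ V / (2 * Real.pi) ^ finrank ℝ V * ‖c₀‖ *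
          (|C| * Real.exp (-a * k)) := by
          gcongr
          refine (hC k k.ne_zero z).trans ?_
          gcongr
          exact le_abs_self C
      _ = ‖c₀‖ * |C| / (2 * Real.pi) ^ finrank ℝ V *
          ((k : ℝ) ^ finrank ℝ V * Real.exp (-a * k)) := by ring
      _ ≤ ‖c₀‖ * |C| / (2 * Real.pi) ^ finrank ℝ V * (C' / (k : ℝ) ^ N) := by
          gcongr
          exact hle k
      _ = _ := by ring

end Asymptotics

end TorusQuantization

theorem mainTheorem3 {V : Type*} [NormedAddCommGroup V] [InnerProductSpace ℝ V]
    [FiniteDimensional ℝ V] [MeasurableSpace V] [BorelSpace V]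
    (Λ : Submodule ℤ V) [DiscreteTopology Λ] [IsZLattice ℝ Λ]
    (hΛ : ∀ a ∈ Λ, ∀ b ∈ Λ, ∃ m : ℤ, ⟪a, b⟫_ℝ = m)
    (γ : Basis (Fin (finrank ℝ V)) ℤ Λ) (τ₁ τ₂ : ℍ) :
    ∃ (b₁ : ∀ k : ℕ+, Basis (ThetaIndex Λ k) ℂ (quantumSpace Λ τ₁ k))
      (b₂ : ∀ k : ℕ+, Basis (ThetaIndex Λ k) ℂ (quantumSpace Λ τ₂ k)),
      (∀ k, IsThetaBasis (b₁ k)) ∧ (∀ k, IsThetaBasis (b₂ k)) ∧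
      (∀ (k : ℕ+) (s t : quantumSpace Λ τ₁ k),
        sectionInner γ τ₂ (identification (b₁ k) (b₂ k) s : V × V → ℂ)
            (identification (b₁ k) (b₂ k) t : V × V → ℂ) =
          sectionInner γ τ₁ (s : V × V → ℂ) (t : V × V → ℂ)) ∧
      IsFourierIntegralOperator γ τ₁ τ₂
        (fun k => (identification (b₁ k) (b₂ k)).toLinearMap)
        (fun _ => symbol V τ₁ τ₂) := by
  have h₁ := fun k : ℕ+ => exists_isThetaBasis hΛ γ τ₁ k.ne_zero
  have h₂ := fun k : ℕ+ => exists_isThetaBasis hΛ γ τ₂ k.ne_zero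
  choose b₁ h₁ using h₁
  choose b₂ h₂ using h₂
  exact ⟨b₁, b₂, h₁, h₂,
    fun k s t => sectionInner_identification hΛ γ k.ne_zero (h₁ k) (h₂ k) s t,
    isFourierIntegralOperator_identification hΛ γ τ₁ τ₂ h₁ h₂⟩
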